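/- **Conventions.** Spinor indices $\alpha,\dot\alpha\in\{0,1\}$ are moved with $v^\alpha=\epsilon^{\alpha\beta}v_\beta$, $v_\alpha=v^\beta\epsilon_{\beta\alpha}$, $\epsilon^{01}=\epsilon_{01}=1$ (same for dotted indices); $\langle p\,q\rangle=p^\alpha q_\alpha$, $[p\,q]=\tilde p^{\dot\alpha}\tilde q_{\dot\alpha}$. A field is a formal power series in commuting variables $(y^\alpha,\tilde y^{\dot\alpha})$ whose coefficients are functions (0-form $\mathsf C$) or 1-forms (1-form $\omega$) on an open set $U\subset\mathbb C^4$. Let $\partial_i,\tilde\partial_i$ be the derivatives with respect to the oscillators $y_i,\tilde y_i$ of the $i$-th argument; after an operator has acted, $y_i=\tilde y_i=0$, and exponentials of operators are expanded order by order. **Vertices of chiral higher-spin gravity at $\Lambda=0$.** Let $n\ge 2$ and $\mho_n=\exp\big(\sum_i[y\,\partial_i]+\sum_{i<j}[\partial_i\,\partial_j]\big)$. Let $\Delta_{n-2}\subset\mathbb R^{2(n-2)}$ be the set of $(u_k,v_k)_{k\le n-2}$ such that, with $u_{n-1}=1-\sum u_k$, $v_{n-1}=1-\sum v_k$, all $u_k,v_k\ge0$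 and $u_1/v_1\le\dots\le u_{n-1}/v_{n-1}$. The sub-vertex with the 1-forms at positions $i<j$ is $$V_{i,j}=(-1)^{i+j-1}\,\mho_n\,\langle\partial_i\,\partial_j\rangle^{n-2}\sum_\sigma\int_{\Delta_{n-2}}\exp\Big(\sum_{k=1}^{n-1}\big(u_k\langle\partial_i\,\partial_{\sigma(k)}\rangle+v_k\langle\partial_j\,\partial_{\sigma(k)}\rangle\big)\Big),\qquad \partial_{\rm out}:=-y .$$ Here $\sigma$ runs over the bijections from $\{1,\dots,n-1\}$ to the legs $\{1,\dots,n\}\setminus\{i,j\}\cup\{\mathrm{out}\}$ for which the slope $u/v$ is ordered increasingly along the sequence of legs $j+1,\dots,n,\mathrm{out},1,\dots,i-1$ and decreasingly along $i+1,\dots,j-1$. The sub-vertices $U_i$, $1\le i\le n$, with the single 1-form at position $i$ are obtained by cyclic duality, i.e. by replacing the undotted spinors in $V$: for $i<n$, $U_i$ is $V_{1,i+1}$ with $y\mapsto-\partial_n$, $\partial_1\mapsto y$, $\partial_{k+1}\mapsto\partial_k$; and $U_n$ is $-V_{n-1,n}$ with $y\mapsto-\partial_1$, $\partial_k\mapsto\partial_{k+1}$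 ($k<n$), $\partial_n\mapsto y$; the factor $\mho_n$ is kept. Set $$\mathcal V_n(\omega,\omega,\mathsf C,\dots,\mathsf C)=\sum_{i<j}V_{i,j}(\dots,\omega_i,\dots,\omega_j,\dots),\qquad \mathcal U_n(\omega,\mathsf C,\dots,\mathsf C)=\sum_iU_i(\dots,\omega_i,\dots),$$ with $\omega$ at the indicated positions, $\mathsf C$ at the others, and the wedge product of the two 1-forms. The equations of chiral higher-spin gravity are $d\omega=\sum_{n\ge2}\mathcal V_n(\omega,\omega,\mathsf C,\dots,\mathsf C)$ and $d\mathsf C=\sum_{n\ge2}\mathcal U_n(\omega,\mathsf C,\dots,\mathsf C)$. **Spin-2 sector.** On $U$ let $h_{\alpha\dot\alpha}$ be a holomorphic coframe and $\varpi_{\alpha\beta},\tilde\varpi_{\dot\alpha\dot\beta}$ symmetric holomorphic connection forms of empty flat space: $$d\varpi_{\alpha\beta}+h_{\alpha\dot\gamma}\wedge h_\beta{}^{\dot\gamma}=0,\qquad \nabla h_{\alpha\dot\alpha}:=dh_{\alpha\dot\alpha}+\tilde\varpi_{\dot\alpha\dot\gamma}\wedge h_\alpha{}^{\dot\gamma}=0,\qquad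 d\tilde\varpi_{\dot\alpha\dot\beta}+\tilde\varpi_{\dot\alpha\dot\gamma}\wedge\tilde\varpi_{\dot\beta}{}^{\dot\gamma}=0 .$$ Let $\lambda,\mu$ (constant) and $\tilde\lambda,\tilde\mu$ ($\nabla\tilde\lambda=\nabla\tilde\mu=0$, where $\nabla v_{\dot\alpha}=dv_{\dot\alpha}+\tilde\varpi_{\dot\alpha\dot\gamma}v^{\dot\gamma}$) be spinors with $\langle\mu\,\lambda\rangle=1=[\tilde\mu\,\tilde\lambda]$, and write $df=h^{\alpha\dot\alpha}\nabla_{\alpha\dot\alpha}f$, $\ell=\lambda\tilde\lambda$, $p=\lambda\tilde\mu$, $\tilde p=\mu\tilde\lambda$. Let $\mathtt H_2$ be holomorphic with $\ell^a\nabla_a\mathtt H_2=0$, $p^a\tilde p^b\nabla_a\nabla_b\mathtt H_2=0$ and (self-duality) $\tilde p^a\nabla_a\mathtt H_2=0$. Let $\mathtt H_{2\,\alpha(k)}$ be its $k$-fold derivatives along $\tilde\mu^{\dot\alpha}\nabla_{\alpha\dot\alpha}$, put $\langle\lambda^{k}\mathtt H_2\rangle:=\lambda^{\alpha_1}\cdots\lambda^{\alpha_k}\mathtt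 H_{2\,\alpha_1\dots\alpha_k}$, $\langle\lambda|h|\lambda]:=\lambda^\gamma h_{\gamma\dot\gamma}\tilde\lambda^{\dot\gamma}$, and $$\boldsymbol\varpi_{\alpha\beta}=\varpi_{\alpha\beta}+2\mathtt H_2\langle\lambda|h|\lambda]\lambda_\alpha\lambda_\beta,\quad \boldsymbol e_{\alpha\dot\alpha}=h_{\alpha\dot\alpha}+\langle\lambda\mathtt H_2\rangle\langle\lambda|h|\lambda]\lambda_\alpha\tilde\lambda_{\dot\alpha},\quad \tilde{\boldsymbol\varpi}_{\dot\alpha\dot\beta}=\tilde\varpi_{\dot\alpha\dot\beta}+\langle\lambda^2\mathtt H_2\rangle\langle\lambda|h|\lambda]\tilde\lambda_{\dot\alpha}\tilde\lambda_{\dot\beta},$$ $$\boldsymbol\Omega=\tfrac14\boldsymbol\varpi_{\alpha\beta}y^\alpha y^\beta+\tfrac12\boldsymbol e_{\alpha\dot\alpha}y^\alpha\tilde y^{\dot\alpha}+\tfrac14\tilde{\boldsymbol\varpi}_{\dot\alpha\dot\beta}\tilde y^{\dot\alpha}\tilde y^{\dot\beta}.$$ **Proposition.** (i) Let $\underline{\mathsf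 C}$ be any 0-form which at every point of $U$ is a power series in $\langle y\,\lambda\rangle,\langle y\,\mu\rangle,[y\,\lambda]$ (the coefficients being arbitrary functions on $U$). Then on $U$ all vertices $\mathcal V_n(\boldsymbol\Omega,\boldsymbol\Omega,\underline{\mathsf C},\dots,\underline{\mathsf C})$ with $n\ge4$ and $\mathcal U_n(\boldsymbol\Omega,\underline{\mathsf C},\dots,\underline{\mathsf C})$ with $n\ge3$ are well defined (the expansions converge) and vanish. (ii) Let $\underline{\mathsf C}=C+B$. Here $C$ is the generating function, $\sum_k\frac{1}{k!(4+k)!}C_{\alpha(k)\dot\alpha(4+k)}y^{\alpha(k)}\tilde y^{\dot\alpha(4+k)}$, of the positive-helicity fields $C_{\alpha(k)\dot\alpha(4+k)}=-\tfrac12\lambda^{\gamma_1}\lambda^{\gamma_2}\lambda^{\gamma_3}\mathtt H_{2\,\gamma_1\gamma_2\gamma_3\alpha(k)}\tilde\lambda_{\dot\alpha(4+k)}$. And $B$ is the generating function of negative-helicity fields $B_{\alpha(4+m)\dot\alpha(m)}$, $m\ge0$, with $B_{\alpha(4)}=\psi_2\,\mu_{\alpha(4)}$, which is a power series in $\langle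 y\,\lambda\rangle,\langle y\,\mu\rangle,[y\,\lambda]$ at every point and satisfies the linear equations $DB_{\alpha(4+m)\dot\alpha(m)}=\boldsymbol e^{\beta\dot\beta}B_{\alpha(4+m)\beta\,\dot\alpha(m)\dot\beta}$, where $D$ is the covariant derivative with connection $\tilde{\boldsymbol\varpi}$ on dotted indices. Then $\underline{\mathsf C}$ is of the form required in (i), and $(\boldsymbol\Omega,\underline{\mathsf C})$ is an exact solution on $U$ of the full nonlinear equations of chiral higher-spin gravity. -/

import Mathlib

open MeasureTheory
open scoped ContDiff

noncomputable section

namespace ChiralHSGRA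

/-! ### Oscillator variables and polydifferential operators -/

/-- Labels of the oscillators: `Sum.inl α` for the undotted `y^α`, `Sum.inr α'` for the dotted
`ỹ^α'`. -/
abbrev Osc := Fin 2 ⊕ Fin 2

/-- Generating functions: formal power series in `(y, ỹ)`. The coefficient of `y^{α(m)} ỹ^{α'(n)}`
is the component of the field with `m` undotted and `n` dotted indices, up to factorials. -/
abbrev GenFun := MvPowerSeries Osc ℂ

section Brackets

variable {R : Type*} [CommRing R]

/-- `⟨p q⟩ = p^α q_α` in the undotted sector for spinors given by their upper components, with
`v_α = v^β ε_{βα}` and `ε^{01} = ε_{01} = 1`. -/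
def ang (p q : Osc → R) : R := p (.inl 1) * q (.inl 0) - p (.inl 0) * q (.inl 1)

/-- `[p q] = p^α' q_α'` in the dotted sector, same convention. -/
def sqb (p q : Osc → R) : R := p (.inr 1) * q (.inr 0) - p (.inr 0) * q (.inr 1)

end Brackets

/-- Symbols of polydifferential operators with `n` arguments: polynomials in the output variables
`(none, a)`, standing for `y^a`, and in `(some i, a)`, standing for `∂/∂y_i^a`. -/
abbrev Symb (n : ℕ) := MvPolynomial (Option (Fin n) × Osc) ℂ

/-- The output spinor `y` (upper components). -/
def ySp (n : ℕ) : Osc → Symb n := fun a => MvPolynomial.X (none, a)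

/-- The spinor of derivatives `∂_i` with index raised, `∂^α = ε^{αβ} ∂_β`: that is
`∂^0 = ∂/∂y_i^1` and `∂^1 = -∂/∂y_i^0`, and likewise in the dotted sector. -/
def dSp {n : ℕ} (i : Fin n) : Osc → Symb n
  | .inl 0 => MvPolynomial.X (some i, .inl 1)
  | .inl 1 => -MvPolynomial.X (some i, .inl 0)
  | .inr 0 => MvPolynomial.X (some i, .inr 1)
  | .inr 1 => -MvPolynomial.X (some i, .inr 0)

/-- The exponents of the variables attached to one leg in a monomial of a symbol. -/
def legExp {n : ℕ} (m : Option (Fin n) × Osc →₀ ℕ) (l : Option (Fin n)) : Osc →₀ ℕ :=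
  Finsupp.equivFunOnFinite.symm fun a => m (l, a)

/-- `∂^m f |_{y = 0} = m! · (coefficient of y^m in f)`. -/
def derivAtZero (m : Osc →₀ ℕ) (f : GenFun) : ℂ :=
  (∏ a, ((m a).factorial : ℂ)) * MvPowerSeries.coeff m f

/-- The coefficient of `y^a` in `F(y, ∂_1, …, ∂_n) Φ_1(y_1) ⋯ Φ_n(y_n) |_{y_i = 0}`, for a symbol
`F`. -/
def act {n : ℕ} (F : Symb n) (Φ : Fin n → GenFun) (a : Osc →₀ ℕ) : ℂ :=
  ∑ m ∈ F.support,
    if legExp m none = a then F.coeff m * ∏ i, derivAtZero (legExp m (some i)) (Φ i) else 0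

/-! ### Sub-vertices

Everything is organised by `m = n - 2`, where `n` is the number of arguments. -/

/-- The `m + 1` two-vectors `(u_k, v_k)`: `m` free ones and the last, `(1 - ∑ u, 1 - ∑ v)`. -/
def fullVec {m : ℕ} (q : Fin m → ℝ × ℝ) : Fin (m + 1) → ℝ × ℝ :=
  Fin.snoc (α := fun _ => ℝ × ℝ) q (1 - ∑ k, (q k).1, 1 - ∑ k, (q k).2)

/-- The integration domain: non-negative `(u_k, v_k)` with
`u_1/v_1 ≤ u_2/v_2 ≤ … ≤ u_m/v_m ≤ (1 - ∑ u)/(1 - ∑ v)`, cleared of denominators. -/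
def simplexDom (m : ℕ) : Set (Fin m → ℝ × ℝ) :=
  {q | (∀ k, 0 ≤ (fullVec q k).1 ∧ 0 ≤ (fullVec q k).2) ∧
    ∀ k l, k < l → (fullVec q k).1 * (fullVec q l).2 ≤ (fullVec q l).1 * (fullVec q k).2}

/-- Position of a leg on the circle `ω_i, …, ω_j, …, n, output, 1, 2, …` read from `ω_i`; the
output leg is `none`. -/
def cyclicPos {n : ℕ} (i : Fin n) : Option (Fin n) → ℕ
  | none => n
  | some l => if l < i then n + 1 + l else l

/-- The graphs that contribute to the sub-vertex with one-forms at positions `i < j`: the ways to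
attach the two-vectors (ordered by slope) to the `m + 1` remaining legs, i.e. to the zero-forms and
the output. The slopes grow along the arc `j + 1, …, n, output, 1, …, i - 1` and decrease along the
arc `i + 1, …, j - 1`; legs on different arcs are shuffled arbitrarily. -/
def IsGraph {m : ℕ} (i j : Fin (m + 2)) (σ : Fin (m + 1) ↪ Option (Fin (m + 2))) : Prop :=
  (∀ k, σ k ≠ some i ∧ σ k ≠ some j) ∧
  ∀ k l, k < l →
    (cyclicPos i (σ k) < j → cyclicPos i (σ l) < j → cyclicPos i (σ l) < cyclicPos i (σ k)) ∧
    ((j : ℕ) < cyclicPos i (σ k) → (j : ℕ) < cyclicPos i (σ l) →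
      cyclicPos i (σ k) < cyclicPos i (σ l))

/-- The exponent of the star-product factor `exp(∑ [y ∂_k] + ∑_{k<l} [∂_k ∂_l])`. -/
def starExponent (n : ℕ) : Symb n :=
  (∑ k, sqb (ySp n) (dSp k)) + ∑ k, ∑ l ∈ Finset.Ioi k, sqb (dSp k) (dSp l)

/-- The exponent of the undotted sector, as an expression `F(y; p_1, …, p_n)` in its spinorial
arguments: `∑ (u ⟨p_i p_c⟩ + v ⟨p_j p_c⟩)` over the zero-form legs `c`, with
`u ⟨y p_i⟩ + v ⟨y p_j⟩` for the output leg. -/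
def uvExponent {m : ℕ} (i j : Fin (m + 2)) (σ : Fin (m + 1) → Option (Fin (m + 2)))
    (q : Fin m → ℝ × ℝ) (y : Osc → Symb (m + 2)) (p : Fin (m + 2) → Osc → Symb (m + 2)) :
    Symb (m + 2) :=
  ∑ c, (((fullVec q c).1 : ℂ) • ang (p i) ((σ c).elim (-y) p) +
    ((fullVec q c).2 : ℂ) • ang (p j) ((σ c).elim (-y) p))

/-- The term of order `k` in the expansion of the exponential in
`⟨p_i p_j⟩^{n-2} exp(starExponent + uvExponent)`. -/
def integrand {m : ℕ} (i j : Fin (m + 2)) (σ : Fin (m + 1) → Option (Fin (m + 2)))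
    (k : ℕ) (q : Fin m → ℝ × ℝ) (y : Osc → Symb (m + 2)) (p : Fin (m + 2) → Osc → Symb (m + 2)) :
    Symb (m + 2) :=
  ((k.factorial : ℂ)⁻¹) • (ang (p i) (p j) ^ m *
    (starExponent (m + 2) + uvExponent i j σ q y p) ^ k)

open Classical in
/-- Integrated sum over graphs of the term of order `k`, as an operator on `Φ`, where the undotted
spinorial arguments have been specialised to `y`, `p`; coefficient of `y^a`. -/
def graphSum {m : ℕ} (i j : Fin (m + 2)) (y : Osc → Symb (m + 2))
    (p : Fin (m + 2) → Osc → Symb (m + 2)) (Φ : Fin (m + 2) → GenFun) (k : ℕ) (a : Osc →₀ ℕ) : ℂ :=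
  ∑ σ : {σ : Fin (m + 1) ↪ Option (Fin (m + 2)) // IsGraph i j σ},
    ∫ q in simplexDom m, act (integrand i j σ.1 k q y p) Φ a

/-- Order `k` of the sub-vertex `V_{C,…,ω_i,…,ω_j,…,C}` with `i < j`. The sign is `(-)^{i+j-1}` for
positions counted from one. -/
def subV {m : ℕ} (i j : Fin (m + 2)) (Φ : Fin (m + 2) → GenFun) (k : ℕ) (a : Osc →₀ ℕ) : ℂ :=
  (-1) ^ ((i : ℕ) + j + 1) * graphSum i j (ySp _) dSp Φ k a

/-- Order `k` of the sub-vertex `U_{C,…,ω_i,…,C}`, from the `V` sub-vertices through the cyclic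
pairing. If the last argument is a zero-form, `⟨V(ω, Φ_1, …, Φ_{n-1}) | Φ_n⟩ = ⟨ω | U(Φ_1, …, Φ_n)⟩`:
replace `y ↦ -∂_n`, `∂_1 ↦ y`, `∂_{k+1} ↦ ∂_k`. If the last argument is the one-form,
`⟨Φ_1 | V(Φ_2, …, Φ_n, ω)⟩ = -⟨U(Φ_1, …, Φ_n) | ω⟩`: replace `y ↦ -∂_1`, `∂_k ↦ ∂_{k+1}`,
`∂_n ↦ y`, with a minus sign. These replacements concern the undotted sector; the star-product factor
of the dotted sector is cyclically invariant and keeps its form. -/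
def subU {m : ℕ} (i : Fin (m + 2)) (Φ : Fin (m + 2) → GenFun) (k : ℕ) (a : Osc →₀ ℕ) : ℂ :=
  Fin.lastCases (motive := fun _ => ℂ)
    (-((-1) ^ (m + (m + 1) + 1) *
      graphSum (Fin.last m).castSucc (Fin.last (m + 1)) (-dSp 0)
        (Fin.snoc (α := fun _ => Osc → Symb (m + 2)) (fun l => dSp l.succ) (ySp _)) Φ k a))
    (fun i => (-1) ^ (0 + ((i : ℕ) + 1) + 1) *
      graphSum 0 i.succ (-dSp (Fin.last (m + 1)))
        (Fin.cons (α := fun _ => Osc → Symb (m + 2)) (ySp _) (fun l => dSp l.castSucc)) Φ k a)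
    i

/-! ### Vertices -/

/-- Complexified spacetime, locally. -/
abbrev Spacetime := Fin 4 → ℂ

/-- The list of arguments with the one-forms `A`, `B` at positions `i`, `j` and `C` elsewhere. -/
def args₂ {n : ℕ} (i j : Fin n) (A B C : GenFun) : Fin n → GenFun :=
  fun k => if k = i then A else if k = j then B else C

/-- The list of arguments with the one-form `A` at position `i` and `C` elsewhere. -/
def args₁ {n : ℕ} (i : Fin n) (A C : GenFun) : Fin n → GenFun :=
  fun k => if k = i then A else C

/-- The vertex `V_n(A, A, C, …, C)` at a point of spacetime, evaluated on two tangent vectors: the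
sum of all `n(n-1)/2` sub-vertices, with the wedge product
`(α ∧ β)(ξ, η) = α(ξ) β(η) - α(η) β(ξ)` of the one-form arguments. Meaningful where
`ConvergesV` holds; zero by convention for `n < 2`. -/
def vertexV : ℕ → (Spacetime →ₗ[ℂ] GenFun) → GenFun → Spacetime → Spacetime → GenFun
  | m + 2, A, C, ξ, η => fun a => ∑ i : Fin (m + 2), ∑ j ∈ Finset.Ioi i,
      ((∑' k, subV i j (args₂ i j (A ξ) (A η) C) k a) -
        ∑' k, subV i j (args₂ i j (A η) (A ξ) C) k a)
  | _, _, _, _, _ => 0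

/-- All the expansions in `V_n(A, A, C, …, C)` converge. -/
def ConvergesV : ℕ → (Spacetime →ₗ[ℂ] GenFun) → GenFun → Prop
  | m + 2, A, C => ∀ (ξ η : Spacetime) (i j : Fin (m + 2)), i < j → ∀ a,
      Summable fun k => subV i j (args₂ i j (A ξ) (A η) C) k a
  | _, _, _ => True

/-- The vertex `U_n(A, C, …, C)` at a point of spacetime, evaluated on a tangent vector: the sum of
all `n` sub-vertices. Meaningful where `ConvergesU` holds; zero by convention for `n < 2`. -/
def vertexU : ℕ → (Spacetime →ₗ[ℂ] GenFun) → GenFun → Spacetime → GenFun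
  | m + 2, A, C, ξ => fun a => ∑ i : Fin (m + 2), ∑' k, subU i (args₁ i (A ξ) C) k a
  | _, _, _, _ => 0

/-- All the expansions in `U_n(A, C, …, C)` converge. -/
def ConvergesU : ℕ → (Spacetime →ₗ[ℂ] GenFun) → GenFun → Prop
  | m + 2, A, C => ∀ (ξ : Spacetime) (i : Fin (m + 2)) (a : Osc →₀ ℕ),
      Summable fun k => subU i (args₁ i (A ξ) C) k a
  | _, _, _ => True

/-- `(A, C)` is a solution on `U` of the full nonlinear equations
`dA = ∑_{n ≥ 2} V_n(A, A, C, …, C)`, `dC = ∑_{n ≥ 2} U_n(A, C, …, C)`. -/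
structure IsExactSolution (U : Set Spacetime) (A : Spacetime → Spacetime →ₗ[ℂ] GenFun)
    (C : Spacetime → GenFun) : Prop where
  differentiable_form : ∀ ξ a, DifferentiableOn ℂ (fun x => MvPowerSeries.coeff a (A x ξ)) U
  differentiable_zero : ∀ a, DifferentiableOn ℂ (fun x => MvPowerSeries.coeff a (C x)) U
  convergesV : ∀ x ∈ U, ∀ n, ConvergesV n (A x) (C x)
  convergesU : ∀ x ∈ U, ∀ n, ConvergesU n (A x) (C x)
  eq_form : ∀ x ∈ U, ∀ ξ η a,
    HasSum (fun n => MvPowerSeries.coeff a (vertexV (n + 2) (A x) (C x) ξ η))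
      (fderiv ℂ (fun z => MvPowerSeries.coeff a (A z η)) x ξ -
        fderiv ℂ (fun z => MvPowerSeries.coeff a (A z ξ)) x η)
  eq_zero : ∀ x ∈ U, ∀ ξ a,
    HasSum (fun n => MvPowerSeries.coeff a (vertexU (n + 2) (A x) (C x) ξ))
      (fderiv ℂ (fun z => MvPowerSeries.coeff a (C z)) x ξ)

/-! ### The empty flat background -/

/-- Scalar-valued one-forms. -/
abbrev OneForm := Spacetime → Spacetime →L[ℂ] ℂ

/-- The exterior differential of a one-form. -/
def extd (α : OneForm) (x ξ η : Spacetime) : ℂ := fderiv ℂ α x ξ η - fderiv ℂ α x η ξ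

/-- The wedge product of two one-forms. -/
def wedge (α β : OneForm) (x ξ η : Spacetime) : ℂ := α x ξ * β x η - α x η * β x ξ

/-- `X_γ ∧ Y^γ` for two spinors of one-forms with lower indices. -/
def contrWedge (X Y : Fin 2 → OneForm) (x ξ η : Spacetime) : ℂ :=
  wedge (X 0) (Y 1) x ξ η - wedge (X 1) (Y 0) x ξ η

/-- Lowering of an index, `v_α = v^β ε_{βα}`. -/
def low (v : Fin 2 → ℂ) : Fin 2 → ℂ := ![-v 1, v 0]

/-- The components `h_{αα'}` (lower indices) of a coframe as one-forms. -/
def coframeForm (h : Spacetime → Spacetime ≃L[ℂ] (Fin 2 → Fin 2 → ℂ)) (α α' : Fin 2) : OneForm :=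
  fun z => (ContinuousLinearMap.proj α' ∘L ContinuousLinearMap.proj α) ∘L
    (h z : Spacetime →L[ℂ] (Fin 2 → Fin 2 → ℂ))

/-- Empty flat spacetime: vierbein `h_{αα'}` and spin connection `ϖ_{αβ}`, `ϖ̃_{α'β'}` (lower
indices), subject to the Cartan structure equations of the deformed chiral Poincaré algebra. -/
structure FlatBackground (U : Set Spacetime) where
  /-- the vierbein, as a coframe -/
  h : Spacetime → Spacetime ≃L[ℂ] (Fin 2 → Fin 2 → ℂ)
  /-- the anti-self-dual spin connection -/
  w : Fin 2 → Fin 2 → OneForm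
  /-- the self-dual spin connection -/
  wt : Fin 2 → Fin 2 → OneForm
  smooth_h : ContDiffOn ℂ ∞ (fun x => (h x : Spacetime →L[ℂ] (Fin 2 → Fin 2 → ℂ))) U
  smooth_w : ∀ α β, ContDiffOn ℂ ∞ (w α β) U
  smooth_wt : ∀ α β, ContDiffOn ℂ ∞ (wt α β) U
  symm_w : ∀ α β, w α β = w β α
  symm_wt : ∀ α β, wt α β = wt β α
  /-- `dϖ_{αβ} + h_{αγ'} ∧ h_β^{γ'} = 0` -/
  curv_w : ∀ x ∈ U, ∀ ξ η α β,
    extd (w α β) x ξ η + contrWedge (coframeForm h α) (coframeForm h β) x ξ η = 0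
  /-- `dh_{αα'} + ϖ̃_{α'γ'} ∧ h_α^{γ'} = 0` -/
  torsion : ∀ x ∈ U, ∀ ξ η α α',
    extd (coframeForm h α α') x ξ η + contrWedge (wt α') (coframeForm h α) x ξ η = 0
  /-- `dϖ̃_{α'β'} + ϖ̃_{α'γ'} ∧ ϖ̃_{β'}^{γ'} = 0` -/
  curv_wt : ∀ x ∈ U, ∀ ξ η α β, extd (wt α β) x ξ η + contrWedge (wt α) (wt β) x ξ η = 0

variable {U : Set Spacetime}

/-- The components `h_{αα'}` of the vierbein as one-forms. -/
def FlatBackground.viel (b : FlatBackground U) (α α' : Fin 2) : OneForm := coframeForm b.h α α'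

/-- The derivative `κ^α τ^{α'} ∇_{αα'} f` of a scalar, where `df = h^{αα'} ∇_{αα'} f`: along the
vector `V` with `h^{αα'}(V) = κ^α τ^{α'}`. -/
def FlatBackground.nabla (b : FlatBackground U) (κ : Fin 2 → ℂ) (τ : Spacetime → Fin 2 → ℂ)
    (f : Spacetime → ℂ) : Spacetime → ℂ := fun x =>
  fderiv ℂ f x ((b.h x).symm fun α α' => low κ α * low (τ x) α')

/-- Dyads (upper components) `λ, μ` and `λ̃, μ̃`, normalised by `⟨μ λ⟩ = 1 = [μ̃ λ̃]` and covariantly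
constant on the flat background. The undotted index is not charged under the connection of the
flat background (only `ϖ̃` enters the torsion constraint), so that `λ, μ` are constant. -/
structure Dyad (b : FlatBackground U) where
  lam : Fin 2 → ℂ
  mu : Fin 2 → ℂ
  lamT : Spacetime → Fin 2 → ℂ
  muT : Spacetime → Fin 2 → ℂ
  norm : ∑ α, mu α * low lam α = 1
  normt : ∀ x ∈ U, ∑ α', muT x α' * low (lamT x) α' = 1
  smooth_lamT : ContDiffOn ℂ ∞ lamT U
  smooth_muT : ContDiffOn ℂ ∞ muT U
  /-- `dλ̃_{α'} + ϖ̃_{α'γ'} λ̃^{γ'} = 0` -/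
  const_lamT : ∀ x ∈ U, ∀ ξ α', fderiv ℂ (fun z => low (lamT z) α') x ξ +
    ∑ γ, b.wt α' γ x ξ * lamT x γ = 0
  /-- `dμ̃_{α'} + ϖ̃_{α'γ'} μ̃^{γ'} = 0` -/
  const_muT : ∀ x ∈ U, ∀ ξ α', fderiv ℂ (fun z => low (muT z) α') x ξ +
    ∑ γ, b.wt α' γ x ξ * muT x γ = 0

/-! ### The spin-2 sector -/

variable {b : FlatBackground U}

/-- The profile function: `ℓ^a ∇_a H₂ = 0`, `p^a p̃^b ∇_a ∇_b H₂ = 0`, and the self-duality condition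
that the `λ̃`-derivative of `H₂` in the dotted sector vanishes, i.e. `p̃^a ∇_a H₂ = 0`; here
`ℓ = λ λ̃`, `p = λ μ̃`, `p̃ = μ λ̃`. -/
structure IsProfile (d : Dyad b) (H₂ : Spacetime → ℂ) : Prop where
  smooth : ContDiffOn ℂ ∞ H₂ U
  u_indep : ∀ x ∈ U, b.nabla d.lam d.lamT H₂ x = 0
  harmonic : ∀ x ∈ U, b.nabla d.lam d.muT (b.nabla d.mu d.lamT H₂) x = 0
  selfDual : ∀ x ∈ U, b.nabla d.mu d.lamT H₂ x = 0

/-- `⟨λ|h|λ] = λ^γ h_{γγ'} λ̃^{γ'}`. -/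
def Dyad.ell (d : Dyad b) : OneForm := fun x =>
  ∑ γ, ∑ γ', (d.lam γ * d.lamT x γ') • b.viel γ γ' x

/-- `⟨λ^{γ(k)} H_{2 γ(k)}⟩`, where `H_{2 γ(k)}` is the `k`-th derivative of `H₂` in the undotted
sector: `dH₂ = h^{αα'} λ̃_{α'} H_{2 α}` and so on, i.e. `κ^α H_{2 α} = κ^α μ̃^{α'} ∇_{αα'} H₂`. -/
def Dyad.lamDeriv (d : Dyad b) (k : ℕ) (H₂ : Spacetime → ℂ) : Spacetime → ℂ :=
  (b.nabla d.lam d.muT)^[k] H₂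

/-- The deformed anti-self-dual connection. -/
def Dyad.boldW (d : Dyad b) (H₂ : Spacetime → ℂ) (α β : Fin 2) : OneForm := fun x =>
  b.w α β x + (2 * H₂ x * low d.lam α * low d.lam β) • d.ell x

/-- The deformed vierbein. -/
def Dyad.boldE (d : Dyad b) (H₂ : Spacetime → ℂ) (α α' : Fin 2) : OneForm := fun x =>
  b.viel α α' x + (d.lamDeriv 1 H₂ x * low d.lam α * low (d.lamT x) α') • d.ell x

/-- The deformed self-dual connection. -/
def Dyad.boldWt (d : Dyad b) (H₂ : Spacetime → ℂ) (α' β' : Fin 2) : OneForm := fun x =>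
  b.wt α' β' x + (d.lamDeriv 2 H₂ x * low (d.lamT x) α' * low (d.lamT x) β') • d.ell x

/-- The master one-form `Ω = ½ ϖ_{αβ} L^{αβ} + e_{αα'} P^{αα'} + ½ ϖ̃_{α'β'} L̃^{α'β'}` with
`L^{αβ} = ½ y^α y^β`, `P^{αα'} = ½ y^α ỹ^{α'}`, `L̃^{α'β'} = ½ ỹ^{α'} ỹ^{β'}`. -/
def Dyad.Omega (d : Dyad b) (H₂ : Spacetime → ℂ) (x : Spacetime) : Spacetime →ₗ[ℂ] GenFun :=
  (1 / 4 : ℂ) • (∑ α, ∑ β, (d.boldW H₂ α β x : Spacetime →ₗ[ℂ] ℂ).smulRight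
      (MvPowerSeries.X (.inl α) * MvPowerSeries.X (.inl β) : GenFun)) +
  (1 / 2 : ℂ) • (∑ α, ∑ α', (d.boldE H₂ α α' x : Spacetime →ₗ[ℂ] ℂ).smulRight
      (MvPowerSeries.X (.inl α) * MvPowerSeries.X (.inr α') : GenFun)) +
  (1 / 4 : ℂ) • (∑ α', ∑ β', (d.boldWt H₂ α' β' x : Spacetime →ₗ[ℂ] ℂ).smulRight
      (MvPowerSeries.X (.inr α') * MvPowerSeries.X (.inr β') : GenFun))

/-- `⟨y κ⟩ = y^α κ_α`. -/
def yAng (κ : Fin 2 → ℂ) : GenFun := ∑ α, low κ α • MvPowerSeries.X (.inl α)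

/-- `[y τ] = ỹ^{α'} τ_{α'}`. -/
def ySqb (τ : Fin 2 → ℂ) : GenFun := ∑ α', low τ α' • MvPowerSeries.X (.inr α')

/-- The zero-forms `C(⟨y λ⟩, ⟨y μ⟩, [y λ], …)`: at every point a power series in these three linear
forms, whose coefficients are arbitrary functions on spacetime. -/
def Dyad.HasSpinTwoForm (d : Dyad b) (C : Spacetime → GenFun) : Prop :=
  ∃ G : Spacetime → MvPowerSeries (Fin 3) ℂ, ∀ x ∈ U,
    C x = MvPowerSeries.subst ![yAng d.lam, yAng d.mu, ySqb (d.lamT x)] (G x)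

/-- Number of undotted oscillators in a monomial. -/
def degU (a : Osc →₀ ℕ) : ℕ := a (.inl 0) + a (.inl 1)

/-- Number of dotted oscillators in a monomial. -/
def degD (a : Osc →₀ ℕ) : ℕ := a (.inr 0) + a (.inr 1)

/-- The positive-helicity zero-form, the generating function of
`C_{α(k) α'(4+k)} = -½ ⟨λ^{γ(3)} H_{2 γ(3)α(k)}⟩ λ̃_{α'(4+k)}`. -/
def Dyad.Cplus (d : Dyad b) (H₂ : Spacetime → ℂ) (x : Spacetime) : GenFun := fun a =>
  if degD a = 4 + degU a then
    (∏ s, ((a s).factorial : ℂ))⁻¹ *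
      (-(1 / 2) * (b.nabla (Pi.single 0 1) d.muT)^[a (.inl 0)]
        ((b.nabla (Pi.single 1 1) d.muT)^[a (.inl 1)] (d.lamDeriv 3 H₂)) x *
        low (d.lamT x) 0 ^ a (.inr 0) * low (d.lamT x) 1 ^ a (.inr 1))
  else 0

/-- `e_{αα'}(ξ) ∂^α ∂̃^{α'} f = e^{αα'}(ξ) ∂_α ∂̃_{α'} f`. -/
def Dyad.translation (d : Dyad b) (H₂ : Spacetime → ℂ) (x ξ : Spacetime) (f : GenFun) : GenFun :=
  d.boldE H₂ 0 0 x ξ • MvPowerSeries.pderiv ℂ (.inl 1) (MvPowerSeries.pderiv ℂ (.inr 1) f)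
  - d.boldE H₂ 0 1 x ξ • MvPowerSeries.pderiv ℂ (.inl 1) (MvPowerSeries.pderiv ℂ (.inr 0) f)
  - d.boldE H₂ 1 0 x ξ • MvPowerSeries.pderiv ℂ (.inl 0) (MvPowerSeries.pderiv ℂ (.inr 1) f)
  + d.boldE H₂ 1 1 x ξ • MvPowerSeries.pderiv ℂ (.inl 0) (MvPowerSeries.pderiv ℂ (.inr 0) f)

/-- `ỹ^{γ'} ϖ̃_{γ'β'}(ξ) ∂̃^{β'} f`, the action of the self-dual connection on dotted indices. -/
def Dyad.rotation (d : Dyad b) (H₂ : Spacetime → ℂ) (x ξ : Spacetime) (f : GenFun) : GenFun :=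
  ∑ γ : Fin 2, MvPowerSeries.X (.inr γ) *
    (d.boldWt H₂ γ 0 x ξ • MvPowerSeries.pderiv ℂ (.inr 1) f -
      d.boldWt H₂ γ 1 x ξ • MvPowerSeries.pderiv ℂ (.inr 0) f)

/-- The negative-helicity zero-form: the generating function of the fields `B_{α(4+m) α'(m)}`,
`m ≥ 0`, of the form above, with `B_{α(4)} = ψ₂ μ_{α(4)}`, where the fields with `m ≥ 1` are the
auxiliary fields generated by the linear equations
`D B_{α(4+m) α'(m)} = e^{ββ'} B_{α(4+m)β α'(m)β'}` on the deformed background. -/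
structure IsNegHelicity (d : Dyad b) (H₂ ψ₂ : Spacetime → ℂ) (B : Spacetime → GenFun) : Prop where
  form : d.HasSpinTwoForm B
  content : ∀ x ∈ U, ∀ a, degU a ≠ 4 + degD a → MvPowerSeries.coeff a (B x) = 0
  leading : ∀ x ∈ U, ∀ a, degD a = 0 →
    MvPowerSeries.coeff a (B x) = MvPowerSeries.coeff a ((ψ₂ x / 24) • yAng d.mu ^ 4)
  differentiable : ∀ a, DifferentiableOn ℂ (fun x => MvPowerSeries.coeff a (B x)) U
  linear : ∀ x ∈ U, ∀ ξ a, fderiv ℂ (fun z => MvPowerSeries.coeff a (B z)) x ξ +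
    MvPowerSeries.coeff a (d.rotation H₂ x ξ (B x)) =
      MvPowerSeries.coeff a (d.translation H₂ x ξ (B x))

end ChiralHSGRA

end

/-! A vertex is a power series of differential operators in which the arguments are contracted with
one another and with the output. Three facts decide which contractions survive. The one-form is
quadratic in the oscillators, so three derivatives on it give zero (`legIdeal_pow_three_le`). At
each point the zero-form depends on the dotted oscillators only through one linear form, so a dotted
contraction of two zero-forms gives `[λ̃ λ̃] = 0` (`sqb_dSp_mem_annIdeal`). A fixed output
coefficient tolerates only finitely many factors of `y` (`outIdeal_pow_le`). The symbols all of
whose multiples act trivially form an ideal `annIdeal`, so each simplification becomes an ideal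
membership.

Convergence: every term of the exponent contains an output variable or a one-form derivative, or is
trivial. A high power of the exponent is therefore trivial and every expansion is a finite sum
(`pow_mem_annIdeal`).

Vanishing: with `n` arguments the prefactor puts `n - 2` derivatives on each one-form, which is
fatal for `n ≥ 5`. For `n = 4` and two one-forms the prefactor uses up both of them; what remains is
symmetric in the one-forms and the wedge product kills it (`subV_two_swap`). For `n = 3, 4` and a
single one-form, all zero-forms being equal, a sub-vertex remembers the position of its one-form
only through an overall sign and the signs of the dotted contractions. The sum over positions and
graphs is then an alternating sum of binomial coefficients, which is zero (`sum_subU_eq_zero`).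

Exact solution: the quadratic vertex of two one-forms is a Poisson bracket in the dotted oscillators
and reproduces the Cartan structure equations (`coeff_vertexV_two`, `quadForm_commutator`). The
cubic one reduces to two vierbeins contracted with two dotted derivatives of the zero-form at
vanishing undotted oscillators (`coeff_vertexV_three`), where negative helicity drops out. On the
geometric side the forms `λ̃^{α'} h_{αα'}` are closed, and the profile varies only along them. The
deformed fields then obey the flat structure equations except for one source, the third
`λ`-derivative of the profile times `λ̃ λ̃`, in the equation of the self-dual connection
(`extd_boldWt`). The cubic vertex supplies exactly this source. The quadratic vertex with a single
one-form is translation minus rotation, so the zero-form equation is linear: it holds for the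
positive-helicity part by `linear_Cplus` and for the negative-helicity part by assumption. -/

open MeasureTheory
open scoped ContDiff

noncomputable section

namespace ChiralHSGRA

/-! ### The operator calculus as a linear functional on symbols -/

section Calculus

variable {n : ℕ} (Φ : Fin n → GenFun) (a : Osc →₀ ℕ)

/-- The value of `act` on the monomial of exponent `m`. -/
def amp (m : Option (Fin n) × Osc →₀ ℕ) : ℂ :=
  if legExp m none = a then ∏ i, derivAtZero (legExp m (some i)) (Φ i) else 0

/-- `act` as a linear functional of the symbol. -/
def actL : Symb n →ₗ[ℂ] ℂ := (MvPolynomial.basisMonomials _ ℂ).constr ℂ (amp Φ a)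

theorem actL_monomial (m : Option (Fin n) × Osc →₀ ℕ) (c : ℂ) :
    actL Φ a (MvPolynomial.monomial m c) = c * amp Φ a m := by
  have h : MvPolynomial.monomial m c = c • (MvPolynomial.basisMonomials _ ℂ m) := by
    simp [MvPolynomial.smul_monomial]
  rw [h, map_smul, actL, Module.Basis.constr_basis, smul_eq_mul]

theorem act_eq_actL (F : Symb n) : act F Φ a = actL Φ a F := by
  conv_rhs => rw [F.as_sum, map_sum]
  refine Finset.sum_congr rfl fun m _ => ?_
  rw [actL_monomial, amp, mul_ite, mul_zero]

theorem legExp_single_add (l l' : Option (Fin n)) (s : Osc) (m : Option (Fin n) × Osc →₀ ℕ) :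
    legExp (Finsupp.single (l, s) 1 + m) l' =
      (if l = l' then Finsupp.single s 1 else 0) + legExp m l' := by
  ext t
  by_cases h : l = l'
  · subst h
    simp [legExp, Finsupp.single_apply]
  · simp [legExp, h]

theorem derivAtZero_single_add (s : Osc) (m : Osc →₀ ℕ) (f : GenFun) :
    derivAtZero (Finsupp.single s 1 + m) f = derivAtZero m (MvPowerSeries.pderiv ℂ s f) := by
  rw [derivAtZero, derivAtZero, MvPowerSeries.coeff_pderiv, add_comm m,
    ← Finset.mul_prod_erase _ _ (Finset.mem_univ s), ← Finset.mul_prod_erase _ (fun b =>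
      ((m b).factorial : ℂ)) (Finset.mem_univ s)]
  have h : ∏ x ∈ Finset.univ.erase s, (((Finsupp.single s 1 + m : Osc →₀ ℕ) x).factorial : ℂ) =
      ∏ x ∈ Finset.univ.erase s, ((m x).factorial : ℂ) := by
    refine Finset.prod_congr rfl fun x hx => ?_
    simp [(Finset.ne_of_mem_erase hx).symm]
  rw [h]
  simp only [Finsupp.add_apply, Finsupp.single_eq_same]
  rw [add_comm 1 (m s), Nat.factorial_succ]
  push_cast
  ring

/-- The factor `m!` in `derivAtZero` makes a symbol variable of leg `i` act exactly as
differentiation of the `i`-th argument. Together with `actL_X_none_mul` this trades symbols for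
operations on the arguments and on the output exponent. -/
theorem actL_X_some_mul (i : Fin n) (s : Osc) (F : Symb n) :
    actL Φ a (MvPolynomial.X (some i, s) * F) =
      actL (Function.update Φ i (MvPowerSeries.pderiv ℂ s (Φ i))) a F := by
  induction F using MvPolynomial.induction_on' with
  | add p q hp hq => rw [mul_add, map_add, map_add, hp, hq]
  | monomial m c =>
    rw [MvPolynomial.X, MvPolynomial.monomial_mul, one_mul, actL_monomial, actL_monomial, amp, amp,
      legExp_single_add, if_neg (Option.some_ne_none i), zero_add]
    congr 2
    refine Finset.prod_congr rfl fun j _ => ?_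
    rw [legExp_single_add]
    by_cases h : i = j
    · subst h
      simp [derivAtZero_single_add]
    · rw [if_neg (by simpa using h), zero_add, Function.update_of_ne (Ne.symm h)]

theorem actL_X_none_mul (s : Osc) (F : Symb n) :
    actL Φ a (MvPolynomial.X (none, s) * F) =
      if 1 ≤ a s then actL Φ (a - Finsupp.single s 1) F else 0 := by
  induction F using MvPolynomial.induction_on' with
  | add p q hp hq =>
    rw [mul_add, map_add, map_add, hp, hq]
    split_ifs <;> simp
  | monomial m c =>
    rw [MvPolynomial.X, MvPolynomial.monomial_mul, one_mul, actL_monomial, actL_monomial, amp, amp,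
      legExp_single_add, if_pos rfl]
    have h2 : ∀ i : Fin n, legExp (Finsupp.single (none, s) 1 + m) (some i) = legExp m (some i) := by
      intro i
      rw [legExp_single_add, if_neg (by simp), zero_add]
    simp only [h2]
    by_cases h : 1 ≤ a s
    · have hle : Finsupp.single s 1 ≤ a := by
        rw [Finsupp.single_le_iff]; exact h
      have : (Finsupp.single s 1 + legExp m none = a) ↔ (legExp m none = a - Finsupp.single s 1) := by
        constructor
        · rintro rfl
          rw [add_tsub_cancel_left]
        · intro h
          rw [h, add_tsub_cancel_of_le hle]
      simp [h, this]
    · have : ¬ (Finsupp.single s 1 + legExp m none = a) := by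
        rintro rfl
        simp at h
      simp [h, this]

/-- Permutations of the legs act on symbols. -/
def permLegs (π : Fin n ≃ Fin n) : Symb n →ₐ[ℂ] Symb n :=
  MvPolynomial.rename fun x => (x.1.map π, x.2)

theorem permLegs_X_some (π : Fin n ≃ Fin n) (i : Fin n) (s : Osc) :
    permLegs π (MvPolynomial.X (some i, s)) = MvPolynomial.X (some (π i), s) := by
  simp [permLegs]

theorem permLegs_X_none (π : Fin n ≃ Fin n) (s : Osc) :
    permLegs π (MvPolynomial.X (none, s)) = MvPolynomial.X (none, s) := by
  simp [permLegs]

theorem actL_permLegs (π : Fin n ≃ Fin n) (F : Symb n) :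
    actL Φ a (permLegs π F) = actL (Φ ∘ π) a F := by
  induction F using MvPolynomial.induction_on' with
  | add p q hp hq => rw [map_add, map_add, map_add, hp, hq]
  | monomial m c =>
    have hinj : Function.Injective
        (fun x : Option (Fin n) × Osc => ((x.1.map π, x.2) : Option (Fin n) × Osc)) := by
      rintro ⟨x, s⟩ ⟨y, t⟩ h
      simp only [Prod.mk.injEq] at h
      rw [Option.map_injective π.injective h.1, h.2]
    rw [permLegs, MvPolynomial.rename_monomial, actL_monomial, actL_monomial, amp, amp]
    have h : ∀ l, legExp (Finsupp.mapDomain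
        (fun x : Option (Fin n) × Osc => ((x.1.map π, x.2) : Option (Fin n) × Osc)) m)
          (l.map π) = legExp m l := by
      intro l
      ext t
      exact Finsupp.mapDomain_apply hinj m (l, t)
    have h0 := h none
    simp only [Option.map_none] at h0
    rw [h0]
    congr 2
    rw [← Equiv.prod_comp π]
    refine Finset.prod_congr rfl fun i _ => ?_
    have hi := h (some i)
    simp only [Option.map_some] at hi
    rw [hi, Function.comp]

/-- Homogeneity in one argument. It lets the coefficients of a `DottedForm` be pulled out of the
functional. -/
theorem actL_update_smul (i : Fin n) (c : ℂ) (f : GenFun) (F : Symb n) :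
    actL (Function.update Φ i (c • f)) a F = c * actL (Function.update Φ i f) a F := by
  induction F using MvPolynomial.induction_on' with
  | add p q hp hq => rw [map_add, map_add, hp, hq, mul_add]
  | monomial m x =>
    rw [actL_monomial, actL_monomial, amp, amp]
    have h : ∏ j, derivAtZero (legExp m (some j)) (Function.update Φ i (c • f) j) =
        c * ∏ j, derivAtZero (legExp m (some j)) (Function.update Φ i f j) := by
      rw [← Finset.mul_prod_erase _ _ (Finset.mem_univ i), ← Finset.mul_prod_erase _ (fun j =>
        derivAtZero (legExp m (some j)) (Function.update Φ i f j)) (Finset.mem_univ i)]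
      have : ∏ x ∈ Finset.univ.erase i, derivAtZero (legExp m (some x))
          (Function.update Φ i (c • f) x) = ∏ x ∈ Finset.univ.erase i,
          derivAtZero (legExp m (some x)) (Function.update Φ i f x) := by
        refine Finset.prod_congr rfl fun j hj => ?_
        rw [Function.update_of_ne (Finset.ne_of_mem_erase hj),
          Function.update_of_ne (Finset.ne_of_mem_erase hj)]
      rw [this, Function.update_self, Function.update_self, derivAtZero, derivAtZero, map_smul,
        smul_eq_mul]
      ring
    rw [h]
    split_ifs <;> ring

theorem actL_eq_zero_of_apply_eq_zero (i : Fin n) (h : Φ i = 0) (F : Symb n) :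
    actL Φ a F = 0 := by
  have := actL_update_smul Φ a i 0 0 F
  rwa [zero_mul, smul_zero, ← h, Function.update_eq_self] at this

/-! ### Symbols that act trivially -/

/-- The ideal of all symbols whose multiples act trivially on `Φ`, in the coefficient of `y^a`. -/
def annIdeal : Ideal (Symb n) where
  carrier := {F | ∀ G, actL Φ a (G * F) = 0}
  add_mem' {F F'} h h' G := by rw [mul_add, map_add, h G, h' G, add_zero]
  zero_mem' G := by rw [mul_zero, map_zero]
  smul_mem' H F h G := by rw [smul_eq_mul, ← mul_assoc]; exact h _

theorem actL_eq_zero_of_mem {F : Symb n} (h : F ∈ annIdeal Φ a) : actL Φ a F = 0 := by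
  simpa using h 1

theorem actL_eq_of_sub_mem {F F' : Symb n} (h : F - F' ∈ annIdeal Φ a) :
    actL Φ a F = actL Φ a F' := by
  rw [← sub_eq_zero, ← map_sub]
  exact actL_eq_zero_of_mem Φ a h

/-- The ideal of the symbols that differentiate the argument `i`. -/
def legIdeal (i : Fin n) : Ideal (Symb n) :=
  Ideal.span (Set.range fun s => MvPolynomial.X (some i, s))

/-- The ideal of the symbols without a part independent of the output variables. -/
def outIdeal (n : ℕ) : Ideal (Symb n) :=
  Ideal.span (Set.range fun s => MvPolynomial.X (none, s))

theorem X_some_mem (i : Fin n) (s : Osc) : MvPolynomial.X (some i, s) ∈ legIdeal i :=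
  Ideal.subset_span ⟨s, rfl⟩

theorem X_none_mem (s : Osc) : MvPolynomial.X (none, s) ∈ outIdeal n :=
  Ideal.subset_span ⟨s, rfl⟩

/-- A generator of `legIdeal i` can be traded for a derivative of the `i`-th argument, so it
suffices that `J` annihilates every configuration with that argument differentiated once. Iteration
counts derivatives. -/
theorem legIdeal_mul_le (i : Fin n) (J : Ideal (Symb n))
    (h : ∀ s, J ≤ annIdeal (Function.update Φ i (MvPowerSeries.pderiv ℂ s (Φ i))) a) :
    legIdeal i * J ≤ annIdeal Φ a := by
  rw [legIdeal, Ideal.mul_le]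
  intro r hr F hF
  induction hr using Submodule.span_induction with
  | mem x hx =>
    obtain ⟨s, rfl⟩ := hx
    intro G
    rw [mul_left_comm, actL_X_some_mul]
    exact h s hF G
  | zero => simp
  | add x y _ _ hx hy => rw [add_mul]; exact add_mem hx hy
  | smul c x _ hx => rw [smul_eq_mul, mul_assoc]; exact Ideal.mul_mem_left _ _ hx

theorem outIdeal_mul_le (J : Ideal (Symb n))
    (h : ∀ s, 1 ≤ a s → J ≤ annIdeal Φ (a - Finsupp.single s 1)) :
    outIdeal n * J ≤ annIdeal Φ a := by
  rw [outIdeal, Ideal.mul_le]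
  intro r hr F hF
  induction hr using Submodule.span_induction with
  | mem x hx =>
    obtain ⟨s, rfl⟩ := hx
    intro G
    rw [mul_left_comm, actL_X_none_mul]
    split_ifs with hs
    · exact h s hs hF G
    · rfl
  | zero => simp
  | add x y _ _ hx hy => rw [add_mul]; exact add_mem hx hy
  | smul c x _ hx => rw [smul_eq_mul, mul_assoc]; exact Ideal.mul_mem_left _ _ hx

theorem le_annIdeal_of_apply_eq_zero (i : Fin n) (h : Φ i = 0) (J : Ideal (Symb n)) :
    J ≤ annIdeal Φ a := fun _ _ _ => actL_eq_zero_of_apply_eq_zero Φ a i h _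

/-- Each output factor lowers the exponent `a` by one, and `a` is exhausted after `a.degree` of
them. -/
theorem outIdeal_pow_le (k : ℕ) (h : a.degree < k) : outIdeal n ^ k ≤ annIdeal Φ a := by
  induction k generalizing a with
  | zero => omega
  | succ k ih =>
    rw [pow_succ']
    refine outIdeal_mul_le Φ a _ fun s hs => ih _ ?_
    have hle : Finsupp.single s 1 ≤ a := by
      rw [Finsupp.single_le_iff]; exact hs
    have := congrArg Finsupp.degree (add_tsub_cancel_of_le hle)
    rw [map_add, Finsupp.degree_single] at this
    omega

/-- A generating function that is at most quadratic in all oscillators. -/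
def IsQuadratic (f : GenFun) : Prop :=
  ∀ s t r, MvPowerSeries.pderiv ℂ s (MvPowerSeries.pderiv ℂ t (MvPowerSeries.pderiv ℂ r f)) = 0

theorem legIdeal_pow_three_le (i : Fin n) (h : IsQuadratic (Φ i)) :
    legIdeal i ^ 3 ≤ annIdeal Φ a := by
  rw [pow_succ', pow_succ', pow_one]
  refine legIdeal_mul_le Φ a i _ fun r => legIdeal_mul_le _ a i _ fun t => ?_
  -- A trivial unit ideal is appended so that the multiplication lemma applies a third time; the
  -- argument is by then a third derivative, hence zero.
  rw [← mul_one (legIdeal i)]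
  refine legIdeal_mul_le _ a i _ fun s => le_annIdeal_of_apply_eq_zero _ _ i ?_ _
  simp [h s t r]

theorem sqb_dSp (k l : Fin n) : sqb (dSp k) (dSp l) =
    MvPolynomial.X (some k, .inr 1) * MvPolynomial.X (some l, .inr 0) -
      MvPolynomial.X (some k, .inr 0) * MvPolynomial.X (some l, .inr 1) := by
  simp only [sqb, dSp]; ring

theorem ang_dSp (k l : Fin n) : ang (dSp k) (dSp l) =
    MvPolynomial.X (some k, .inl 1) * MvPolynomial.X (some l, .inl 0) -
      MvPolynomial.X (some k, .inl 0) * MvPolynomial.X (some l, .inl 1) := by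
  simp only [ang, dSp]; ring

theorem sqb_ySp_dSp (l : Fin n) : sqb (ySp n) (dSp l) =
    MvPolynomial.X (none, .inr 0) * MvPolynomial.X (some l, .inr 0) +
      MvPolynomial.X (none, .inr 1) * MvPolynomial.X (some l, .inr 1) := by
  simp only [sqb, dSp, ySp]; ring

theorem ang_ySp_dSp (l : Fin n) : ang (ySp n) (dSp l) =
    MvPolynomial.X (none, .inl 0) * MvPolynomial.X (some l, .inl 0) +
      MvPolynomial.X (none, .inl 1) * MvPolynomial.X (some l, .inl 1) := by
  simp only [ang, dSp, ySp]; ring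

/-- Generating functions that depend on the dotted oscillators through one linear form only, given
by the two coefficients `c`. -/
def DottedForm (c : Fin 2 → ℂ) (f : GenFun) : Prop :=
  ∃ g : GenFun, ∀ γ, MvPowerSeries.pderiv ℂ (.inr γ) f = c γ • g

/-- Both dotted gradients are proportional to the same spinor `c`, so the contraction is `c 1 * c 0
- c 0 * c 1 = 0`. For `k = l` the symbol itself is zero. -/
theorem sqb_dSp_mem_annIdeal (c : Fin 2 → ℂ) (k l : Fin n) (hk : DottedForm c (Φ k))
    (hl : DottedForm c (Φ l)) : sqb (dSp k) (dSp l) ∈ annIdeal Φ a := by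
  by_cases hkl : k = l
  · subst hkl
    rw [sqb_dSp, mul_comm, sub_self]
    exact zero_mem _
  obtain ⟨f, hf⟩ := hk
  obtain ⟨g, hg⟩ := hl
  intro G
  rw [sqb_dSp, mul_comm, sub_mul, map_sub, mul_assoc, mul_assoc]
  simp only [actL_X_some_mul, Function.update_of_ne (Ne.symm hkl), hf, hg]
  simp only [actL_update_smul]
  rw [Function.update_comm hkl, actL_update_smul, Function.update_comm hkl, actL_update_smul]
  ring

/-! ### Taylor expansion -/

theorem pderiv_finset_prod {ι : Type*} [DecidableEq ι] (s : Osc) (S : Finset ι) (f : ι → GenFun) :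
    MvPowerSeries.pderiv ℂ s (∏ i ∈ S, f i) =
      ∑ i ∈ S, ∏ j ∈ S, Function.update f i (MvPowerSeries.pderiv ℂ s (f i)) j := by
  induction S using Finset.induction_on with
  | empty => simp
  | insert i S hi ih =>
    rw [Finset.prod_insert hi, Derivation.leibniz, ih, Finset.sum_insert hi, Finset.prod_insert hi,
      Function.update_self, smul_eq_mul, smul_eq_mul, add_comm]
    congr 1
    · rw [mul_comm]
      congr 1
      refine Finset.prod_congr rfl fun j hj => ?_
      rw [Function.update_of_ne (by rintro rfl; exact hi hj)]
    · rw [Finset.mul_sum]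
      refine Finset.sum_congr rfl fun j hj => ?_
      rw [Finset.prod_insert hi, Function.update_of_ne (by rintro rfl; exact hi hj)]

theorem pderiv_rescale (w : Osc → ℂ) (s : Osc) (f : GenFun) :
    MvPowerSeries.pderiv ℂ s (MvPowerSeries.rescale w f) =
      w s • MvPowerSeries.rescale w (MvPowerSeries.pderiv ℂ s f) := by
  ext m
  rw [map_smul, MvPowerSeries.coeff_pderiv, MvPowerSeries.coeff_rescale,
    MvPowerSeries.coeff_rescale, MvPowerSeries.coeff_pderiv, smul_eq_mul,
    Finsupp.prod_fintype _ _ (by simp), Finsupp.prod_fintype _ _ (by simp)]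
  have : ∏ i, w i ^ (m + Finsupp.single s 1 : Osc →₀ ℕ) i = w s * ∏ i, w i ^ m i := by
    simp only [Finsupp.add_apply, pow_add, Finset.prod_mul_distrib]
    rw [mul_comm]
    congr 1
    rw [Finset.prod_eq_single s]
    · simp
    · intro b _ hb
      simp [Ne.symm hb]
    · simp
  rw [this]
  ring

/-- The exponent `∑ w_{l,s} y^s ∂/∂y_l^s` of a (rescaled) Taylor shift to the output point. -/
def taylorSymb (w : Fin n → Osc → ℂ) : Symb n :=
  ∑ s, ∑ l, w l s • (MvPolynomial.X (none, s) * MvPolynomial.X (some l, s))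

/-- The Euler operator `y^s ∂_s` is diagonal on monomials; summed over `s`, its eigenvalues give the
degree. -/
theorem coeff_pderiv_sub (s : Osc) (P : GenFun) :
    (if 1 ≤ a s then MvPowerSeries.coeff (a - Finsupp.single s 1) (MvPowerSeries.pderiv ℂ s P)
      else 0) = a s * MvPowerSeries.coeff a P := by
  split_ifs with h
  · have hle : Finsupp.single s 1 ≤ a := by
      rw [Finsupp.single_le_iff]; exact h
    rw [MvPowerSeries.coeff_pderiv, tsub_add_cancel_of_le hle, Finsupp.tsub_apply,
      Finsupp.single_eq_same, Nat.cast_sub h]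
    push_cast
    ring
  · have : a s = 0 := by omega
    simp [this]

/-- The exponential of `∑ w y ∂` is a Taylor shift from the origin to the point `w y` in every
argument. Its term of order `k` sees only output monomials of degree `k`. The induction
differentiates the product of rescaled arguments and closes by Euler's identity. -/
theorem actL_taylorSymb_pow (w : Fin n → Osc → ℂ) (k : ℕ) :
    actL Φ a (taylorSymb w ^ k) = if a.degree = k then
      k.factorial * MvPowerSeries.coeff a (∏ l, MvPowerSeries.rescale (w l) (Φ l)) else 0 := by
  induction k generalizing Φ a with
  | zero =>
    have h1 : (1 : Symb n) = MvPolynomial.monomial 0 1 := rfl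
    rw [pow_zero, h1, actL_monomial, amp]
    have h2 : ∀ l, legExp (0 : Option (Fin n) × Osc →₀ ℕ) l = 0 := fun l => by ext; simp [legExp]
    simp only [h2, Finsupp.degree_eq_zero_iff, eq_comm (a := (0 : Osc →₀ ℕ))]
    split_ifs with h
    · subst h
      rw [MvPowerSeries.coeff_zero_eq_constantCoeff_apply, map_prod]
      simp only [one_mul, derivAtZero]
      simp only [Finsupp.coe_zero, Pi.zero_apply, Nat.factorial_zero, Nat.cast_one,
        Finset.prod_const_one, one_mul, ← MvPowerSeries.coeff_zero_eq_constantCoeff_apply,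
        MvPowerSeries.coeff_rescale]
      simp
    · simp
  | succ k ih =>
    rw [pow_succ']
    nth_rewrite 1 [taylorSymb]
    rw [Finset.sum_mul, map_sum]
    simp only [Finset.sum_mul, map_sum, smul_mul_assoc, map_smul, mul_assoc, actL_X_none_mul,
      actL_X_some_mul, ih]
    have key : ∀ s, MvPowerSeries.pderiv ℂ s (∏ l, MvPowerSeries.rescale (w l) (Φ l)) =
        ∑ l, w l s • ∏ j, MvPowerSeries.rescale (w j)
          (Function.update Φ l (MvPowerSeries.pderiv ℂ s (Φ l)) j) := by
      intro s
      rw [pderiv_finset_prod]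
      refine Finset.sum_congr rfl fun l _ => ?_
      rw [pderiv_rescale]
      have : Function.update (fun j => MvPowerSeries.rescale (w j) (Φ j)) l
          (w l s • MvPowerSeries.rescale (w l) (MvPowerSeries.pderiv ℂ s (Φ l))) =
          fun j => (if j = l then MvPowerSeries.C (w l s) else 1) * MvPowerSeries.rescale (w j)
            (Function.update Φ l (MvPowerSeries.pderiv ℂ s (Φ l)) j) := by
        ext1 j
        by_cases h : j = l
        · subst h
          simp [MvPowerSeries.smul_eq_C_mul]
        · simp [h]
      rw [this, Finset.prod_mul_distrib, Finset.prod_ite_eq' Finset.univ l,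
        if_pos (Finset.mem_univ l), MvPowerSeries.smul_eq_C_mul]
    have key2 : ∀ s, (∑ l, w l s • if 1 ≤ a s then
        (if (a - Finsupp.single s 1).degree = k then
          (k.factorial : ℂ) * MvPowerSeries.coeff (a - Finsupp.single s 1)
            (∏ j, MvPowerSeries.rescale (w j)
              (Function.update Φ l (MvPowerSeries.pderiv ℂ s (Φ l)) j)) else 0) else 0) =
        if a.degree = k + 1 then (k.factorial : ℂ) * (a s * MvPowerSeries.coeff a
          (∏ l, MvPowerSeries.rescale (w l) (Φ l))) else 0 := by
      intro s
      by_cases hs : 1 ≤ a s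
      · have hle : Finsupp.single s 1 ≤ a := by
          rw [Finsupp.single_le_iff]; exact hs
        have hd := congrArg Finsupp.degree (add_tsub_cancel_of_le hle)
        rw [map_add, Finsupp.degree_single] at hd
        have hiff : (a - Finsupp.single s 1).degree = k ↔ a.degree = k + 1 := by omega
        simp only [hs, if_true, hiff]
        rw [← coeff_pderiv_sub, if_pos hs, key, map_sum, Finset.mul_sum]
        split_ifs with h
        · refine Finset.sum_congr rfl fun l _ => ?_
          rw [map_smul, smul_eq_mul, smul_eq_mul]
          ring
        · simp
      · have : a s = 0 := by omega
        simp [this]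
    rw [Finset.sum_congr rfl fun s _ => key2 s]
    split_ifs with h
    -- Euler's identity: the exponents add up to the degree `k + 1`, the factor that turns `k!` into
    -- `(k + 1)!`.
    · rw [← Finset.mul_sum, ← Finset.sum_mul, ← Nat.cast_sum, ← Finsupp.degree_eq_sum, h,
        Nat.factorial_succ]
      push_cast
      ring
    · simp

end Calculus

/-! ### Symbols of the sub-vertices -/

section Membership

variable {n : ℕ}

theorem ang_mem {J : Ideal (Symb n)} {p : Osc → Symb n} (h : ∀ s, p s ∈ J) (q : Osc → Symb n) :
    ang p q ∈ J :=
  sub_mem (Ideal.mul_mem_right _ _ (h _)) (Ideal.mul_mem_right _ _ (h _))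

theorem sqb_mem {J : Ideal (Symb n)} {p : Osc → Symb n} (h : ∀ s, p s ∈ J) (q : Osc → Symb n) :
    sqb p q ∈ J :=
  sub_mem (Ideal.mul_mem_right _ _ (h _)) (Ideal.mul_mem_right _ _ (h _))

theorem ang_comm (p q : Osc → Symb n) : ang p q = -ang q p := by
  simp only [ang]; ring

theorem sqb_comm (p q : Osc → Symb n) : sqb p q = -sqb q p := by
  simp only [sqb]; ring

theorem dSp_mem (i : Fin n) (s : Osc) : dSp i s ∈ legIdeal i := by
  rcases s with s | s <;> fin_cases s
  · exact X_some_mem i _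
  · exact neg_mem (X_some_mem i _)
  · exact X_some_mem i _
  · exact neg_mem (X_some_mem i _)

theorem ySp_mem (s : Osc) : ySp n s ∈ outIdeal n := X_none_mem s

theorem permLegs_dSp (π : Fin n ≃ Fin n) (i : Fin n) (s : Osc) :
    permLegs π (dSp i s) = dSp (π i) s := by
  rcases s with s | s <;> fin_cases s <;> simp [dSp, permLegs_X_some]

theorem permLegs_ySp (π : Fin n ≃ Fin n) (s : Osc) : permLegs π (ySp n s) = ySp n s :=
  permLegs_X_none π s

theorem permLegs_ang_dSp (π : Fin n ≃ Fin n) (i j : Fin n) :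
    permLegs π (ang (dSp i) (dSp j)) = ang (dSp (π i)) (dSp (π j)) := by
  simp [ang, permLegs_dSp]

theorem permLegs_sqb_dSp (π : Fin n ≃ Fin n) (i j : Fin n) :
    permLegs π (sqb (dSp i) (dSp j)) = sqb (dSp (π i)) (dSp (π j)) := by
  simp [sqb, permLegs_dSp]

theorem permLegs_ang_ySp (π : Fin n ≃ Fin n) (j : Fin n) :
    permLegs π (ang (ySp n) (dSp j)) = ang (ySp n) (dSp (π j)) := by
  simp [ang, permLegs_dSp, permLegs_ySp]

theorem permLegs_sqb_ySp (π : Fin n ≃ Fin n) (j : Fin n) :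
    permLegs π (sqb (ySp n) (dSp j)) = sqb (ySp n) (dSp (π j)) := by
  simp [sqb, permLegs_dSp, permLegs_ySp]

variable (Φ : Fin n → GenFun) (a : Osc →₀ ℕ)

/-- A term of the star exponent involves the output, or one of the two distinguished legs, or
contracts two arguments with the same dotted form; these are the three summands of the ideal. -/
theorem starExponent_mem (i j : Fin n) (c : Fin 2 → ℂ)
    (hC : ∀ k, k ≠ i → k ≠ j → DottedForm c (Φ k)) :
    starExponent n ∈ outIdeal n ⊔ (legIdeal i ⊔ legIdeal j) ⊔ annIdeal Φ a := by
  have hi : legIdeal i ≤ outIdeal n ⊔ (legIdeal i ⊔ legIdeal j) ⊔ annIdeal Φ a :=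
    le_sup_left.trans (le_sup_right.trans le_sup_left)
  have hj : legIdeal j ≤ outIdeal n ⊔ (legIdeal i ⊔ legIdeal j) ⊔ annIdeal Φ a :=
    le_sup_right.trans (le_sup_right.trans le_sup_left)
  refine add_mem (sum_mem fun k _ => ?_) (sum_mem fun k _ => sum_mem fun l _ => ?_)
  · exact (le_sup_left.trans le_sup_left : outIdeal n ≤ _) (sqb_mem ySp_mem _)
  · by_cases hki : k = i
    · exact hi (hki ▸ sqb_mem (dSp_mem k) _)
    by_cases hkj : k = j
    · exact hj (hkj ▸ sqb_mem (dSp_mem k) _)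
    by_cases hli : l = i
    · rw [sqb_comm]; exact neg_mem (hi (hli ▸ sqb_mem (dSp_mem l) _))
    by_cases hlj : l = j
    · rw [sqb_comm]; exact neg_mem (hj (hlj ▸ sqb_mem (dSp_mem l) _))
    · exact (le_sup_right : annIdeal Φ a ≤ _)
        (sqb_dSp_mem_annIdeal Φ a c k l (hC k hki hkj) (hC l hli hlj))

theorem smul_mem_ideal {J : Ideal (Symb n)} (c : ℂ) {F : Symb n} (h : F ∈ J) : c • F ∈ J := by
  rw [MvPolynomial.smul_eq_C_mul]
  exact Ideal.mul_mem_left _ _ h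

/-- A pigeonhole for powers of sums of ideals: `a.degree + 8` is `(a.degree + 1) + (3 + 3) + 1`.
Among that many factors there are more output factors than `a` admits, or three derivatives on a
single quadratic argument, or one trivial symbol. -/
theorem pow_mem_annIdeal (i j : Fin n) (hi : IsQuadratic (Φ i)) (hj : IsQuadratic (Φ j))
    {E : Symb n} (hE : E ∈ outIdeal n ⊔ (legIdeal i ⊔ legIdeal j) ⊔ annIdeal Φ a) (k : ℕ)
    (hk : a.degree + 8 ≤ k) : E ^ k ∈ annIdeal Φ a := by
  obtain ⟨r, rfl⟩ := Nat.exists_eq_add_of_le hk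
  rw [pow_add]
  refine Ideal.mul_mem_right _ _ ?_
  have h1 := Ideal.pow_mem_pow hE (a.degree + 8)
  have h2 : (legIdeal i ⊔ legIdeal j) ^ (3 + 3) ≤ annIdeal Φ a :=
    Ideal.sup_pow_add_le_pow_sup_pow.trans
      (sup_le (legIdeal_pow_three_le Φ a i hi) (legIdeal_pow_three_le Φ a j hj))
  have h3 : (outIdeal n ⊔ (legIdeal i ⊔ legIdeal j)) ^ ((a.degree + 1) + (3 + 3)) ≤ annIdeal Φ a :=
    Ideal.sup_pow_add_le_pow_sup_pow.trans
      (sup_le (outIdeal_pow_le Φ a _ (Nat.lt_succ_self _)) h2)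
  have h4 : (outIdeal n ⊔ (legIdeal i ⊔ legIdeal j) ⊔ annIdeal Φ a) ^
      (((a.degree + 1) + (3 + 3)) + 1) ≤ annIdeal Φ a :=
    Ideal.sup_pow_add_le_pow_sup_pow.trans (sup_le h3 (pow_one (annIdeal Φ a)).le)
  exact h4 h1

/-- Modulo trivial symbols only the contractions with the one-form remain in the exponent of the
star product. -/
theorem starExponent_sub_mem (i : Fin n) (c : Fin 2 → ℂ) (hC : ∀ k, k ≠ i → DottedForm c (Φ k)) :
    starExponent n - ((∑ k, sqb (ySp n) (dSp k)) +
      ∑ l, (if l < i then (1 : ℂ) else -1) • sqb (dSp l) (dSp i)) ∈ annIdeal Φ a := by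
  have h1 : ∑ l, (if l < i then (1 : ℂ) else -1) • sqb (dSp l) (dSp i) =
      ∑ k, ∑ l, ((if k < l then if l = i then sqb (dSp k) (dSp l) else 0 else 0) +
        (if l < k then if l = i then sqb (dSp l) (dSp k) else 0 else 0)) := by
    refine Finset.sum_congr rfl fun k _ => ?_
    rw [Finset.sum_eq_single i]
    · rcases lt_trichotomy k i with h | h | h
      · simp [h, h.not_gt]
      · subst h
        rw [sqb_dSp, mul_comm, sub_self]
        simp
      · simp only [h, h.not_gt, if_true, if_false, zero_add, neg_smul, one_smul]
        rw [sqb_comm, neg_neg]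
    · intro l _ hl
      simp [hl]
    · simp
  -- Relabelling the pair turns the contractions with the one-form on the left into ordered pairs,
  -- to be compared with the star exponent term by term.
  have h2 : ∑ k : Fin n, ∑ l, (if l < k then if l = i then sqb (dSp l) (dSp k) else 0 else 0) =
      ∑ k : Fin n, ∑ l, (if k < l then if k = i then sqb (dSp k) (dSp l) else 0 else 0) :=
    Finset.sum_comm
  have h3 : ∑ k : Fin n, ∑ l ∈ Finset.Ioi k, sqb (dSp k) (dSp l) =
      ∑ k : Fin n, ∑ l, (if k < l then sqb (dSp k) (dSp l) else 0) := by
    refine Finset.sum_congr rfl fun k _ => ?_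
    rw [← Finset.sum_filter]
    congr 1
    ext l; simp
  rw [starExponent, h1, h3, add_sub_add_left_eq_sub]
  simp only [Finset.sum_add_distrib]
  rw [h2, ← Finset.sum_add_distrib, ← Finset.sum_sub_distrib]
  refine sum_mem fun k _ => ?_
  rw [← Finset.sum_add_distrib, ← Finset.sum_sub_distrib]
  refine sum_mem fun l _ => ?_
  by_cases hkl : k < l
  · simp only [hkl, if_true]
    by_cases hl : l = i
    · have : k ≠ i := fun h => by omega
      simp [hl, this]
    · by_cases hk : k = i
      · rw [if_neg hl, if_pos hk, zero_add, sub_self]; exact zero_mem _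
      · simpa [hl, hk] using sqb_dSp_mem_annIdeal Φ a c k l (hC k hk) (hC l hl)
  · simp [hkl]

end Membership

/-! ### Graph sums: enumeration and criteria for vanishing. -/

section Graphs

variable {m : ℕ}

/-- `IsGraph` for plain functions. -/
def IsGraphFun (i j : Fin (m + 2)) (σ : Fin (m + 1) → Option (Fin (m + 2))) : Prop :=
  (∀ k l, σ k = σ l → k = l) ∧ (∀ k, σ k ≠ some i ∧ σ k ≠ some j) ∧
  ∀ k l, k < l →
    (cyclicPos i (σ k) < j → cyclicPos i (σ l) < j → cyclicPos i (σ l) < cyclicPos i (σ k)) ∧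
    ((j : ℕ) < cyclicPos i (σ k) → (j : ℕ) < cyclicPos i (σ l) →
      cyclicPos i (σ k) < cyclicPos i (σ l))

instance (i j : Fin (m + 2)) : DecidablePred (IsGraphFun (m := m) i j) := fun σ => by
  unfold IsGraphFun; infer_instance

/-- The graphs of a sub-vertex as a finite set. -/
def graphs (i j : Fin (m + 2)) : Finset (Fin (m + 1) → Option (Fin (m + 2))) :=
  Finset.univ.filter (IsGraphFun i j)

theorem mem_graphs {i j : Fin (m + 2)} {σ : Fin (m + 1) → Option (Fin (m + 2))} :
    σ ∈ graphs i j ↔ IsGraphFun i j σ := by simp [graphs]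

theorem act_integrand (i j : Fin (m + 2)) (σ : Fin (m + 1) → Option (Fin (m + 2)))
    (k : ℕ) (q : Fin m → ℝ × ℝ) (y : Osc → Symb (m + 2)) (p : Fin (m + 2) → Osc → Symb (m + 2))
    (Φ : Fin (m + 2) → GenFun) (a : Osc →₀ ℕ) :
    act (integrand i j σ k q y p) Φ a = (k.factorial : ℂ)⁻¹ * actL Φ a (ang (p i) (p j) ^ m *
      (starExponent (m + 2) + uvExponent i j σ q y p) ^ k) := by
  rw [act_eq_actL, integrand, map_smul, smul_eq_mul]

theorem graphSum_eq (i j : Fin (m + 2)) (y : Osc → Symb (m + 2))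
    (p : Fin (m + 2) → Osc → Symb (m + 2)) (Φ : Fin (m + 2) → GenFun) (k : ℕ) (a : Osc →₀ ℕ) :
    graphSum i j y p Φ k a = (k.factorial : ℂ)⁻¹ * ∑ σ ∈ graphs i j,
      ∫ q in simplexDom m, actL Φ a (ang (p i) (p j) ^ m *
        (starExponent (m + 2) + uvExponent i j σ q y p) ^ k) := by
  classical
  rw [graphSum, Finset.mul_sum]
  refine Finset.sum_bij (fun σ _ => (σ.1 : Fin (m + 1) → Option (Fin (m + 2)))) ?_ ?_ ?_ ?_
  · intro σ _
    exact mem_graphs.2 ⟨fun k l h => σ.1.injective h, σ.2⟩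
  · intro σ _ τ _ h
    exact Subtype.ext (DFunLike.coe_injective h)
  · intro σ hσ
    rw [mem_graphs] at hσ
    exact ⟨⟨⟨σ, fun k l h => hσ.1 k l h⟩, hσ.2⟩, Finset.mem_univ _, rfl⟩
  · intro σ _
    rw [← integral_const_mul]
    simp only [act_integrand]

theorem uvExponent_mem {J : Ideal (Symb (m + 2))} (i j : Fin (m + 2))
    (σ : Fin (m + 1) → Option (Fin (m + 2))) (q : Fin m → ℝ × ℝ) (y : Osc → Symb (m + 2))
    (p : Fin (m + 2) → Osc → Symb (m + 2)) (hi : ∀ s, p i s ∈ J) (hj : ∀ s, p j s ∈ J) :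
    uvExponent i j σ q y p ∈ J :=
  sum_mem fun _ _ => add_mem (smul_mem_ideal _ (ang_mem hi _)) (smul_mem_ideal _ (ang_mem hj _))

/-- The expansion of a sub-vertex stops once the order exceeds the degree of the output by the
number of oscillators in the one-forms. -/
theorem graphSum_eq_zero_of_le (i j : Fin (m + 2)) (y : Osc → Symb (m + 2))
    (p : Fin (m + 2) → Osc → Symb (m + 2)) (Φ : Fin (m + 2) → GenFun) (a : Osc →₀ ℕ)
    (i' j' : Fin (m + 2)) (c : Fin 2 → ℂ) (hi : IsQuadratic (Φ i')) (hj : IsQuadratic (Φ j'))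
    (hC : ∀ k, k ≠ i' → k ≠ j' → DottedForm c (Φ k))
    (hpi : ∀ s, p i s ∈ outIdeal (m + 2) ⊔ (legIdeal i' ⊔ legIdeal j'))
    (hpj : ∀ s, p j s ∈ outIdeal (m + 2) ⊔ (legIdeal i' ⊔ legIdeal j'))
    (k : ℕ) (hk : a.degree + 8 ≤ k) : graphSum i j y p Φ k a = 0 := by
  rw [graphSum_eq, Finset.sum_eq_zero, mul_zero]
  intro σ _
  have h : ∀ q, actL Φ a (ang (p i) (p j) ^ m *
        (starExponent (m + 2) + uvExponent i j σ q y p) ^ k) = 0 := by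
    intro q
    refine actL_eq_zero_of_mem Φ a (Ideal.mul_mem_left _ _ ?_)
    refine pow_mem_annIdeal Φ a i' j' hi hj (add_mem (starExponent_mem Φ a i' j' c hC) ?_) k hk
    exact (le_sup_left : _ ≤ outIdeal (m + 2) ⊔ (legIdeal i' ⊔ legIdeal j') ⊔ annIdeal Φ a)
      (uvExponent_mem i j σ q y p hpi hpj)
  simp [h]

/-- The prefactor alone contains three derivatives of the quadratic argument `i'`, so neither the
exponent nor the graph matters. -/
theorem graphSum_eq_zero_of_three_le (i j : Fin (m + 2)) (y : Osc → Symb (m + 2))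
    (p : Fin (m + 2) → Osc → Symb (m + 2)) (Φ : Fin (m + 2) → GenFun) (a : Osc →₀ ℕ)
    (i' : Fin (m + 2)) (hi : IsQuadratic (Φ i')) (h : ang (p i) (p j) ∈ legIdeal i')
    (hm : 3 ≤ m) (k : ℕ) : graphSum i j y p Φ k a = 0 := by
  rw [graphSum_eq, Finset.sum_eq_zero, mul_zero]
  intro σ _
  obtain ⟨r, rfl⟩ := Nat.exists_eq_add_of_le hm
  have h' : ∀ q, actL Φ a (ang (p i) (p j) ^ (3 + r) *
        (starExponent _ + uvExponent i j σ q y p) ^ k) = 0 := by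
    intro q
    refine actL_eq_zero_of_mem Φ a (Ideal.mul_mem_right _ _ ?_)
    rw [pow_add]
    exact Ideal.mul_mem_right _ _ (legIdeal_pow_three_le Φ a i' hi (Ideal.pow_mem_pow h 3))
  simp [h']

end Graphs

/-! ### Sub-vertices with two one-forms. -/

section TwoForm

variable {m : ℕ} {A B C : GenFun} {c : Fin 2 → ℂ}

theorem args₂_left {n : ℕ} (i j : Fin n) : args₂ i j A B C i = A := by simp [args₂]

theorem args₂_right {n : ℕ} {i j : Fin n} (h : i ≠ j) : args₂ i j A B C j = B := by
  simp [args₂, h.symm]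

theorem args₂_of_ne {n : ℕ} {i j k : Fin n} (hi : k ≠ i) (hj : k ≠ j) : args₂ i j A B C k = C := by
  simp [args₂, hi, hj]

theorem subV_eq_zero_of_le {i j : Fin (m + 2)} (hij : i ≠ j) (hA : IsQuadratic A)
    (hB : IsQuadratic B) (hC : DottedForm c C) (a : Osc →₀ ℕ) (k : ℕ) (hk : a.degree + 8 ≤ k) :
    subV i j (args₂ i j A B C) k a = 0 := by
  rw [subV, graphSum_eq_zero_of_le i j _ _ _ a i j c _ _ _ _ _ k hk, mul_zero]
  · rwa [args₂_left]
  · rwa [args₂_right hij]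
  · intro k hi hj
    rwa [args₂_of_ne hi hj]
  · intro s
    exact (le_sup_left.trans le_sup_right : legIdeal i ≤ _) (dSp_mem i s)
  · intro s
    exact (le_sup_right.trans le_sup_right : legIdeal j ≤ _) (dSp_mem j s)

theorem summable_subV {i j : Fin (m + 2)} (hij : i ≠ j) (hA : IsQuadratic A)
    (hB : IsQuadratic B) (hC : DottedForm c C) (a : Osc →₀ ℕ) :
    Summable fun k => subV i j (args₂ i j A B C) k a := by
  refine summable_of_ne_finset_zero (s := Finset.range (a.degree + 8)) fun k hk => ?_
  rw [Finset.mem_range, not_lt] at hk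
  exact subV_eq_zero_of_le hij hA hB hC a k hk

theorem subV_eq_zero_of_three_le {i j : Fin (m + 2)} (hA : IsQuadratic A)
    (a : Osc →₀ ℕ) (hm : 3 ≤ m) (k : ℕ) : subV i j (args₂ i j A B C) k a = 0 := by
  rw [subV, graphSum_eq_zero_of_three_le i j _ _ _ a i _ (ang_mem (dSp_mem i) _) hm, mul_zero]
  rwa [args₂_left]

theorem args₂_comp_swap {n : ℕ} {i j : Fin n} (hij : i ≠ j) :
    args₂ i j A B C ∘ Equiv.swap i j = args₂ i j B A C := by
  ext1 k
  rw [Function.comp]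
  by_cases hi : k = i
  · subst hi
    rw [Equiv.swap_apply_left, args₂_right hij, args₂_left]
  by_cases hj : k = j
  · subst hj
    rw [Equiv.swap_apply_right, args₂_right hij, args₂_left]
  · rw [Equiv.swap_apply_of_ne_of_ne hi hj, args₂_of_ne hi hj, args₂_of_ne hi hj]

/-- Since `E - E'` divides `E ^ k - E' ^ k`, exponents may be compared to first order, in the
presence of the prefactor `A`. -/
theorem mul_pow_sub_pow_mem {R : Type*} [CommRing R] {J : Ideal R} {A E E' : R}
    (h : A * (E - E') ∈ J) (k : ℕ) : A * E ^ k - A * E' ^ k ∈ J := by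
  obtain ⟨r, hr⟩ := sub_dvd_pow_sub_pow E E' k
  rw [← mul_sub, hr, ← mul_assoc]
  exact Ideal.mul_mem_right _ _ h

/-- In the quartic vertex all undotted oscillators of the one-forms are contracted with each other,
symmetrically. -/
theorem subV_two_swap {i j : Fin (2 + 2)} (hij : i ≠ j) (hA : IsQuadratic A)
    (hB : IsQuadratic B) (hC : DottedForm c C) (a : Osc →₀ ℕ) (k : ℕ) :
    subV i j (args₂ i j A B C) k a = subV i j (args₂ i j B A C) k a := by
  -- The squared bracket already puts two derivatives on each one-form, so every exponent term
  -- touching leg `i` or `j` is trivial. Only the dotted Taylor shift of the zero-forms is left,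
  -- which depends neither on the graph nor on the integration point.
  have key : ∀ (A B : GenFun), IsQuadratic A → IsQuadratic B → ∀ σ q,
      actL (args₂ i j A B C) a (ang (dSp i) (dSp j) ^ 2 *
        (starExponent (2 + 2) + uvExponent i j σ q (ySp _) dSp) ^ k) =
      actL (args₂ i j A B C) a (ang (dSp i) (dSp j) ^ 2 *
        (∑ l, if l = i ∨ l = j then 0 else sqb (ySp _) (dSp l)) ^ k) := by
    intro A B hA hB σ q
    refine actL_eq_of_sub_mem _ _ (mul_pow_sub_pow_mem ?_ k)
    have h1 : ang (dSp i) (dSp j) ^ 2 ∈ legIdeal i ^ 2 := Ideal.pow_mem_pow (ang_mem (dSp_mem i) _) 2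
    have h2 : ang (dSp i) (dSp j) ^ 2 ∈ legIdeal j ^ 2 := by
      rw [ang_comm]
      exact Ideal.pow_mem_pow (neg_mem (ang_mem (dSp_mem j) _)) 2
    have h3 : ∀ F ∈ legIdeal i, ang (dSp i) (dSp j) ^ 2 * F ∈ annIdeal (args₂ i j A B C) a := by
      intro F hF
      refine legIdeal_pow_three_le _ a i (by rwa [args₂_left]) ?_
      rw [pow_succ]
      exact Ideal.mul_mem_mul h1 hF
    have h4 : ∀ F ∈ legIdeal j, ang (dSp i) (dSp j) ^ 2 * F ∈ annIdeal (args₂ i j A B C) a := by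
      intro F hF
      refine legIdeal_pow_three_le _ a j (by rwa [args₂_right hij]) ?_
      rw [pow_succ]
      exact Ideal.mul_mem_mul h2 hF
    have h5 : uvExponent i j σ q (ySp _) dSp ∈ legIdeal i ⊔ legIdeal j :=
      uvExponent_mem i j σ q _ _ (fun s => (le_sup_left : legIdeal i ≤ _) (dSp_mem i s))
        (fun s => (le_sup_right : legIdeal j ≤ _) (dSp_mem j s))
    have h6 : ∀ F ∈ legIdeal i ⊔ legIdeal j,
        ang (dSp i) (dSp j) ^ 2 * F ∈ annIdeal (args₂ i j A B C) a := by
      intro F hF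
      obtain ⟨x, hx, y, hy, rfl⟩ := Submodule.mem_sup.1 hF
      rw [mul_add]
      exact add_mem (h3 x hx) (h4 y hy)
    have hd : ∀ l, l ≠ i → l ≠ j → DottedForm c (args₂ i j A B C l) := fun l hi hj => by
      rwa [args₂_of_ne hi hj]
    rw [add_sub_right_comm, mul_add]
    refine add_mem ?_ (h6 _ h5)
    rw [starExponent, add_sub_right_comm, mul_add, ← Finset.sum_sub_distrib, Finset.mul_sum,
      Finset.mul_sum]
    refine add_mem (sum_mem fun l _ => ?_) (sum_mem fun l _ => ?_)
    · by_cases hli : l = i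
      · rw [if_pos (Or.inl hli), sub_zero, sqb_comm]
        exact h3 _ (neg_mem (hli ▸ sqb_mem (dSp_mem l) _))
      by_cases hlj : l = j
      · rw [if_pos (Or.inr hlj), sub_zero, sqb_comm]
        exact h4 _ (neg_mem (hlj ▸ sqb_mem (dSp_mem l) _))
      · rw [if_neg (by tauto), sub_self, mul_zero]
        exact zero_mem _
    · rw [Finset.mul_sum]
      refine sum_mem fun r _ => ?_
      by_cases hli : l = i
      · exact h3 _ (hli ▸ sqb_mem (dSp_mem l) _)
      by_cases hlj : l = j
      · exact h4 _ (hlj ▸ sqb_mem (dSp_mem l) _)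
      by_cases hri : r = i
      · rw [sqb_comm]; exact h3 _ (neg_mem (hri ▸ sqb_mem (dSp_mem r) _))
      by_cases hrj : r = j
      · rw [sqb_comm]; exact h4 _ (neg_mem (hrj ▸ sqb_mem (dSp_mem r) _))
      · exact Ideal.mul_mem_left _ _ (sqb_dSp_mem_annIdeal _ a c l r (hd l hli hlj) (hd r hri hrj))
  rw [subV, subV, graphSum_eq, graphSum_eq]
  simp only [key A B hA hB, key B A hB hA]
  -- Exchanging the legs `i` and `j` changes the sign of `⟨∂_i ∂_j⟩`, whose square is invariant.
  rw [← args₂_comp_swap hij, ← actL_permLegs, map_mul, map_pow, map_pow, permLegs_ang_dSp, map_sum,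
    Equiv.swap_apply_left, Equiv.swap_apply_right, ang_comm (dSp j), neg_sq]
  have h7 : ∑ l, permLegs (Equiv.swap i j) (if l = i ∨ l = j then 0 else sqb (ySp _) (dSp l)) =
      ∑ l, if l = i ∨ l = j then 0 else sqb (ySp _) (dSp l) := by
    refine Finset.sum_congr rfl fun l _ => ?_
    split_ifs with h
    · rw [map_zero]
    · push Not at h
      rw [permLegs_sqb_ySp, Equiv.swap_apply_of_ne_of_ne h.1 h.2]
  rw [h7]

end TwoForm

/-! ### The reflection of the integration domain -/

section Reflection

variable {m : ℕ}

theorem fullVec_castSucc (q : Fin m → ℝ × ℝ) (k : Fin m) : fullVec q k.castSucc = q k := by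
  simp [fullVec]

theorem fullVec_last (q : Fin m → ℝ × ℝ) :
    fullVec q (Fin.last m) = (1 - ∑ k, (q k).1, 1 - ∑ k, (q k).2) := by
  simp [fullVec]

theorem sum_fullVec_fst (q : Fin m → ℝ × ℝ) : ∑ c, (fullVec q c).1 = 1 := by
  rw [Fin.sum_univ_castSucc]
  simp [fullVec_castSucc, fullVec_last]

theorem sum_fullVec_snd (q : Fin m → ℝ × ℝ) : ∑ c, (fullVec q c).2 = 1 := by
  rw [Fin.sum_univ_castSucc]
  simp [fullVec_castSucc, fullVec_last]

theorem fullVec_eq_of_sum {w : Fin (m + 1) → ℝ × ℝ} (h1 : ∑ c, (w c).1 = 1)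
    (h2 : ∑ c, (w c).2 = 1) : fullVec (fun k => w k.castSucc) = w := by
  ext1 c
  refine Fin.lastCases ?_ (fun k => ?_) c
  · rw [fullVec_last]
    rw [Fin.sum_univ_castSucc] at h1 h2
    ext
    · simp only; linarith
    · simp only; linarith
  · rw [fullVec_castSucc]

/-- Reversal of the order of the two-vectors, together with the exchange of `u` and `v`. -/
def reflect (q : Fin m → ℝ × ℝ) : Fin m → ℝ × ℝ := fun k => (fullVec q k.castSucc.rev).swap

theorem fullVec_reflect (q : Fin m → ℝ × ℝ) (c : Fin (m + 1)) :
    fullVec (reflect q) c = (fullVec q c.rev).swap := by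
  have := fullVec_eq_of_sum (w := fun c => (fullVec q c.rev).swap)
    (by rw [← sum_fullVec_snd q]; exact Equiv.sum_comp Fin.revPerm fun c => (fullVec q c).2)
    (by rw [← sum_fullVec_fst q]; exact Equiv.sum_comp Fin.revPerm fun c => (fullVec q c).1)
  exact congrFun this c

theorem reflect_involutive : Function.Involutive (reflect (m := m)) := by
  intro q
  ext1 k
  rw [reflect, fullVec_reflect, Fin.rev_rev, Prod.swap_swap, fullVec_castSucc]

/-- Exchanging `u` and `v` inverts the slopes; reversing the sequence restores their increasing
order. -/
theorem reflect_mem_iff (q : Fin m → ℝ × ℝ) : reflect q ∈ simplexDom m ↔ q ∈ simplexDom m := by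
  have h : ∀ q : Fin m → ℝ × ℝ, q ∈ simplexDom m → reflect q ∈ simplexDom m := by
    intro q hq
    refine ⟨fun k => ?_, fun k l hkl => ?_⟩
    · rw [fullVec_reflect]
      exact (hq.1 k.rev).symm
    · rw [fullVec_reflect, fullVec_reflect]
      have := hq.2 l.rev k.rev (Fin.rev_lt_rev.2 hkl)
      simp only [Prod.fst_swap, Prod.snd_swap]
      linarith
  refine ⟨fun hq => ?_, h q⟩
  have := h _ hq
  rwa [reflect_involutive q] at this

/-- The linear part of the reflection. -/
def reflectLinear (m : ℕ) : (Fin m → ℝ × ℝ) →ₗ[ℝ] (Fin m → ℝ × ℝ) where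
  toFun q := reflect q - reflect 0
  map_add' q q' := by
    ext1 k
    simp only [reflect, Pi.sub_apply, Pi.add_apply]
    refine Fin.lastCases ?_ (fun l => ?_) k.castSucc.rev
    · ext <;> simp [fullVec_last, Finset.sum_add_distrib] <;> ring
    · ext <;> simp [fullVec_castSucc]
  map_smul' t q := by
    ext1 k
    simp only [reflect, Pi.sub_apply, Pi.smul_apply]
    refine Fin.lastCases ?_ (fun l => ?_) k.castSucc.rev
    · ext <;> simp [fullVec_last, Finset.mul_sum]
    · ext <;> simp [fullVec_castSucc]

/-- The reflection is an affine involution, so its linear part squares to the identity and has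
determinant `±1`; translations preserve the measure. -/
theorem measurePreserving_reflect : MeasurePreserving (reflect (m := m)) volume volume := by
  have hL : ∀ q, reflect q = reflectLinear m q + reflect 0 := fun q => by simp [reflectLinear]
  have h2 : ∀ q, reflectLinear m (reflectLinear m q) = q := by
    intro q
    have h0 := reflect_involutive (m := m) 0
    have hq := reflect_involutive q
    rw [hL, hL q, map_add] at hq
    rw [hL] at h0
    rw [add_assoc, h0, add_zero] at hq
    exact hq
  have hdet : LinearMap.det (reflectLinear m) * LinearMap.det (reflectLinear m) = 1 := by
    rw [← map_mul, ← map_one (LinearMap.det (M := Fin m → ℝ × ℝ) (A := ℝ))]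
    congr 1
    exact LinearMap.ext h2
  have habs : |(LinearMap.det (reflectLinear m))⁻¹| = 1 := by
    rw [abs_inv, inv_eq_one]
    have := congrArg abs hdet
    rw [abs_mul, abs_one] at this
    nlinarith [abs_nonneg (LinearMap.det (reflectLinear m))]
  have hlin : MeasurePreserving (reflectLinear m) volume volume := by
    refine ⟨(LinearMap.continuous_of_finiteDimensional _).measurable, ?_⟩
    rw [Measure.map_linearMap_addHaar_eq_smul_addHaar _ (left_ne_zero_of_mul_eq_one hdet), habs]
    simp
  have := (measurePreserving_add_right volume (reflect (m := m) 0)).comp hlin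
  have he : reflect (m := m) = (fun x => x + reflect 0) ∘ reflectLinear m := funext hL
  rwa [he]

theorem setIntegral_comp_reflect (f : (Fin m → ℝ × ℝ) → ℂ) :
    ∫ q in simplexDom m, f (reflect q) = ∫ q in simplexDom m, f q := by
  have hpre : reflect ⁻¹' simplexDom m = simplexDom m := Set.ext reflect_mem_iff
  have he := (MeasurableEquiv.ofInvolutive _ reflect_involutive
    (measurePreserving_reflect (m := m)).measurable).measurableEmbedding
  conv_lhs => rw [← hpre]
  exact measurePreserving_reflect.setIntegral_preimage_emb he f _

theorem continuous_fullVec (c : Fin (m + 1)) :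
    Continuous fun q : Fin m → ℝ × ℝ => fullVec q c := by
  refine Fin.lastCases ?_ (fun l => ?_) c
  · simp only [fullVec_last]; fun_prop
  · simp only [fullVec_castSucc]; fun_prop

/-- The defining inequalities are closed, and non-negative coordinates summing to one confine the
domain to a unit cube. -/
theorem isCompact_simplexDom (m : ℕ) : IsCompact (simplexDom m) := by
  have hcl : IsClosed (simplexDom m) := by
    simp only [simplexDom, Set.ofPred_and, Set.ofPred_forall]
    refine IsClosed.inter (isClosed_iInter fun k => IsClosed.inter ?_ ?_)
      (isClosed_iInter fun k => isClosed_iInter fun l => isClosed_iInter fun _ => ?_)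
    · exact isClosed_le continuous_const (continuous_fullVec k).fst
    · exact isClosed_le continuous_const (continuous_fullVec k).snd
    · exact isClosed_le ((continuous_fullVec k).fst.mul (continuous_fullVec l).snd)
        ((continuous_fullVec l).fst.mul (continuous_fullVec k).snd)
  refine (isCompact_Icc (a := (0 : Fin m → ℝ × ℝ)) (b := 1)).of_isClosed_subset hcl ?_
  intro q hq
  constructor
  · intro k
    have := hq.1 k.castSucc
    rw [fullVec_castSucc] at this
    exact ⟨this.1, this.2⟩
  · intro k
    have h1 := Finset.single_le_sum (f := fun c => (fullVec q c).1) (fun c _ => (hq.1 c).1)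
      (Finset.mem_univ k.castSucc)
    have h2 := Finset.single_le_sum (f := fun c => (fullVec q c).2) (fun c _ => (hq.1 c).2)
      (Finset.mem_univ k.castSucc)
    rw [sum_fullVec_fst] at h1
    rw [sum_fullVec_snd] at h2
    simp only [fullVec_castSucc] at h1 h2
    exact ⟨h1, h2⟩

theorem integrable_simplexDom {f : (Fin m → ℝ × ℝ) → ℂ} (hf : Continuous f) :
    Integrable f (volume.restrict (simplexDom m)) :=
  hf.continuousOn.integrableOn_compact (isCompact_simplexDom m)

/-- The integrands are polynomial in the integration variables. Together with compactness this gives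
integrability, needed to split the integrals. -/
theorem continuous_map_mul_pow {X ι : Type*} [TopologicalSpace X] [Fintype ι] {n : ℕ}
    (L : Symb n →ₗ[ℂ] ℂ) (E : Symb n) (M N : ι → Symb n) {f g : ι → X → ℂ}
    (hf : ∀ c, Continuous (f c)) (hg : ∀ c, Continuous (g c)) (k : ℕ) (G : Symb n) :
    Continuous fun q => L (G * (E + ∑ c, (f c q • M c + g c q • N c)) ^ k) := by
  induction k generalizing G with
  | zero => simp only [pow_zero]; exact continuous_const
  | succ k ih =>
    simp only [pow_succ', ← mul_assoc, mul_add, add_mul, Finset.mul_sum, Finset.sum_mul, map_add,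
      map_sum, mul_smul_comm, smul_mul_assoc, map_smul, smul_eq_mul]
    refine (ih _).add (continuous_finsetSum _ fun c _ => ?_)
    exact ((hf c).mul (ih _)).add ((hg c).mul (ih _))

end Reflection

/-! ### Sub-vertices with a single one-form -/

section OneFormVertex

variable {m : ℕ} {A C : GenFun} {c : Fin 2 → ℂ}

theorem args₁_self {n : ℕ} (i : Fin n) : args₁ i A C i = A := by simp [args₁]

theorem args₁_of_ne {n : ℕ} {i k : Fin n} (h : k ≠ i) : args₁ i A C k = C := by simp [args₁, h]

/-- The leg of the dual vertex (last argument a zero-form) corresponding to a leg of the original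
one. -/
def dualLeg : Option (Fin (m + 2)) → Fin (m + 2)
  | none => Fin.last _
  | some l => Fin.cases 0 Fin.castSucc l

/-- The leg of the dual vertex (last argument the one-form) corresponding to a leg of the original
one. -/
def dualLegLast : Option (Fin (m + 2)) → Fin (m + 2)
  | none => 0
  | some l => Fin.lastCases 0 Fin.succ l

/-- Leg `0` of the original vertex carries the output after duality, so the value of `dualLeg` there
is an arbitrary default. This is why it is excluded. -/
theorem dualLeg_injective {x y : Option (Fin (m + 2))} (hx : x ≠ some 0) (hy : y ≠ some 0)
    (h : dualLeg x = dualLeg y) : x = y := by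
  have key : ∀ z : Option (Fin (m + 2)), z ≠ some 0 →
      z = none ∧ dualLeg z = Fin.last _ ∨ ∃ l : Fin (m + 1), z = some l.succ ∧
        dualLeg z = l.castSucc := by
    rintro (_ | l) hz
    · exact Or.inl ⟨rfl, rfl⟩
    · refine Or.inr ?_
      obtain ⟨l', rfl⟩ := Fin.exists_succ_eq.2 (fun h : l = 0 => hz (h ▸ rfl))
      exact ⟨l', rfl, by simp [dualLeg]⟩
  rcases key x hx with ⟨rfl, h1⟩ | ⟨l, rfl, h1⟩ <;> rcases key y hy with ⟨rfl, h2⟩ | ⟨l', rfl, h2⟩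
  · rfl
  · rw [h1, h2] at h
    exact absurd h.symm (Fin.castSucc_ne_last l')
  · rw [h1, h2] at h
    exact absurd h (Fin.castSucc_ne_last l)
  · rw [h1, h2] at h
    rw [Fin.castSucc_injective _ h]

/-- Here the last leg becomes the output and carries the default value. -/
theorem dualLegLast_injective {x y : Option (Fin (m + 2))} (hx : x ≠ some (Fin.last _))
    (hy : y ≠ some (Fin.last _)) (h : dualLegLast x = dualLegLast y) : x = y := by
  have key : ∀ z : Option (Fin (m + 2)), z ≠ some (Fin.last _) →
      z = none ∧ dualLegLast z = 0 ∨ ∃ l : Fin (m + 1), z = some l.castSucc ∧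
        dualLegLast z = l.succ := by
    rintro (_ | l) hz
    · exact Or.inl ⟨rfl, rfl⟩
    · refine Or.inr ?_
      obtain ⟨l', rfl⟩ := Fin.exists_castSucc_eq.2 (fun h : l = Fin.last _ => hz (h ▸ rfl))
      exact ⟨l', rfl, by simp [dualLegLast]⟩
  rcases key x hx with ⟨rfl, h1⟩ | ⟨l, rfl, h1⟩ <;> rcases key y hy with ⟨rfl, h2⟩ | ⟨l', rfl, h2⟩
  · rfl
  · rw [h1, h2] at h
    exact absurd h.symm (Fin.succ_ne_zero l')
  · rw [h1, h2] at h
    exact absurd h (Fin.succ_ne_zero l)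
  · rw [h1, h2] at h
    rw [Fin.succ_injective _ h]

/-- The double sign comes from `∂_out = -y` combined with the substitution `y ↦ -∂_n`. After duality
all vectors are attached to zero-forms. -/
theorem dualLeg_spec {x : Option (Fin (m + 2))} (hx : x ≠ some 0) :
    x.elim (- -dSp (Fin.last (m + 1))) (Fin.cons (α := fun _ => Osc → Symb (m + 2)) (ySp (m + 2))
      (fun l => dSp l.castSucc)) = dSp (dualLeg x) := by
  rcases x with _ | l
  · simp [dualLeg]
  · obtain ⟨l', rfl⟩ := Fin.exists_succ_eq.2 (fun h : l = 0 => hx (h ▸ rfl))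
    simp [dualLeg]

theorem dualLegLast_spec {x : Option (Fin (m + 2))} (hx : x ≠ some (Fin.last _)) :
    x.elim (- -dSp (0 : Fin (m + 2))) (Fin.snoc (α := fun _ => Osc → Symb (m + 2))
      (fun l => dSp l.succ) (ySp (m + 2))) = dSp (dualLegLast x) := by
  rcases x with _ | l
  · simp [dualLegLast]
  · obtain ⟨l', rfl⟩ := Fin.exists_castSucc_eq.2 (fun h : l = Fin.last _ => hx (h ▸ rfl))
    simp [dualLegLast]

theorem subU_castSucc (i : Fin (m + 1)) (Φ : Fin (m + 2) → GenFun) (k : ℕ) (a : Osc →₀ ℕ) :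
    subU i.castSucc Φ k a = (-1) ^ (i : ℕ) * graphSum 0 i.succ (-dSp (Fin.last (m + 1)))
        (Fin.cons (α := fun _ => Osc → Symb (m + 2)) (ySp _) (fun l => dSp l.castSucc)) Φ k a := by
  rw [subU, Fin.lastCases_castSucc, zero_add, pow_add, pow_add]
  simp

theorem subU_last (Φ : Fin (m + 2) → GenFun) (k : ℕ) (a : Osc →₀ ℕ) :
    subU (Fin.last (m + 1)) Φ k a =
      -graphSum (Fin.last m).castSucc (Fin.last (m + 1)) (-dSp 0)
        (Fin.snoc (α := fun _ => Osc → Symb (m + 2)) (fun l => dSp l.succ) (ySp _)) Φ k a := by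
  rw [subU, Fin.lastCases_last, show m + (m + 1) + 1 = 2 * (m + 1) by ring, pow_mul]
  simp

theorem subU_eq_zero_of_le (i : Fin (m + 2)) (hA : IsQuadratic A) (hC : DottedForm c C)
    (a : Osc →₀ ℕ) (k : ℕ) (hk : a.degree + 8 ≤ k) : subU i (args₁ i A C) k a = 0 := by
  have hy : ∀ (i : Fin (m + 2)) s, ySp (m + 2) s ∈ outIdeal (m + 2) ⊔ (legIdeal i ⊔ legIdeal i) :=
    fun i s => (le_sup_left : outIdeal (m + 2) ≤ _) (ySp_mem s)
  have hd : ∀ (i : Fin (m + 2)) s, dSp i s ∈ outIdeal (m + 2) ⊔ (legIdeal i ⊔ legIdeal i) :=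
    fun i s => (le_sup_left.trans le_sup_right : legIdeal i ≤ _) (dSp_mem i s)
  refine Fin.lastCases ?_ (fun i => ?_) i
  · rw [subU_last, graphSum_eq_zero_of_le _ _ _ _ _ a (Fin.last _) (Fin.last _) c _ _ _ _ _ k hk,
      neg_zero]
    · rwa [args₁_self]
    · rwa [args₁_self]
    · intro k h _
      rwa [args₁_of_ne h]
    · rw [Fin.snoc_castSucc, Fin.succ_last]
      exact hd _
    · rw [Fin.snoc_last]
      exact hy _
  · rw [subU_castSucc, graphSum_eq_zero_of_le _ _ _ _ _ a i.castSucc i.castSucc c _ _ _ _ _ k hk,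
      mul_zero]
    · rwa [args₁_self]
    · rwa [args₁_self]
    · intro k h _
      rwa [args₁_of_ne h]
    · rw [Fin.cons_zero]
      exact hy _
    · rw [Fin.cons_succ]
      exact hd _

theorem summable_subU (i : Fin (m + 2)) (hA : IsQuadratic A) (hC : DottedForm c C)
    (a : Osc →₀ ℕ) : Summable fun k => subU i (args₁ i A C) k a := by
  refine summable_of_ne_finset_zero (s := Finset.range (a.degree + 8)) fun k hk => ?_
  rw [Finset.mem_range, not_lt] at hk
  exact subU_eq_zero_of_le i hA hC a k hk

theorem subU_eq_zero_of_three_le (i : Fin (m + 2)) (hA : IsQuadratic A)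
    (a : Osc →₀ ℕ) (hm : 3 ≤ m) (k : ℕ) : subU i (args₁ i A C) k a = 0 := by
  refine Fin.lastCases ?_ (fun i => ?_) i
  · rw [subU_last, graphSum_eq_zero_of_three_le _ _ _ _ _ a (Fin.last _) _ _ hm, neg_zero]
    · rwa [args₁_self]
    · rw [Fin.snoc_castSucc, Fin.succ_last]
      exact ang_mem (dSp_mem _) _
  · rw [subU_castSucc, graphSum_eq_zero_of_three_le _ _ _ _ _ a i.castSucc _ _ hm, mul_zero]
    · rwa [args₁_self]
    · rw [Fin.cons_zero, Fin.cons_succ, ang_comm]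
      exact neg_mem (ang_mem (dSp_mem _) _)

/-- The exponent of a dual sub-vertex without the dotted contractions with the one-form, after
the one-form is moved to the first position and the vector `w c` is attached to leg `c + 1`. -/
def dualExponent (w : Fin (m + 1) → ℝ × ℝ) : Symb (m + 2) :=
  (∑ k, sqb (ySp _) (dSp k)) + ∑ c, (((w c).1 : ℂ) • ang (ySp _) (dSp c.succ) +
    ((w c).2 : ℂ) • ang (dSp 0) (dSp c.succ))

/-- The one-form is moved to the front and the leg carrying the vector `c` to position `c + 1`. As
the zero-forms coincide and have no dotted contractions among themselves, the original order
survives only in the sign of each contraction with the one-form. -/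
theorem actL_dual (a : Osc →₀ ℕ) (i : Fin (m + 2)) (τ : Fin (m + 1) → Fin (m + 2))
    (hτ : Function.Injective τ) (hi : ∀ c, τ c ≠ i) (hC : DottedForm c C)
    (w : Fin (m + 1) → ℝ × ℝ) (k : ℕ) :
    actL (args₁ i A C) a (ang (ySp _) (dSp i) ^ m * (starExponent (m + 2) +
      ∑ c, (((w c).1 : ℂ) • ang (ySp _) (dSp (τ c)) +
        ((w c).2 : ℂ) • ang (dSp i) (dSp (τ c)))) ^ k) =
    actL (args₁ 0 A C) a (ang (ySp _) (dSp 0) ^ m * (dualExponent w +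
      ∑ c : Fin (m + 1), (if τ c < i then (1 : ℂ) else -1) • sqb (dSp c.succ) (dSp 0)) ^ k) := by
  -- An injective self-map of a finite set is a permutation; `i` followed by `τ` provides the
  -- relabelling of the legs.
  have hinj : Function.Injective (Fin.cons i τ : Fin (m + 2) → Fin (m + 2)) :=
    Fin.cons_injective_iff.2 ⟨fun ⟨x, hx⟩ => hi x hx, hτ⟩
  let π : Fin (m + 2) ≃ Fin (m + 2) := Equiv.ofBijective _ (Finite.injective_iff_bijective.1 hinj)
  have h0 : π 0 = i := rfl
  have hs : ∀ c : Fin (m + 1), π c.succ = τ c := fun c => rfl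
  have hargs : args₁ i A C ∘ π = args₁ 0 A C := by
    ext1 x
    refine Fin.cases ?_ (fun x => ?_) x
    · rw [Function.comp, h0, args₁_self, args₁_self]
    · rw [Function.comp, hs, args₁_of_ne (hi x), args₁_of_ne (Fin.succ_ne_zero x)]
  rw [← hargs, ← actL_permLegs, map_mul (permLegs π), map_pow (permLegs π), map_pow (permLegs π),
    permLegs_ang_ySp, h0]
  refine actL_eq_of_sub_mem _ _ (mul_pow_sub_pow_mem (Ideal.mul_mem_left _ _ ?_) k)
  have hmap : permLegs π (dualExponent w + ∑ c : Fin (m + 1),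
      (if τ c < i then (1 : ℂ) else -1) • sqb (dSp c.succ) (dSp 0)) =
      ((∑ k, sqb (ySp _) (dSp k)) +
        ∑ l, (if l < i then (1 : ℂ) else -1) • sqb (dSp l) (dSp i)) +
      ∑ c, (((w c).1 : ℂ) • ang (ySp _) (dSp (τ c)) +
        ((w c).2 : ℂ) • ang (dSp i) (dSp (τ c))) := by
    have e1 : ∑ l, (if l < i then (1 : ℂ) else -1) • sqb (dSp l) (dSp i) =
        ∑ c, (if τ c < i then (1 : ℂ) else -1) • sqb (dSp (τ c)) (dSp i) := by
      rw [← Equiv.sum_comp π, Fin.sum_univ_succ, h0, sqb_dSp i i, mul_comm, sub_self, smul_zero,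
        zero_add]
      simp only [hs]
    have e2 : ∑ k, sqb (ySp (m + 2)) (dSp k) = ∑ k, sqb (ySp (m + 2)) (dSp (π k)) :=
      (Equiv.sum_comp π _).symm
    simp only [dualExponent, map_add, map_sum, map_smul, permLegs_sqb_ySp, permLegs_ang_ySp,
      permLegs_ang_dSp, permLegs_sqb_dSp, hs, h0]
    rw [e1, e2]
    ring
  rw [hmap, add_sub_add_right_eq_sub]
  exact starExponent_sub_mem _ a i c fun k hk => by rwa [args₁_of_ne hk]

/-- Binomial expansion to first order in `D`, exact modulo `J` because `A * D ^ 2` lies in `J`. -/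
theorem mul_add_pow_sub_mem {R : Type*} [CommRing R] {J : Ideal R} {A E D : R}
    (h : A * D ^ 2 ∈ J) (k : ℕ) :
    A * (E + D) ^ k - (A * E ^ k + k * (A * D * E ^ (k - 1))) ∈ J := by
  obtain ⟨r, hr⟩ := Polynomial.powAddExpansion E D k
  rw [hr]
  have : A * (E ^ k + k * E ^ (k - 1) * D + r * D ^ 2) - (A * E ^ k + k * (A * D * E ^ (k - 1))) =
      r * (A * D ^ 2) := by ring
  rw [this]
  exact Ideal.mul_mem_left _ _ h

/-- At most one dotted contraction with the one-form survives. -/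
theorem actL_dual_affine (hm : 1 ≤ m) (hA : IsQuadratic A) (a : Osc →₀ ℕ) (E : Symb (m + 2))
    (ε : Fin (m + 1) → ℂ) (k : ℕ) :
    actL (args₁ 0 A C) a (ang (ySp _) (dSp 0) ^ m *
      (E + ∑ c : Fin (m + 1), ε c • sqb (dSp c.succ) (dSp 0)) ^ k) =
    actL (args₁ 0 A C) a (ang (ySp _) (dSp 0) ^ m * E ^ k) +
      ∑ c : Fin (m + 1), ε c * (k * actL (args₁ 0 A C) a
        (ang (ySp _) (dSp 0) ^ m * sqb (dSp c.succ) (dSp 0) * E ^ (k - 1))) := by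
  have hang : ang (ySp (m + 2)) (dSp 0) ∈ legIdeal 0 := by
    rw [ang_comm]; exact neg_mem (ang_mem (dSp_mem 0) _)
  have hD : ∑ c : Fin (m + 1), ε c • sqb (dSp c.succ) (dSp 0) ∈ legIdeal (n := m + 2) 0 :=
    sum_mem fun c _ => smul_mem_ideal _ (by rw [sqb_comm]; exact neg_mem (sqb_mem (dSp_mem 0) _))
  have h : ang (ySp (m + 2)) (dSp 0) ^ m *
      (∑ c : Fin (m + 1), ε c • sqb (dSp c.succ) (dSp 0)) ^ 2 ∈ annIdeal (args₁ 0 A C) a := by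
    -- For `m ≥ 1` the prefactor differentiates the one-form at least once, so a second dotted
    -- contraction would be the third derivative.
    obtain ⟨r, rfl⟩ := Nat.exists_eq_add_of_le hm
    refine legIdeal_pow_three_le _ a 0 (by rwa [args₁_self]) ?_
    rw [pow_add, pow_one, mul_right_comm]
    refine Ideal.mul_mem_right _ _ ?_
    rw [pow_succ' _ 2]
    exact Ideal.mul_mem_mul hang (Ideal.pow_mem_pow hD 2)
  rw [actL_eq_of_sub_mem _ _ (mul_add_pow_sub_mem h k), map_add, add_right_inj,
    ← nsmul_eq_mul, map_nsmul, nsmul_eq_mul, Finset.mul_sum, Finset.sum_mul, map_sum,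
    Finset.mul_sum]
  refine Finset.sum_congr rfl fun c _ => ?_
  rw [mul_smul_comm, smul_mul_assoc, map_smul, smul_eq_mul]
  ring

/-- The integral of a dual sub-vertex without dotted contractions with the one-form. -/
def dualInt (A C : GenFun) (a : Osc →₀ ℕ) (k : ℕ) : ℂ :=
  ∫ q in simplexDom m, actL (args₁ 0 A C) a
    (ang (ySp (m + 2)) (dSp 0) ^ m * dualExponent (fullVec q) ^ k)

/-- The integral of a dual sub-vertex with one dotted contraction between the one-form and the
zero-form attached to the vector `c`. -/
def dualIntContr (A C : GenFun) (a : Osc →₀ ℕ) (k : ℕ) (c : Fin (m + 1)) : ℂ :=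
  ∫ q in simplexDom m, k * actL (args₁ 0 A C) a
    (ang (ySp (m + 2)) (dSp 0) ^ m * sqb (dSp c.succ) (dSp 0) * dualExponent (fullVec q) ^ (k - 1))

theorem continuous_actL_dualExponent (L : Symb (m + 2) →ₗ[ℂ] ℂ) (G : Symb (m + 2)) (k : ℕ) :
    Continuous fun q : Fin m → ℝ × ℝ => L (G * dualExponent (fullVec q) ^ k) := by
  refine continuous_map_mul_pow L _ _ _ (fun c => ?_) (fun c => ?_) k G
  · exact Complex.continuous_ofReal.comp (continuous_fullVec c).fst
  · exact Complex.continuous_ofReal.comp (continuous_fullVec c).snd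

theorem integral_dual (hm : 1 ≤ m) (hA : IsQuadratic A) (a : Osc →₀ ℕ)
    (ε : Fin (m + 1) → ℂ) (k : ℕ) :
    ∫ q in simplexDom m, actL (args₁ 0 A C) a (ang (ySp _) (dSp 0) ^ m *
      (dualExponent (fullVec q) + ∑ c : Fin (m + 1), ε c • sqb (dSp c.succ) (dSp 0)) ^ k) =
    dualInt (m := m) A C a k + ∑ c, ε c * dualIntContr A C a k c := by
  simp only [actL_dual_affine hm hA]
  have h : ∀ x : Fin (m + 1), Continuous fun q : Fin m → ℝ × ℝ => ε x * (k *
      actL (args₁ 0 A C) a (ang (ySp (m + 2)) (dSp 0) ^ m * sqb (dSp x.succ) (dSp 0) *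
        dualExponent (fullVec q) ^ (k - 1))) := fun x =>
    continuous_const.mul (continuous_const.mul (continuous_actL_dualExponent _ _ _))
  rw [integral_add (integrable_simplexDom (continuous_actL_dualExponent _ _ _))
    (integrable_simplexDom (continuous_finsetSum _ fun x _ => h x)), dualInt]
  congr 1
  rw [integral_finsetSum _ fun x _ => integrable_simplexDom (h x)]
  refine Finset.sum_congr rfl fun c _ => ?_
  rw [integral_const_mul, dualIntContr]

/-- A dotted contraction carries `+1` for a zero-form to the left of the one-form and `-1` for one
to the right. Everything else is independent of the position and the graph, and is collected in two
universal integrals. -/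
theorem subU_castSucc_eq (hm : 1 ≤ m) (hA : IsQuadratic A) (hC : DottedForm c C)
    (i : Fin (m + 1)) (k : ℕ) (a : Osc →₀ ℕ) :
    subU i.castSucc (args₁ i.castSucc A C) k a = (k.factorial : ℂ)⁻¹ * ((-1) ^ (i : ℕ) *
      ∑ σ ∈ graphs 0 i.succ, (dualInt (m := m) A C a k +
        ∑ x, (if dualLeg (σ x) < i.castSucc then 1 else -1) * dualIntContr A C a k x)) := by
  rw [subU_castSucc, graphSum_eq, mul_left_comm]
  congr 2
  refine Finset.sum_congr rfl fun σ hσ => ?_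
  rw [mem_graphs] at hσ
  have h0 : ∀ x, σ x ≠ some 0 := fun x => (hσ.2.1 x).1
  rw [← integral_dual hm hA]
  refine integral_congr_ae (Filter.Eventually.of_forall fun q => ?_)
  simp only [uvExponent, Fin.cons_zero, Fin.cons_succ, dualLeg_spec (h0 _)]
  refine actL_dual a i.castSucc (fun x => dualLeg (σ x)) (fun x y h => ?_) (fun x h => ?_) hC
    (fullVec q) k
  · exact hσ.1 _ _ (dualLeg_injective (h0 x) (h0 y) h)
  · have : dualLeg (σ x) = dualLeg (some i.succ) := by rw [h]; simp [dualLeg]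
    exact (hσ.2.1 x).2 (dualLeg_injective (h0 x) (by simp) this)

/-- With the one-form in last position every zero-form is to its left, so all signs are `+1`. Here
`u` multiplies the contractions with the one-form and `v` those with the output, opposite to the
other positions; the reflection of the domain undoes this. -/
theorem subU_last_eq (hm : 1 ≤ m) (hA : IsQuadratic A) (hC : DottedForm c C)
    (k : ℕ) (a : Osc →₀ ℕ) :
    subU (Fin.last (m + 1)) (args₁ (Fin.last (m + 1)) A C) k a = (k.factorial : ℂ)⁻¹ *
      ((-1) ^ (m + 1) * ∑ _σ ∈ graphs (Fin.last m).castSucc (Fin.last (m + 1)),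
        (dualInt (m := m) A C a k + ∑ x : Fin (m + 1), 1 * dualIntContr A C a k x)) := by
  rw [subU_last, graphSum_eq, ← mul_neg, pow_succ, mul_neg_one, neg_mul, Finset.mul_sum]
  congr 2
  refine Finset.sum_congr rfl fun σ hσ => ?_
  rw [mem_graphs] at hσ
  have h0 : ∀ x, σ x ≠ some (Fin.last _) := fun x => (hσ.2.1 x).2
  rw [← integral_dual hm hA]
  conv_rhs => rw [← setIntegral_comp_reflect]
  rw [← integral_const_mul]
  refine integral_congr_ae (Filter.Eventually.of_forall fun q => ?_)
  simp only [uvExponent, Fin.snoc_castSucc, Fin.snoc_last, dualLegLast_spec (h0 _), Fin.succ_last]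
  have hne : ∀ x, dualLegLast (σ x) ≠ Fin.last (m + 1) := fun x h => by
    have : dualLegLast (σ x) = dualLegLast (some (Fin.last m).castSucc) := by
      rw [h]; simp [dualLegLast]
    exact (hσ.2.1 x).1 (dualLegLast_injective (h0 x)
      (fun h => Fin.castSucc_ne_last _ (Option.some_injective _ h)) this)
  have key := actL_dual (A := A) a (Fin.last (m + 1)) (fun x => dualLegLast (σ x.rev))
    (fun x y h => Fin.rev_injective (hσ.1 _ _ (dualLegLast_injective (h0 _) (h0 _) h)))
    (fun x => hne _) hC (fullVec (reflect q)) k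
  simp only [Fin.lt_last_iff_ne_last.2 (hne _), if_true] at key
  -- The prefactor appears with its arguments in the opposite order, contributing `(-1) ^ m`; the
  -- minus sign of the duality completes this to `(-1) ^ (m + 1)`.
  rw [← key, ← smul_eq_mul ((-1 : ℂ) ^ m), ← map_smul, ang_comm (dSp (Fin.last (m + 1))), neg_pow]
  congr 1
  have hsum : ∑ x, (((fullVec q x).1 : ℂ) • ang (dSp (Fin.last (m + 1))) (dSp (dualLegLast (σ x))) +
      ((fullVec q x).2 : ℂ) • ang (ySp (m + 2)) (dSp (dualLegLast (σ x)))) =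
      ∑ x, (((fullVec (reflect q) x).1 : ℂ) • ang (ySp (m + 2)) (dSp (dualLegLast (σ x.rev))) +
      ((fullVec (reflect q) x).2 : ℂ) •
        ang (dSp (Fin.last (m + 1))) (dSp (dualLegLast (σ x.rev)))) := by
    rw [← Equiv.sum_comp Fin.revPerm]
    refine Finset.sum_congr rfl fun x _ => ?_
    rw [fullVec_reflect]
    exact add_comm _ _
  rw [hsum, MvPolynomial.smul_eq_C_mul, map_pow, map_neg, map_one, mul_assoc]

/-- The dual sub-vertices with equal zero-forms cancel, provided the graphs with their signs do. -/
theorem sum_subU_eq_zero (hm : 1 ≤ m) (hA : IsQuadratic A) (hC : DottedForm c C)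
    (hN : ∑ i : Fin (m + 1), (-1 : ℤ) ^ (i : ℕ) * ∑ _σ ∈ graphs 0 i.succ, 1 +
      (-1) ^ (m + 1) * ∑ _σ ∈ graphs (Fin.last m).castSucc (Fin.last (m + 1)), 1 = 0)
    (hS : ∀ x : Fin (m + 1), ∑ i : Fin (m + 1), (-1 : ℤ) ^ (i : ℕ) *
      ∑ σ ∈ graphs 0 i.succ, (if dualLeg (σ x) < i.castSucc then 1 else -1) +
      (-1) ^ (m + 1) * ∑ _σ ∈ graphs (Fin.last m).castSucc (Fin.last (m + 1)), 1 = 0)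
    (k : ℕ) (a : Osc →₀ ℕ) : ∑ i : Fin (m + 2), subU i (args₁ i A C) k a = 0 := by
  have hN' := congrArg (fun z : ℤ => (z : ℂ) * dualInt (m := m) A C a k) hN
  have hS' := Finset.sum_congr (rfl : (Finset.univ : Finset (Fin (m + 1))) = Finset.univ) fun x _ =>
    congrArg (fun z : ℤ => (z : ℂ) * dualIntContr A C a k x) (hS x)
  rw [Fin.sum_univ_castSucc, subU_last_eq hm hA hC]
  simp only [subU_castSucc_eq hm hA hC]
  rw [← Finset.mul_sum, ← mul_add]
  refine mul_eq_zero_of_right _ ?_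
  push_cast at hN' hS'
  simp only [zero_mul, Finset.sum_const_zero, add_mul, Finset.sum_add_distrib, Finset.sum_mul,
    Finset.mul_sum, mul_add, one_mul, mul_one, mul_assoc] at hN' hS' ⊢
  rw [Finset.sum_comm] at hS'
  rw [add_add_add_comm, hN', zero_add]
  refine Eq.trans ?_ hS'
  congr 1
  · refine Finset.sum_congr rfl fun i _ => ?_
    rw [Finset.sum_comm]
  · rw [Finset.sum_comm]

/-- With `i` zero-forms to the left of the one-form, the graphs are the shuffles of two chains of
lengths `i` and `m + 1 - i`, so their signed number is `∑ (-1)^i (m+1 choose i) = 0`. Fixing a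
vector and weighting by the side on which its zero-form lies gives `∑ (-1)^i ((m choose i-1) - (m
choose i)) = 0` for `m ≥ 1`. Only `m = 1` and `m = 2` are needed, and both counts are verified by
enumeration. -/
theorem sum_subU_one (hA : IsQuadratic A) (hC : DottedForm c C) (k : ℕ) (a : Osc →₀ ℕ) :
    ∑ i : Fin (1 + 2), subU i (args₁ i A C) k a = 0 :=
  sum_subU_eq_zero le_rfl hA hC (by decide +kernel) (by decide +kernel) k a

theorem sum_subU_two (hA : IsQuadratic A) (hC : DottedForm c C) (k : ℕ) (a : Osc →₀ ℕ) :
    ∑ i : Fin (2 + 2), subU i (args₁ i A C) k a = 0 :=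
  sum_subU_eq_zero one_le_two hA hC (by decide +kernel) (by decide +kernel) k a

end OneFormVertex

/-! ### Vanishing of the higher vertices in the spin-2 sector -/

section Quadratic

/-- The quadratic generating function with components `w`, `e`, `wt`. -/
def quadForm (w e wt : Fin 2 → Fin 2 → ℂ) : GenFun :=
  (1 / 4 : ℂ) • (∑ α, ∑ β, w α β • (MvPowerSeries.X (.inl α) * MvPowerSeries.X (.inl β) : GenFun)) +
  (1 / 2 : ℂ) • (∑ α, ∑ α', e α α' •
    (MvPowerSeries.X (.inl α) * MvPowerSeries.X (.inr α') : GenFun)) +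
  (1 / 4 : ℂ) • (∑ α', ∑ β', wt α' β' •
    (MvPowerSeries.X (.inr α') * MvPowerSeries.X (.inr β') : GenFun))

theorem IsQuadratic.add {f g : GenFun} (hf : IsQuadratic f) (hg : IsQuadratic g) :
    IsQuadratic (f + g) := fun s t r => by simp only [map_add, hf s t r, hg s t r, add_zero]

theorem IsQuadratic.smul {f : GenFun} (hf : IsQuadratic f) (c : ℂ) : IsQuadratic (c • f) :=
  fun s t r => by simp only [Derivation.map_smul, hf s t r, smul_zero]

theorem IsQuadratic.sum {ι : Type*} (S : Finset ι) {f : ι → GenFun} (hf : ∀ i, IsQuadratic (f i)) :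
    IsQuadratic (∑ i ∈ S, f i) := fun s t r => by
  simp only [map_sum, hf _ s t r, Finset.sum_const_zero]

theorem isQuadratic_X_mul_X (i j : Osc) :
    IsQuadratic (MvPowerSeries.X i * MvPowerSeries.X j : GenFun) := by
  intro s t r
  have h : ∀ (p q : Osc), ∃ z : ℂ, MvPowerSeries.pderiv ℂ p (MvPowerSeries.X q : GenFun) =
      MvPowerSeries.C z := fun p q => by
    by_cases h : q = p
    · exact ⟨1, by rw [h, MvPowerSeries.pderiv_X_self, map_one]⟩
    · exact ⟨0, by rw [MvPowerSeries.pderiv_X_of_ne h, map_zero]⟩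
  obtain ⟨z1, h1⟩ := h r i
  obtain ⟨z2, h2⟩ := h r j
  obtain ⟨z3, h3⟩ := h t i
  obtain ⟨z4, h4⟩ := h t j
  simp [Derivation.leibniz, h1, h2, h3, h4]

theorem isQuadratic_quadForm (w e wt : Fin 2 → Fin 2 → ℂ) : IsQuadratic (quadForm w e wt) :=
  ((((IsQuadratic.sum _ fun _ => IsQuadratic.sum _ fun _ => (isQuadratic_X_mul_X _ _).smul _).smul
    _).add ((IsQuadratic.sum _ fun _ => IsQuadratic.sum _ fun _ =>
      (isQuadratic_X_mul_X _ _).smul _).smul _))).add ((IsQuadratic.sum _ fun _ =>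
        IsQuadratic.sum _ fun _ => (isQuadratic_X_mul_X _ _).smul _).smul _)

/-- The symmetry of `wt` merges two equal terms, which turns the coefficient `1/4` into `1/2`. -/
theorem pderiv_inr_quadForm (w e : Fin 2 → Fin 2 → ℂ) {wt : Fin 2 → Fin 2 → ℂ}
    (h : wt 1 0 = wt 0 1) (γ : Fin 2) :
    MvPowerSeries.pderiv ℂ (.inr γ) (quadForm w e wt) =
      (1 / 2 : ℂ) • ∑ α, e α γ • (MvPowerSeries.X (.inl α) : GenFun) +
      (1 / 2 : ℂ) • ∑ β, wt γ β • (MvPowerSeries.X (.inr β) : GenFun) := by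
  fin_cases γ <;>
  · simp only [quadForm, Fin.sum_univ_two, map_add, Derivation.map_smul, Derivation.leibniz,
      MvPowerSeries.pderiv_X, Pi.single_apply, smul_eq_mul, h]
    simp [h]
    module

theorem pderiv_inl_inr_quadForm (w e : Fin 2 → Fin 2 → ℂ) {wt : Fin 2 → Fin 2 → ℂ}
    (h : wt 1 0 = wt 0 1) (α γ : Fin 2) :
    MvPowerSeries.pderiv ℂ (.inl α) (MvPowerSeries.pderiv ℂ (.inr γ) (quadForm w e wt)) =
      MvPowerSeries.C (1 / 2 * e α γ) := by
  rw [pderiv_inr_quadForm w e h]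
  fin_cases α <;>
  · simp only [map_add, Derivation.map_smul, Fin.sum_univ_two, MvPowerSeries.pderiv_X,
      Pi.single_apply]
    simp [MvPowerSeries.smul_eq_C_mul]

end Quadratic

/-! ### The spin-2 sector as an instance: quadratic one-forms and zero-forms with one dotted
direction. -/

section SpinTwo

variable {U : Set Spacetime} {b : FlatBackground U} {d : Dyad b} {H₂ : Spacetime → ℂ}

theorem Omega_apply (x ξ : Spacetime) : d.Omega H₂ x ξ = quadForm
    (fun α β => d.boldW H₂ α β x ξ) (fun α β => d.boldE H₂ α β x ξ)
    (fun α β => d.boldWt H₂ α β x ξ) := by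
  simp [Dyad.Omega, quadForm]

theorem isQuadratic_Omega (x ξ : Spacetime) : IsQuadratic (d.Omega H₂ x ξ) := by
  rw [Omega_apply]
  exact isQuadratic_quadForm _ _ _

theorem hasSubst_dyad (κ κ' τ : Fin 2 → ℂ) :
    MvPowerSeries.HasSubst ![yAng κ, yAng κ', ySqb τ] := by
  refine MvPowerSeries.hasSubst_of_constantCoeff_zero fun s => ?_
  fin_cases s <;> simp [yAng, ySqb, MvPowerSeries.smul_eq_C_mul]

theorem pderiv_inr_yAng (κ : Fin 2 → ℂ) (γ : Fin 2) :
    MvPowerSeries.pderiv ℂ (.inr γ) (yAng κ) = 0 := by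
  simp [yAng]

theorem pderiv_inr_ySqb (τ : Fin 2 → ℂ) (γ : Fin 2) :
    MvPowerSeries.pderiv ℂ (.inr γ) (ySqb τ) = MvPowerSeries.C (low τ γ) := by
  fin_cases γ <;>
  · simp only [ySqb, map_add, Derivation.map_smul, Fin.sum_univ_two, MvPowerSeries.pderiv_X,
      Pi.single_apply]
    simp [MvPowerSeries.smul_eq_C_mul]

theorem derivation_prod_eq_zero {D : Derivation ℂ GenFun GenFun} {v : Fin 3 → GenFun}
    (hv : ∀ i, D (v i) = 0) (e : Fin 3 →₀ ℕ) : D (e.prod fun s n => v s ^ n) = 0 := by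
  refine Finset.prod_induction _ (fun f => D f = 0) (fun f g hf hg => ?_) ?_ fun i _ => ?_
  · rw [Derivation.leibniz, hf, hg, smul_zero, smul_zero, add_zero]
  · exact D.map_one_eq_zero
  · rw [Derivation.leibniz_pow, hv, smul_zero, smul_zero]

/-- The derivation `c 1 ∂_0 - c 0 ∂_1` kills every substituted series, hence every monomial in them.
Each coefficient of the substitution is a finite sum over such monomials. -/
theorem pderiv_inr_subst_relation {c : Fin 2 → ℂ} {v : Fin 3 → GenFun}
    (hs : MvPowerSeries.HasSubst v)
    (hv : ∀ i, c 1 • MvPowerSeries.pderiv ℂ (.inr 0) (v i) =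
      c 0 • MvPowerSeries.pderiv ℂ (.inr 1) (v i))
    (G : MvPowerSeries (Fin 3) ℂ) :
    c 1 • MvPowerSeries.pderiv ℂ (.inr 0) (MvPowerSeries.subst v G : GenFun) =
      c 0 • MvPowerSeries.pderiv ℂ (.inr 1) (MvPowerSeries.subst v G) := by
  let D : Derivation ℂ GenFun GenFun :=
    c 1 • MvPowerSeries.pderiv ℂ (.inr 0) - c 0 • MvPowerSeries.pderiv ℂ (.inr 1)
  have hD : ∀ f, D f = c 1 • MvPowerSeries.pderiv ℂ (.inr 0) f -
      c 0 • MvPowerSeries.pderiv ℂ (.inr 1) f := fun f => rfl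
  ext m
  -- A common finite support for the two coefficients, so that they can be compared monomial by
  -- monomial.
  have hfin := (MvPowerSeries.coeff_subst_finite hs G (m + Finsupp.single (.inr 0) 1)).union
    (MvPowerSeries.coeff_subst_finite hs G (m + Finsupp.single (.inr 1) 1))
  rw [map_smul, map_smul, MvPowerSeries.coeff_pderiv, MvPowerSeries.coeff_pderiv,
    MvPowerSeries.coeff_subst hs, MvPowerSeries.coeff_subst hs,
    finsum_eq_sum_of_support_subset (s := hfin.toFinset) _ (by simp),
    finsum_eq_sum_of_support_subset (s := hfin.toFinset) _ (by simp), Finset.sum_mul,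
    Finset.sum_mul, smul_eq_mul, smul_eq_mul, Finset.mul_sum, Finset.mul_sum]
  refine Finset.sum_congr rfl fun e _ => ?_
  have h := congrArg (MvPowerSeries.coeff m) (derivation_prod_eq_zero (D := D)
    (fun i => by rw [hD, hv i, sub_self]) e)
  rw [hD, map_sub, map_smul, map_smul, MvPowerSeries.coeff_pderiv, MvPowerSeries.coeff_pderiv,
    map_zero, smul_eq_mul, smul_eq_mul] at h
  rw [smul_eq_mul, smul_eq_mul]
  linear_combination (MvPowerSeries.coeff e G) * h

theorem pderiv_inr_subst (κ κ' τ : Fin 2 → ℂ) (G : MvPowerSeries (Fin 3) ℂ) :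
    low τ 1 • MvPowerSeries.pderiv ℂ (.inr 0)
      (MvPowerSeries.subst ![yAng κ, yAng κ', ySqb τ] G : GenFun) =
    low τ 0 • MvPowerSeries.pderiv ℂ (.inr 1)
      (MvPowerSeries.subst ![yAng κ, yAng κ', ySqb τ] G) := by
  refine pderiv_inr_subst_relation (hasSubst_dyad κ κ' τ) (fun i => ?_) G
  fin_cases i
  · simp [pderiv_inr_yAng]
  · simp [pderiv_inr_yAng]
  · simp [pderiv_inr_ySqb, MvPowerSeries.smul_eq_C_mul, mul_comm]

theorem low_lamT_ne_zero {x : Spacetime} (hx : x ∈ U) :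
    low (d.lamT x) 0 ≠ 0 ∨ low (d.lamT x) 1 ≠ 0 := by
  by_contra! h
  have := d.normt x hx
  rw [Fin.sum_univ_two, h.1, h.2] at this
  simp at this

theorem dottedForm_of_relation {c : Fin 2 → ℂ} (hc : c 0 ≠ 0 ∨ c 1 ≠ 0) {f : GenFun}
    (h : c 1 • MvPowerSeries.pderiv ℂ (.inr 0) f = c 0 • MvPowerSeries.pderiv ℂ (.inr 1) f) :
    DottedForm c f := by
  rcases hc with hc | hc
  · refine ⟨(c 0)⁻¹ • MvPowerSeries.pderiv ℂ (.inr 0) f, fun γ => ?_⟩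
    fin_cases γ
    · simp [smul_smul, hc]
    · simp only [Fin.mk_one]
      rw [smul_comm, h, smul_smul, inv_mul_cancel₀ hc, one_smul]
  · refine ⟨(c 1)⁻¹ • MvPowerSeries.pderiv ℂ (.inr 1) f, fun γ => ?_⟩
    fin_cases γ
    · simp only [Fin.zero_eta]
      rw [smul_comm, ← h, smul_smul, inv_mul_cancel₀ hc, one_smul]
    · simp [smul_smul, hc]

theorem Dyad.HasSpinTwoForm.dottedForm {C : Spacetime → GenFun} (hC : d.HasSpinTwoForm C)
    {x : Spacetime} (hx : x ∈ U) : DottedForm (low (d.lamT x)) (C x) := by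
  obtain ⟨G, hG⟩ := hC
  refine dottedForm_of_relation (low_lamT_ne_zero hx) ?_
  rw [hG x hx]
  exact pderiv_inr_subst _ _ _ _

theorem convergesV_of_dottedForm (n : ℕ) (x : Spacetime) {C : GenFun} {c : Fin 2 → ℂ}
    (hC : DottedForm c C) : ConvergesV n (d.Omega H₂ x) C := by
  match n with
  | 0 => trivial
  | 1 => trivial
  | m + 2 =>
    intro ξ η i j hij a
    exact summable_subV hij.ne (isQuadratic_Omega x ξ) (isQuadratic_Omega x η) hC a

theorem convergesU_of_dottedForm (n : ℕ) (x : Spacetime) {C : GenFun} {c : Fin 2 → ℂ}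
    (hC : DottedForm c C) : ConvergesU n (d.Omega H₂ x) C := by
  match n with
  | 0 => trivial
  | 1 => trivial
  | m + 2 =>
    intro ξ i a
    exact summable_subU i (isQuadratic_Omega x ξ) hC a

/-- Antisymmetrisation in the two tangent vectors removes the quartic vertex, whose sub-vertices are
symmetric in the one-forms; beyond it each sub-vertex vanishes separately. -/
theorem vertexV_eq_zero {n : ℕ} (hn : 4 ≤ n) (x ξ η : Spacetime) {C : GenFun} {c : Fin 2 → ℂ}
    (hC : DottedForm c C) : vertexV n (d.Omega H₂ x) C ξ η = 0 := by
  obtain ⟨m, rfl⟩ := Nat.exists_eq_add_of_le' hn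
  show vertexV ((m + 2) + 2) (d.Omega H₂ x) C ξ η = 0
  funext a
  show _ = (0 : ℂ)
  refine Finset.sum_eq_zero fun i _ => Finset.sum_eq_zero fun j hj => ?_
  have hij : i ≠ j := (Finset.mem_Ioi.1 hj).ne
  rw [sub_eq_zero]
  refine tsum_congr fun k => ?_
  rcases Nat.eq_zero_or_pos m with rfl | hm
  · exact subV_two_swap hij (isQuadratic_Omega x ξ) (isQuadratic_Omega x η) hC a k
  · rw [subV_eq_zero_of_three_le (isQuadratic_Omega x ξ) a (by omega),
      subV_eq_zero_of_three_le (isQuadratic_Omega x η) a (by omega)]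

/-- For `n = 3, 4` only the sum over the positions of the one-form vanishes, so it is exchanged with
the sum over orders first; for `n ≥ 5` each sub-vertex vanishes. -/
theorem vertexU_eq_zero {n : ℕ} (hn : 3 ≤ n) (x ξ : Spacetime) {C : GenFun} {c : Fin 2 → ℂ}
    (hC : DottedForm c C) : vertexU n (d.Omega H₂ x) C ξ = 0 := by
  obtain ⟨m, rfl⟩ := Nat.exists_eq_add_of_le' hn
  show vertexU ((m + 1) + 2) (d.Omega H₂ x) C ξ = 0
  have hA := isQuadratic_Omega (d := d) (H₂ := H₂) x ξ
  funext a
  show ∑ i : Fin ((m + 1) + 2), ∑' k, subU i (args₁ i (d.Omega H₂ x ξ) C) k a = (0 : ℂ)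
  rw [← Summable.tsum_finsetSum fun i _ => summable_subU i hA hC a]
  refine (tsum_congr fun k => ?_).trans tsum_zero
  match m with
  | 0 => exact sum_subU_one hA hC k a
  | 1 => exact sum_subU_two hA hC k a
  | m + 2 => exact Finset.sum_eq_zero fun i _ => subU_eq_zero_of_three_le i hA a (by omega) k

end SpinTwo

/-! ### The quadratic vertices -/

section Quadratic

/-- Odd and even parts of the binomial expansion in `B`, modulo `B ^ 3` and `B ^ 2`. Multiplying by
`T ± B` mixes the two, so they are proved in one induction. -/
theorem pow_sub_pow_odd {R : Type*} [CommRing R] (T B : R) (k : ℕ) :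
    (∃ r, (T + B) ^ (k + 1) - (T - B) ^ (k + 1) = 2 * (k + 1) * B * T ^ k + B ^ 3 * r) ∧
    ∃ r, (T + B) ^ (k + 1) + (T - B) ^ (k + 1) = 2 * T ^ (k + 1) + B ^ 2 * r := by
  induction k with
  | zero => exact ⟨⟨0, by push_cast; ring⟩, ⟨0, by ring⟩⟩
  | succ k ih =>
    obtain ⟨⟨r, hr⟩, ⟨r', hr'⟩⟩ := ih
    constructor
    · refine ⟨T * r + r', ?_⟩
      push_cast
      rw [pow_succ (T + B), pow_succ (T - B)]
      linear_combination T * hr + B * hr'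
    · refine ⟨T * r' + 2 * (k + 1) * T ^ k + B ^ 2 * r, ?_⟩
      rw [pow_succ (T + B), pow_succ (T - B)]
      linear_combination T * hr' + B * hr

/-- The sign differences produced by wedge products and neighbouring sub-vertices are differences of
this type. Only a single factor `B` survives, because the cubic remainder acts trivially. -/
theorem actL_odd_part {n : ℕ} (Φ : Fin n → GenFun) (a : Osc →₀ ℕ) (A T B : Symb n)
    (h : A * B ^ 3 ∈ annIdeal Φ a) (k : ℕ) :
    actL Φ a (A * (T + B) ^ (k + 1)) - actL Φ a (A * (T - B) ^ (k + 1)) =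
      2 * (k + 1) * actL Φ a (A * B * T ^ k) := by
  obtain ⟨⟨r, hr⟩, -⟩ := pow_sub_pow_odd T B k
  have h1 : A * (T + B) ^ (k + 1) - A * (T - B) ^ (k + 1) =
      (2 * (k + 1) : ℂ) • (A * B * T ^ k) + r * (A * B ^ 3) := by
    rw [← mul_sub, hr, MvPolynomial.smul_eq_C_mul]
    simp only [map_mul, map_add, map_natCast, map_one, map_ofNat]
    ring
  rw [← map_sub, h1, map_add, map_smul, smul_eq_mul, h r, add_zero]

theorem sum_univ_zero_add_two {M : Type*} [AddCommMonoid M] (f : Fin (0 + 2) → M) :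
    ∑ i, f i = f 0 + f 1 := Fin.sum_univ_two f

theorem prod_univ_zero_add_two {M : Type*} [CommMonoid M] (f : Fin (0 + 2) → M) :
    ∏ i, f i = f 0 * f 1 := Fin.prod_univ_two f

/-- The weights of a shift in the dotted oscillators only. -/
def dotWeight : Osc → ℂ := Sum.elim 0 1

theorem graphs_zero : graphs (m := 0) 0 1 = {fun _ => none} := by decide +kernel

/-- Without free vectors the domain is one point of mass one. -/
theorem integral_simplexDom_zero (z : ℂ) : ∫ _ in simplexDom 0, z = z := by
  have h : simplexDom 0 = Set.univ := by
    refine Set.eq_univ_of_forall fun q => ⟨fun k => ?_, fun k l hkl => ?_⟩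
    · rw [Fin.fin_one_eq_zero k]
      have := fullVec_last q
      rw [show Fin.last 0 = 0 from rfl] at this
      rw [this]; simp
    · rw [Fin.fin_one_eq_zero k, Fin.fin_one_eq_zero l] at hkl
      exact absurd hkl (lt_irrefl _)
  rw [h, Measure.restrict_univ, integral_const, Measure.real, volume_pi, Measure.pi_of_empty]
  simp

/-- The only vector is `(1, 1)`, attached to the output, so both one-form slots are Taylor shifted
with unit weight. -/
theorem graphSum_zero (y : Osc → Symb (0 + 2)) (p : Fin (0 + 2) → Osc → Symb (0 + 2))
    (Φ : Fin (0 + 2) → GenFun) (k : ℕ) (a : Osc →₀ ℕ) :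
    graphSum (m := 0) 0 1 y p Φ k a = (k.factorial : ℂ)⁻¹ * actL Φ a
      ((starExponent (0 + 2) + (ang (p 0) (-y) + ang (p 1) (-y))) ^ k) := by
  rw [graphSum_eq, graphs_zero, Finset.sum_singleton]
  have h : ∀ q : Fin 0 → ℝ × ℝ, uvExponent 0 1 (fun _ => none) q y p =
      ang (p 0) (-y) + ang (p 1) (-y) := by
    intro q
    have := fullVec_last q
    rw [show Fin.last 0 = 0 from rfl] at this
    simp [uvExponent, this]
  simp only [h, pow_zero, one_mul]
  rw [integral_simplexDom_zero]

theorem starExponent_two : starExponent (0 + 2) =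
    sqb (ySp _) (dSp 0) + sqb (ySp _) (dSp 1) + sqb (dSp 0) (dSp 1) := by
  rw [starExponent, Fin.sum_univ_two, Fin.sum_univ_two]
  have h0 : Finset.Ioi (0 : Fin (0 + 2)) = {1} := by decide
  have h1 : Finset.Ioi (1 : Fin (0 + 2)) = ∅ := by decide
  rw [h0, h1]
  simp

variable {A B C : GenFun} {c : Fin 2 → ℂ}

theorem ang_neg_right {n : ℕ} (p q : Osc → Symb n) : ang p (-q) = ang q p := by
  simp only [ang, Pi.neg_apply]; ring

theorem sqb_cube_mem {n : ℕ} (Φ : Fin n → GenFun) (a : Osc →₀ ℕ) (i j : Fin n)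
    (h : IsQuadratic (Φ i)) (F : Symb n) : F * sqb (dSp i) (dSp j) ^ 3 ∈ annIdeal Φ a :=
  Ideal.mul_mem_left _ _
    (legIdeal_pow_three_le Φ a i h (Ideal.pow_mem_pow (sqb_mem (dSp_mem i) _) 3))

theorem taylorSymb_one : taylorSymb (n := 0 + 2) (fun _ => 1) =
    sqb (ySp _) (dSp 0) + sqb (ySp _) (dSp 1) + ang (ySp _) (dSp 0) + ang (ySp _) (dSp 1) := by
  rw [taylorSymb, sqb_ySp_dSp, sqb_ySp_dSp, ang_ySp_dSp, ang_ySp_dSp, Fintype.sum_sum_type]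
  simp only [sum_univ_zero_add_two, Pi.one_apply, one_smul]
  ring

/-- A Taylor shift reaches an output coefficient of degree `N` at a single order; the accompanying
bracket raises that order by one. -/
theorem tsum_factorial_shift {f : ℕ → ℂ} {N : ℕ} {v : ℂ} (h0 : f 0 = 0)
    (hf : ∀ k, f (k + 1) = (k.factorial : ℂ)⁻¹ * if N = k then k.factorial * v else 0) :
    ∑' k, f k = v := by
  rw [tsum_eq_single (N + 1), hf, if_pos rfl, inv_mul_cancel_left₀]
  · exact_mod_cast N.factorial_ne_zero
  · rintro (_ | k) hk
    · exact h0
    · rw [hf, if_neg (by omega), mul_zero]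

/-- Exchanging the one-forms fixes the Taylor shift and flips the sign of `[∂_0 ∂_1]`. The
difference is the odd part of the star product, and for a quadratic argument this stops at the
Poisson bracket. -/
theorem subV_antisymm_two (hA : IsQuadratic A) (a : Osc →₀ ℕ) (k : ℕ) :
    subV (m := 0) 0 1 (args₂ 0 1 A B C) (k + 1) a - subV (m := 0) 0 1 (args₂ 0 1 B A C) (k + 1) a =
      (k.factorial : ℂ)⁻¹ * if a.degree = k then k.factorial * (2 * MvPowerSeries.coeff a
        (MvPowerSeries.pderiv ℂ (.inr 1) A * MvPowerSeries.pderiv ℂ (.inr 0) B -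
          MvPowerSeries.pderiv ℂ (.inr 0) A * MvPowerSeries.pderiv ℂ (.inr 1) B)) else 0 := by
  have hsw : args₂ (0 : Fin (0 + 2)) 1 B A C = args₂ 0 1 A B C ∘ Equiv.swap 0 1 :=
    (args₂_comp_swap (by decide)).symm
  have hE : starExponent (0 + 2) + (ang (dSp 0) (-ySp _) + ang (dSp 1) (-ySp _)) =
      taylorSymb (n := 0 + 2) (fun _ => 1) + sqb (dSp 0) (dSp 1) := by
    rw [starExponent_two, taylorSymb_one, ang_neg_right, ang_neg_right]; ring
  have hE' : permLegs (Equiv.swap 0 1) (taylorSymb (n := 0 + 2) (fun _ => 1) +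
      sqb (dSp 0) (dSp 1)) = taylorSymb (n := 0 + 2) (fun _ => 1) - sqb (dSp 0) (dSp 1) := by
    rw [taylorSymb_one]
    simp only [map_add, permLegs_sqb_ySp, permLegs_ang_ySp, permLegs_sqb_dSp,
      Equiv.swap_apply_left, Equiv.swap_apply_right]
    rw [sqb_comm (dSp 1) (dSp 0)]
    ring
  have hodd := actL_odd_part (args₂ (0 : Fin (0 + 2)) 1 A B C) a 1
    (taylorSymb (fun _ => 1)) (sqb (dSp 0) (dSp 1))
    (sqb_cube_mem _ _ _ _ (by rwa [args₂_left]) _) k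
  simp only [one_mul] at hodd
  have h1 : ((-1 : ℂ)) ^ (((0 : Fin (0 + 2)) : ℕ) + (1 : Fin (0 + 2)) + 1) = 1 := by simp
  rw [subV, subV, h1, one_mul, one_mul, graphSum_zero, graphSum_zero, hE, hsw, ← actL_permLegs,
    map_pow (permLegs _), hE', ← mul_sub, hodd, sqb_dSp, sub_mul, map_sub]
  simp only [mul_assoc, actL_X_some_mul, actL_taylorSymb_pow, prod_univ_zero_add_two]
  have h2 : ∀ f : GenFun, MvPowerSeries.rescale (1 : Osc → ℂ) f = f := fun f => by
    rw [MvPowerSeries.rescale_one]; rfl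
  have h3 : (0 : Fin (0 + 2)) ≠ 1 := by decide
  simp only [h2, Function.update_self, Function.update_of_ne h3, Function.update_of_ne h3.symm,
    args₂_left, args₂_right h3]
  rw [Nat.factorial_succ]
  push_cast
  have h4 : ((k : ℂ) + 1) ≠ 0 := by exact_mod_cast k.succ_ne_zero
  split_ifs
  · rw [map_sub]
    field_simp
  · simp

/-- The quadratic vertex with two one-forms is the star-commutator in the dotted sector. -/
theorem coeff_vertexV_two (F : Spacetime →ₗ[ℂ] GenFun) (hF : ∀ ξ, IsQuadratic (F ξ))
    (hC : DottedForm c C) (ξ η : Spacetime) (a : Osc →₀ ℕ) :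
    MvPowerSeries.coeff a (vertexV 2 F C ξ η) = 2 * MvPowerSeries.coeff a
      (MvPowerSeries.pderiv ℂ (.inr 1) (F ξ) * MvPowerSeries.pderiv ℂ (.inr 0) (F η) -
        MvPowerSeries.pderiv ℂ (.inr 0) (F ξ) * MvPowerSeries.pderiv ℂ (.inr 1) (F η)) := by
  show ∑ i : Fin (0 + 2), ∑ j ∈ Finset.Ioi i, ((∑' k, subV i j (args₂ i j (F ξ) (F η) C) k a) -
        ∑' k, subV i j (args₂ i j (F η) (F ξ) C) k a) = _
  have h0 : Finset.Ioi (0 : Fin (0 + 2)) = {1} := by decide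
  have h1 : Finset.Ioi (1 : Fin (0 + 2)) = ∅ := by decide
  rw [Fin.sum_univ_two, h0, h1, Finset.sum_singleton, Finset.sum_empty, add_zero,
    ← Summable.tsum_sub (summable_subV (by decide) (hF ξ) (hF η) hC a)
      (summable_subV (by decide) (hF η) (hF ξ) hC a)]
  refine tsum_factorial_shift ?_ (subV_antisymm_two (hF ξ) a)
  have hsw : args₂ (0 : Fin (0 + 2)) 1 (F η) (F ξ) C =
    args₂ 0 1 (F ξ) (F η) C ∘ Equiv.swap 0 1 := (args₂_comp_swap (by decide)).symm
  simp only [subV, graphSum_zero, pow_zero]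
  rw [hsw, ← actL_permLegs, map_one (permLegs _), sub_self]

/-- After duality the undotted derivatives of the one-form are contracted with the zero-form instead
of the output; only its dotted oscillators are shifted, hence the weight `dotWeight`. -/
theorem taylorSymb_dual : taylorSymb (n := 0 + 2) ![dotWeight, 1] =
    sqb (ySp _) (dSp 0) + sqb (ySp _) (dSp 1) + ang (ySp _) (dSp 1) := by
  rw [taylorSymb, sqb_ySp_dSp, sqb_ySp_dSp, ang_ySp_dSp, Fintype.sum_sum_type]
  simp only [sum_univ_zero_add_two, dotWeight, Matrix.cons_val_zero, Matrix.cons_val_one, Sum.elim_inl,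
    Sum.elim_inr, Pi.one_apply, Pi.zero_apply, one_smul, zero_smul]
  ring

/-- The order `k + 1` of the quadratic vertex with a single one-form, as a symbol. -/
theorem sum_subU_zero (hA : IsQuadratic A) (a : Osc →₀ ℕ) (k : ℕ) :
    ∑ i : Fin (0 + 2), subU i (args₁ i A C) (k + 1) a = 2 * (k.factorial : ℂ)⁻¹ *
      (actL (args₁ 0 A C) a (sqb (dSp 0) (dSp 1) * taylorSymb (n := 0 + 2) ![dotWeight, 1] ^ k) +
        k * actL (args₁ 0 A C) a (sqb (dSp 0) (dSp 1) * ang (dSp 0) (dSp 1) *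
          taylorSymb (n := 0 + 2) ![dotWeight, 1] ^ (k - 1))) := by
  have hsw : args₁ (1 : Fin (0 + 2)) A C = args₁ 0 A C ∘ Equiv.swap 0 1 := by
    ext1 l
    fin_cases l <;> simp [args₁]
  set T := taylorSymb (n := 0 + 2) ![dotWeight, 1] with hT
  rw [taylorSymb_dual] at hT
  have e0 : subU (m := 0) 0 (args₁ 0 A C) (k + 1) a = ((k + 1).factorial : ℂ)⁻¹ *
      actL (args₁ 0 A C) a (((T + ang (dSp 0) (dSp 1)) + sqb (dSp 0) (dSp 1)) ^ (k + 1)) := by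
    have h := subU_castSucc (m := 0) 0 (args₁ 0 A C) (k + 1) a
    rw [show (0 : Fin (0 + 1)).succ = 1 from rfl, graphSum_zero] at h
    refine h.trans ?_
    have hE : starExponent (0 + 2) + (ang ((Fin.cons (α := fun _ => Osc → Symb (0 + 2))
        (ySp (0 + 2)) fun l => dSp l.castSucc) 0) (- -dSp (Fin.last (0 + 1))) +
        ang ((Fin.cons (α := fun _ => Osc → Symb (0 + 2))
        (ySp (0 + 2)) fun l => dSp l.castSucc) 1) (- -dSp (Fin.last (0 + 1)))) =
        (T + ang (dSp 0) (dSp 1)) + sqb (dSp 0) (dSp 1) := by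
      rw [hT, starExponent_two, neg_neg]
      show _ + (ang (ySp _) (dSp 1) + ang (dSp 0) (dSp 1)) = _
      ring
    rw [hE]
    simp
  have e1 : subU (m := 0) 1 (args₁ 1 A C) (k + 1) a = -(((k + 1).factorial : ℂ)⁻¹ *
      actL (args₁ 0 A C) a (((T + ang (dSp 0) (dSp 1)) - sqb (dSp 0) (dSp 1)) ^ (k + 1))) := by
    have h := subU_last (m := 0) (args₁ 1 A C) (k + 1) a
    rw [show (Fin.last 0).castSucc = (0 : Fin (0 + 2)) from rfl,
      show (Fin.last (0 + 1)) = (1 : Fin (0 + 2)) from rfl, graphSum_zero] at h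
    refine h.trans ?_
    have hE : starExponent (0 + 2) + (ang ((Fin.snoc (α := fun _ => Osc → Symb (0 + 2))
        (fun l => dSp l.succ) (ySp (0 + 2))) 0) (- -dSp 0) +
        ang ((Fin.snoc (α := fun _ => Osc → Symb (0 + 2))
        (fun l => dSp l.succ) (ySp (0 + 2))) 1) (- -dSp 0)) = permLegs (Equiv.swap 0 1)
        ((T + ang (dSp 0) (dSp 1)) - sqb (dSp 0) (dSp 1)) := by
      rw [hT, starExponent_two, neg_neg]
      simp only [map_add, map_sub, permLegs_sqb_ySp, permLegs_ang_ySp, permLegs_sqb_dSp,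
        permLegs_ang_dSp, Equiv.swap_apply_left, Equiv.swap_apply_right]
      show _ + (ang (dSp 1) (dSp 0) + ang (ySp _) (dSp 0)) = _
      rw [sqb_comm (dSp 1) (dSp 0)]
      ring
    rw [hE, ← map_pow (permLegs _), actL_permLegs, hsw]
    have : (args₁ 0 A C ∘ Equiv.swap 0 1) ∘ Equiv.swap 0 1 = args₁ (0 : Fin (0 + 2)) A C := by
      ext1 l; simp
    rw [this]
  have hodd := actL_odd_part (args₁ (0 : Fin (0 + 2)) A C) a 1
    (T + ang (dSp 0) (dSp 1)) (sqb (dSp 0) (dSp 1))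
    (sqb_cube_mem _ _ _ _ (by rwa [args₁_self]) _) k
  simp only [one_mul] at hodd
  -- One dotted contraction leaves room for at most one undotted contraction: the former alone gives
  -- rotations, both together give translations.
  have hR : sqb (dSp 0) (dSp 1) * ang (dSp 0) (dSp 1) ^ 2 ∈
      annIdeal (args₁ (0 : Fin (0 + 2)) A C) a := by
    refine legIdeal_pow_three_le _ a 0 (by rwa [args₁_self]) ?_
    rw [pow_succ' _ 2]
    exact Ideal.mul_mem_mul (sqb_mem (dSp_mem 0) _) (Ideal.pow_mem_pow (ang_mem (dSp_mem 0) _) 2)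
  have hexp := actL_eq_of_sub_mem _ _ (mul_add_pow_sub_mem (E := T) hR k)
  rw [Fin.sum_univ_two, e0, e1, ← sub_eq_add_neg, ← mul_sub, hodd, hexp, map_add, ← nsmul_eq_mul,
    map_nsmul, nsmul_eq_mul, Nat.factorial_succ]
  have h4 : ((k : ℂ) + 1) ≠ 0 := by exact_mod_cast k.succ_ne_zero
  push_cast
  field_simp

theorem sum_subU_zero_zero (a : Osc →₀ ℕ) :
    ∑ i : Fin (0 + 2), subU i (args₁ i A C) 0 a = 0 := by
  have hsw : args₁ (1 : Fin (0 + 2)) A C = args₁ 0 A C ∘ Equiv.swap 0 1 := by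
    ext1 l
    fin_cases l <;> simp [args₁]
  have e0 := subU_castSucc (m := 0) 0 (args₁ 0 A C) 0 a
  have e1 := subU_last (m := 0) (args₁ 1 A C) 0 a
  rw [show (0 : Fin (0 + 1)).succ = 1 from rfl, graphSum_zero, pow_zero] at e0
  rw [show (Fin.last 0).castSucc = (0 : Fin (0 + 2)) from rfl,
      show (Fin.last (0 + 1)) = (1 : Fin (0 + 2)) from rfl, graphSum_zero, pow_zero, hsw,
      ← actL_permLegs, map_one (permLegs _)] at e1
  rw [Fin.sum_univ_two, hsw]
  refine (congrArg₂ (· + ·) e0 e1).trans ?_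
  simp

/-- The single contraction contributes at order `N + 1`, the double one at `N + 2`. At `k = 0` the
truncated subtraction in `k - 1` is harmless, since the factor `k` vanishes. -/
theorem tsum_factorial_shift₂ {f : ℕ → ℂ} {N : ℕ} {v v' : ℂ} (h0 : f 0 = 0)
    (hf : ∀ k, f (k + 1) = 2 * (k.factorial : ℂ)⁻¹ * ((if N = k then k.factorial * v else 0) +
      k * if N = k - 1 then (k - 1).factorial * v' else 0)) :
    ∑' k, f k = 2 * v + 2 * v' := by
  have hN : ∀ N : ℕ, ((N.factorial : ℕ) : ℂ) ≠ 0 := fun N => by exact_mod_cast N.factorial_ne_zero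
  rw [tsum_eq_sum (s := {N + 1, N + 2})]
  · have h1 : ((N : ℂ) + 1) ≠ 0 := by exact_mod_cast N.succ_ne_zero
    have h2 : (N : ℂ) * (if N = N - 1 then ((N - 1).factorial : ℂ) * v' else 0) = 0 := by
      rcases Nat.eq_zero_or_pos N with rfl | h
      · simp
      · rw [if_neg (by omega), mul_zero]
    rw [Finset.sum_pair (by omega), hf, hf, h2, if_pos rfl, if_neg (show ¬ N = N + 1 by omega),
      if_pos (show N = N + 1 - 1 by omega), Nat.add_sub_cancel, Nat.factorial_succ]
    push_cast
    have := hN N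
    field_simp
    ring
  · rintro (_ | k) hk
    · exact h0
    · simp only [Finset.mem_insert, Finset.mem_singleton, not_or] at hk
      rw [hf, if_neg (by omega)]
      rcases Nat.eq_zero_or_pos k with rfl | h
      · simp
      · rw [if_neg (by omega)]
        simp

/-- The quadratic vertex with a single one-form. -/
theorem coeff_vertexU_two (F : Spacetime →ₗ[ℂ] GenFun) (hF : ∀ ξ, IsQuadratic (F ξ))
    (hC : DottedForm c C) (ξ : Spacetime) (a : Osc →₀ ℕ) :
    MvPowerSeries.coeff a (vertexU 2 F C ξ) = 2 * MvPowerSeries.coeff a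
      (MvPowerSeries.rescale dotWeight (MvPowerSeries.pderiv ℂ (.inr 1) (F ξ)) *
          MvPowerSeries.pderiv ℂ (.inr 0) C -
        MvPowerSeries.rescale dotWeight (MvPowerSeries.pderiv ℂ (.inr 0) (F ξ)) *
          MvPowerSeries.pderiv ℂ (.inr 1) C) +
      2 * MvPowerSeries.coeff a
      (MvPowerSeries.rescale dotWeight (MvPowerSeries.pderiv ℂ (.inl 1)
            (MvPowerSeries.pderiv ℂ (.inr 1) (F ξ))) *
          MvPowerSeries.pderiv ℂ (.inl 0) (MvPowerSeries.pderiv ℂ (.inr 0) C) -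
        MvPowerSeries.rescale dotWeight (MvPowerSeries.pderiv ℂ (.inl 0)
            (MvPowerSeries.pderiv ℂ (.inr 1) (F ξ))) *
          MvPowerSeries.pderiv ℂ (.inl 1) (MvPowerSeries.pderiv ℂ (.inr 0) C) -
        MvPowerSeries.rescale dotWeight (MvPowerSeries.pderiv ℂ (.inl 1)
            (MvPowerSeries.pderiv ℂ (.inr 0) (F ξ))) *
          MvPowerSeries.pderiv ℂ (.inl 0) (MvPowerSeries.pderiv ℂ (.inr 1) C) +
        MvPowerSeries.rescale dotWeight (MvPowerSeries.pderiv ℂ (.inl 0)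
            (MvPowerSeries.pderiv ℂ (.inr 0) (F ξ))) *
          MvPowerSeries.pderiv ℂ (.inl 1) (MvPowerSeries.pderiv ℂ (.inr 1) C)) := by
  show ∑ i : Fin (0 + 2), ∑' k, subU i (args₁ i (F ξ) C) k a = _
  rw [← Summable.tsum_finsetSum fun i _ => summable_subU i (hF ξ) hC a]
  refine tsum_factorial_shift₂ (N := a.degree) (sum_subU_zero_zero a) fun k => ?_
  have h3 : (0 : Fin (0 + 2)) ≠ 1 := by decide
  have h2 : ∀ f : GenFun, MvPowerSeries.rescale (1 : Osc → ℂ) f = f := fun f => by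
    rw [MvPowerSeries.rescale_one]; rfl
  have hexp : sqb (dSp 0) (dSp 1) * ang (dSp 0) (dSp 1) * taylorSymb (n := 0 + 2)
      ![dotWeight, 1] ^ (k - 1) =
      MvPolynomial.X (some 0, .inr 1) * (MvPolynomial.X (some 1, .inr 0) *
        (MvPolynomial.X (some 0, .inl 1) * (MvPolynomial.X (some 1, .inl 0) *
          taylorSymb (n := 0 + 2) ![dotWeight, 1] ^ (k - 1)))) -
      MvPolynomial.X (some 0, .inr 1) * (MvPolynomial.X (some 1, .inr 0) *
        (MvPolynomial.X (some 0, .inl 0) * (MvPolynomial.X (some 1, .inl 1) *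
          taylorSymb (n := 0 + 2) ![dotWeight, 1] ^ (k - 1)))) -
      MvPolynomial.X (some 0, .inr 0) * (MvPolynomial.X (some 1, .inr 1) *
        (MvPolynomial.X (some 0, .inl 1) * (MvPolynomial.X (some 1, .inl 0) *
          taylorSymb (n := 0 + 2) ![dotWeight, 1] ^ (k - 1)))) +
      MvPolynomial.X (some 0, .inr 0) * (MvPolynomial.X (some 1, .inr 1) *
        (MvPolynomial.X (some 0, .inl 0) * (MvPolynomial.X (some 1, .inl 1) *
          taylorSymb (n := 0 + 2) ![dotWeight, 1] ^ (k - 1)))) := by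
    rw [sqb_dSp, ang_dSp]; ring
  rw [sum_subU_zero (hF ξ), hexp, sqb_dSp, sub_mul, map_sub]
  simp only [mul_assoc, map_add, map_sub, actL_X_some_mul, actL_taylorSymb_pow, prod_univ_zero_add_two,
    Function.update_self, Function.update_of_ne h3, Function.update_of_ne h3.symm,
    Matrix.cons_val_zero, Matrix.cons_val_one, h2, args₁_self, args₁_of_ne h3.symm]
  congr 1
  split_ifs <;> ring

end Quadratic

/-! ### The cubic vertex -/

section Cubic

variable {A B C : GenFun} {c : Fin 2 → ℂ}

theorem graphs_cubic_zero_one : graphs (m := 1) 0 1 = {![some 2, none]} := by decide +kernel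

theorem graphs_cubic_zero_two : graphs (m := 1) 0 2 = {![some 1, none], ![none, some 1]} := by
  decide +kernel

theorem graphs_cubic_one_two : graphs (m := 1) 1 2 = {![none, some 0]} := by decide +kernel

theorem sum_univ_one_add_two {M : Type*} [AddCommMonoid M] (f : Fin (1 + 2) → M) :
    ∑ i, f i = f 0 + f 1 + f 2 := Fin.sum_univ_three f

theorem prod_univ_one_add_two {M : Type*} [CommMonoid M] (f : Fin (1 + 2) → M) :
    ∏ i, f i = f 0 * f 1 * f 2 := Fin.prod_univ_three f

theorem sum_univ_one_add_one {M : Type*} [AddCommMonoid M] (f : Fin (1 + 1) → M) :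
    ∑ i, f i = f 0 + f 1 := Fin.sum_univ_two f

/-- The area of the integration domain of the cubic vertex. -/
theorem integral_simplexDom_one (z : ℂ) : ∫ _ in simplexDom 1, z = 1 / 2 * z := by
  -- With vectors `(u, v)` and `(1 - u, 1 - v)` the slope condition `u (1 - v) ≤ (1 - u) v` is just
  -- `u ≤ v`: the domain is a triangle of area one half.
  let S : Set (ℝ × ℝ) := {p | 0 ≤ p.1 ∧ p.1 ≤ p.2 ∧ p.2 ≤ 1}
  have hS : MeasurableSet S :=
    ((isClosed_le continuous_const continuous_fst).inter
      ((isClosed_le continuous_fst continuous_snd).inter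
        (isClosed_le continuous_snd continuous_const))).measurableSet
  have hpre : simplexDom 1 = (MeasurableEquiv.funUnique (Fin 1) (ℝ × ℝ)) ⁻¹' S := by
    ext q
    have h0 : fullVec q 0 = q 0 := fullVec_castSucc q 0
    have h1 : fullVec q 1 = (1 - (q 0).1, 1 - (q 0).2) := by
      have := fullVec_last q
      simpa using this
    have hmem : (q ∈ (MeasurableEquiv.funUnique (Fin 1) (ℝ × ℝ)) ⁻¹' S) ↔
        (0 ≤ (q 0).1 ∧ (q 0).1 ≤ (q 0).2 ∧ (q 0).2 ≤ 1) := Iff.rfl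
    rw [hmem]
    constructor
    · rintro ⟨h, h'⟩
      have a0 := h 0
      have a1 := h 1
      have a2 := h' 0 1 (by decide)
      rw [h0] at a0
      rw [h1] at a1
      rw [h0, h1] at a2
      simp only at a1 a2
      exact ⟨a0.1, by nlinarith, by linarith⟩
    · rintro ⟨a0, a1, a2⟩
      refine ⟨fun k => ?_, fun k l hkl => ?_⟩
      · fin_cases k
        · exact ⟨by rw [Fin.zero_eta, h0]; exact a0, by rw [Fin.zero_eta, h0]; linarith⟩
        · exact ⟨by rw [Fin.mk_one, h1]; simp only; linarith,
            by rw [Fin.mk_one, h1]; simp only; linarith⟩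
      · obtain ⟨hk, hl⟩ : k = 0 ∧ l = 1 := by
          fin_cases k <;> fin_cases l <;> simp_all
        rw [hk, hl, h0, h1]
        simp only
        nlinarith
  have hvol : volume S = ENNReal.ofReal (1 / 2) := by
    have hsec : ∀ u : ℝ, volume (Prod.mk u ⁻¹' S) =
        (Set.Icc (0 : ℝ) 1).indicator (fun u => ENNReal.ofReal (1 - u)) u := by
      intro u
      by_cases hu : u ∈ Set.Icc (0 : ℝ) 1
      · rw [Set.indicator_of_mem hu, ← Real.volume_Icc]
        congr 1
        ext v
        exact ⟨fun h => h.2, fun h => ⟨hu.1, h⟩⟩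
      · rw [Set.indicator_of_notMem hu]
        convert measure_empty (μ := (volume : Measure ℝ))
        ext v
        simp only [Set.mem_preimage, Set.mem_empty_iff_false, iff_false]
        exact fun h => hu ⟨h.1, h.2.1.trans h.2.2⟩
    rw [Measure.volume_eq_prod, Measure.prod_apply hS]
    simp only [hsec]
    rw [lintegral_indicator measurableSet_Icc, ← ofReal_integral_eq_lintegral_ofReal]
    · congr 1
      rw [integral_Icc_eq_integral_Ioc, ← intervalIntegral.integral_of_le zero_le_one]
      rw [intervalIntegral.integral_sub (by simp) (by simp), integral_id,
        intervalIntegral.integral_const]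
      norm_num
    · exact (by fun_prop : Continuous fun u : ℝ => 1 - u).continuousOn.integrableOn_compact
        isCompact_Icc
    · refine (ae_restrict_iff' measurableSet_Icc).2 (Filter.Eventually.of_forall fun u hu => ?_)
      simpa using hu.2
  have hv : volume (simplexDom 1) = ENNReal.ofReal (1 / 2) := by
    rw [hpre, ← hvol]
    exact (volume_preserving_funUnique (Fin 1) (ℝ × ℝ)).measure_preimage hS.nullMeasurableSet
  rw [setIntegral_const, Measure.real, hv, ENNReal.toReal_ofReal (by norm_num),
    Complex.real_smul]
  norm_num

/-- The exponent of a cubic sub-vertex, with the one-forms moved to the first two positions: the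
vector `w` is attached to the zero-form and `w'` to the output. -/
def cubicExponent (w w' : ℝ × ℝ) (s t : ℂ) : Symb (1 + 2) :=
  (sqb (ySp _) (dSp 0) + sqb (ySp _) (dSp 1) + sqb (ySp _) (dSp 2) + sqb (dSp 0) (dSp 1) +
    s • sqb (dSp 0) (dSp 2) + t • sqb (dSp 1) (dSp 2)) +
  ∑ x : Fin 2, ((![(w.1 : ℂ), (w.2 : ℂ)] x) • ang (dSp (![0, 1] x)) (dSp 2) +
    (![(w'.1 : ℂ), (w'.2 : ℂ)] x) • ang (ySp _) (dSp (![0, 1] x)))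

/-- What remains of the exponent of a cubic sub-vertex when all oscillators of the second one-form
are contracted. -/
def cubicReduced (u u' : ℝ) (s : ℂ) : Symb (1 + 2) :=
  (sqb (ySp _) (dSp 2) + sqb (ySp _) (dSp 0) + s • sqb (dSp 0) (dSp 2)) +
  ∑ _x : Unit, ((u : ℂ) • ang (dSp 0) (dSp 2) + (u' : ℂ) • ang (ySp _) (dSp 0))

theorem starExponent_three : starExponent (1 + 2) =
    sqb (ySp _) (dSp 0) + sqb (ySp _) (dSp 1) + sqb (ySp _) (dSp 2) +
      (sqb (dSp 0) (dSp 1) + sqb (dSp 0) (dSp 2) + sqb (dSp 1) (dSp 2)) := by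
  have h0 : Finset.Ioi (0 : Fin (1 + 2)) = {1, 2} := by decide
  have h1 : Finset.Ioi (1 : Fin (1 + 2)) = {2} := by decide
  have h2 : Finset.Ioi (2 : Fin (1 + 2)) = ∅ := by decide
  rw [starExponent, sum_univ_one_add_two, sum_univ_one_add_two, h0, h1, h2,
    Finset.sum_pair (by decide), Finset.sum_singleton, Finset.sum_empty, add_zero]

theorem cubic_zero_one (q : Fin 1 → ℝ × ℝ) :
    starExponent (1 + 2) + uvExponent 0 1 ![some 2, none] q (ySp _) dSp =
      cubicExponent (fullVec q 0) (fullVec q 1) 1 1 := by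
  rw [starExponent_three, uvExponent, sum_univ_one_add_one, cubicExponent, Fin.sum_univ_two]
  simp [ang_neg_right]
  ring

theorem cubic_zero_two (q : Fin 1 → ℝ × ℝ) : permLegs (Equiv.swap 1 2)
    (starExponent (1 + 2) + uvExponent 0 2 ![some 1, none] q (ySp _) dSp) =
      cubicExponent (fullVec q 0) (fullVec q 1) 1 (-1) := by
  have h : Equiv.swap (1 : Fin (1 + 2)) 2 0 = 0 := by decide
  rw [starExponent_three, uvExponent, sum_univ_one_add_one, cubicExponent, Fin.sum_univ_two]
  simp only [Matrix.cons_val_zero, Matrix.cons_val_one, Option.elim_some, Option.elim_none,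
    ang_neg_right, map_add, map_smul, permLegs_sqb_ySp, permLegs_sqb_dSp, permLegs_ang_dSp,
    permLegs_ang_ySp, h, Equiv.swap_apply_left, Equiv.swap_apply_right]
  rw [sqb_comm (dSp 2) (dSp 1)]
  module

theorem cubic_zero_two' (q : Fin 1 → ℝ × ℝ) : permLegs (Equiv.swap 1 2)
    (starExponent (1 + 2) + uvExponent 0 2 ![none, some 1] q (ySp _) dSp) =
      cubicExponent (fullVec q 1) (fullVec q 0) 1 (-1) := by
  have h : Equiv.swap (1 : Fin (1 + 2)) 2 0 = 0 := by decide
  rw [starExponent_three, uvExponent, sum_univ_one_add_one, cubicExponent, Fin.sum_univ_two]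
  simp only [Matrix.cons_val_zero, Matrix.cons_val_one, Option.elim_some, Option.elim_none,
    ang_neg_right, map_add, map_smul, permLegs_sqb_ySp, permLegs_sqb_dSp, permLegs_ang_dSp,
    permLegs_ang_ySp, h, Equiv.swap_apply_left, Equiv.swap_apply_right]
  rw [sqb_comm (dSp 2) (dSp 1)]
  module

/-- The permutation that moves the last two legs to the front. -/
def rotateLegs : Fin (1 + 2) ≃ Fin (1 + 2) :=
  ⟨![2, 0, 1], ![1, 2, 0], by decide, by decide⟩

theorem cubic_one_two (q : Fin 1 → ℝ × ℝ) : permLegs rotateLegs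
    (starExponent (1 + 2) + uvExponent 1 2 ![none, some 0] q (ySp _) dSp) =
      cubicExponent (fullVec q 1) (fullVec q 0) (-1) (-1) := by
  have h0 : rotateLegs 0 = 2 := rfl
  have h1 : rotateLegs 1 = 0 := rfl
  have h2 : rotateLegs 2 = 1 := rfl
  rw [starExponent_three, uvExponent, sum_univ_one_add_one, cubicExponent, Fin.sum_univ_two]
  simp only [Matrix.cons_val_zero, Matrix.cons_val_one, Option.elim_some, Option.elim_none,
    ang_neg_right, map_add, map_smul, permLegs_sqb_ySp, permLegs_sqb_dSp, permLegs_ang_dSp,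
    permLegs_ang_ySp, h0, h1, h2]
  rw [sqb_comm (dSp 2) (dSp 1), sqb_comm (dSp 2) (dSp 0)]
  module

/-- Integral of a cubic sub-vertex; the vector `x` is attached to the zero-form and `x'` to the
output. -/
def cubicInt (A B C : GenFun) (a : Osc →₀ ℕ) (x x' : Fin 2) (s t : ℂ) (k : ℕ) : ℂ :=
  ∫ q in simplexDom 1, actL (args₂ 0 1 A B C) a (ang (dSp 0) (dSp 1) *
    cubicExponent (fullVec q x) (fullVec q x') s t ^ k)

/-- With the one-forms in front, a placement of the zero-form is remembered by the signs of its two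
dotted contractions and by the vector it carries. The middle placement has two graphs and the
opposite overall sign. Each graph is paired with the outer placement carrying the same vectors, from
which it differs in one sign only. -/
theorem sum_subV_one (a : Osc →₀ ℕ) (k : ℕ) :
    subV (m := 1) 0 1 (args₂ 0 1 A B C) k a + subV (m := 1) 0 2 (args₂ 0 2 A B C) k a +
      subV (m := 1) 1 2 (args₂ 1 2 A B C) k a = (k.factorial : ℂ)⁻¹ *
      ((cubicInt A B C a 0 1 1 1 k - cubicInt A B C a 0 1 1 (-1) k) +
        (cubicInt A B C a 1 0 (-1) (-1) k - cubicInt A B C a 1 0 1 (-1) k)) := by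
  have a02 : args₂ (0 : Fin (1 + 2)) 2 A B C = args₂ 0 1 A B C ∘ Equiv.swap 1 2 := by
    ext1 l
    fin_cases l <;> simp [args₂, Equiv.swap_apply_def]
  have a12 : args₂ (1 : Fin (1 + 2)) 2 A B C = args₂ 0 1 A B C ∘ rotateLegs := by
    ext1 l
    fin_cases l <;> simp [args₂, rotateLegs]
  have s01 : ((-1 : ℂ)) ^ (((0 : Fin (1 + 2)) : ℕ) + (1 : Fin (1 + 2)) + 1) = 1 := by simp
  have s02 : ((-1 : ℂ)) ^ (((0 : Fin (1 + 2)) : ℕ) + (2 : Fin (1 + 2)) + 1) = -1 := by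
    have : ((2 : Fin (1 + 2)) : ℕ) = 2 := rfl
    rw [this]; norm_num
  have s12 : ((-1 : ℂ)) ^ (((1 : Fin (1 + 2)) : ℕ) + (2 : Fin (1 + 2)) + 1) = 1 := by
    have : ((2 : Fin (1 + 2)) : ℕ) = 2 := rfl
    have h1 : ((1 : Fin (1 + 2)) : ℕ) = 1 := rfl
    rw [this, h1]; norm_num
  have hsw : Equiv.swap (1 : Fin (1 + 2)) 2 0 = 0 := by decide
  have r1 : rotateLegs 1 = 0 := rfl
  have r2 : rotateLegs 2 = 1 := rfl
  rw [subV, subV, subV, s01, s02, s12, graphSum_eq, graphSum_eq, graphSum_eq,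
    graphs_cubic_zero_one, graphs_cubic_zero_two, graphs_cubic_one_two, Finset.sum_singleton,
    Finset.sum_singleton, Finset.sum_pair (by decide), a02, a12]
  simp only [← actL_permLegs, pow_one, map_mul (permLegs _), map_pow (permLegs _), cubic_zero_one,
    cubic_zero_two, cubic_zero_two', cubic_one_two, permLegs_ang_dSp, hsw, r1, r2,
    Equiv.swap_apply_right]
  simp only [cubicInt]
  ring

theorem continuous_cubicExponent (L : Symb (1 + 2) →ₗ[ℂ] ℂ) (G : Symb (1 + 2)) (x x' : Fin 2)
    (s t : ℂ) (k : ℕ) : Continuous fun q : Fin 1 → ℝ × ℝ =>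
      L (G * cubicExponent (fullVec q x) (fullVec q x') s t ^ k) := by
  have h : ∀ (x y : Fin 2), Continuous fun q : Fin 1 → ℝ × ℝ =>
      (![((fullVec q x).1 : ℂ), ((fullVec q x).2 : ℂ)] y) := by
    intro x y
    fin_cases y
    · exact Complex.continuous_ofReal.comp (continuous_fullVec x).fst
    · exact Complex.continuous_ofReal.comp (continuous_fullVec x).snd
  exact continuous_map_mul_pow L _ _ _ (h x) (h x') k G

theorem continuous_cubicReduced (L : Symb (1 + 2) →ₗ[ℂ] ℂ) (G : Symb (1 + 2)) (s : ℂ) (k : ℕ) :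
    Continuous fun q : Fin 1 → ℝ × ℝ =>
      L (G * cubicReduced (fullVec q 0).1 (fullVec q 1).1 s ^ k) :=
  continuous_map_mul_pow L _ _ _
    (fun _ => Complex.continuous_ofReal.comp (continuous_fullVec 0).fst)
    (fun _ => Complex.continuous_ofReal.comp (continuous_fullVec 1).fst) k G

/-- Integral of the cubic vertex with the oscillators of the second one-form contracted. -/
def cubicRedInt (A B C : GenFun) (a : Osc →₀ ℕ) (s : ℂ) (k : ℕ) : ℂ :=
  ∫ q in simplexDom 1, actL (args₂ 0 1 A B C) a (ang (dSp 0) (dSp 1) * sqb (dSp 1) (dSp 2) *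
    cubicReduced (fullVec q 0).1 (fullVec q 1).1 s ^ k)

theorem ang_mul_mem_left (hA : IsQuadratic A) (a : Osc →₀ ℕ) {F : Symb (1 + 2)}
    (hF : F ∈ legIdeal (n := 1 + 2) 0 ^ 2) :
    ang (dSp 0) (dSp 1) * F ∈ annIdeal (args₂ (0 : Fin (1 + 2)) 1 A B C) a := by
  refine legIdeal_pow_three_le _ a 0 (by rwa [args₂_left]) ?_
  rw [pow_succ' _ 2]
  exact Ideal.mul_mem_mul (ang_mem (dSp_mem 0) _) hF

theorem ang_mul_mem_right (hB : IsQuadratic B) (a : Osc →₀ ℕ) {F : Symb (1 + 2)}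
    (hF : F ∈ legIdeal (n := 1 + 2) 1 ^ 2) :
    ang (dSp 0) (dSp 1) * F ∈ annIdeal (args₂ (0 : Fin (1 + 2)) 1 A B C) a := by
  refine legIdeal_pow_three_le _ a 1 (by rwa [args₂_right (by decide)]) ?_
  rw [pow_succ' _ 2, ang_comm]
  exact Ideal.mul_mem_mul (neg_mem (ang_mem (dSp_mem 1) _)) hF

-- The exponents differ in the sign of `[∂_1 ∂_2]`, so the odd part in this bracket is left.
-- Together with the prefactor it uses up the second one-form, which removes every other exponent
-- term differentiating it.
set_option maxHeartbeats 800000 in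
theorem actL_cubic_right (hB : IsQuadratic B) (a : Osc →₀ ℕ) (w w' : ℝ × ℝ) (k : ℕ) :
    actL (args₂ 0 1 A B C) a (ang (dSp 0) (dSp 1) * cubicExponent w w' 1 1 ^ (k + 1)) -
      actL (args₂ 0 1 A B C) a (ang (dSp 0) (dSp 1) * cubicExponent w w' 1 (-1) ^ (k + 1)) =
    2 * (k + 1) * actL (args₂ 0 1 A B C) a (ang (dSp 0) (dSp 1) * sqb (dSp 1) (dSp 2) *
      cubicReduced w.1 w'.1 1 ^ k) := by
  have h1 : cubicExponent w w' 1 1 = cubicExponent w w' 1 0 + sqb (dSp 1) (dSp 2) := by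
    simp only [cubicExponent]; module
  have h2 : cubicExponent w w' 1 (-1) = cubicExponent w w' 1 0 - sqb (dSp 1) (dSp 2) := by
    simp only [cubicExponent]; module
  have hD : sqb (dSp 1) (dSp 2) ∈ legIdeal (n := 1 + 2) 1 := sqb_mem (dSp_mem 1) _
  rw [h1, h2, actL_odd_part _ _ _ _ _ (by
    rw [pow_succ, ← mul_assoc]
    exact Ideal.mul_mem_right _ _ (ang_mul_mem_right hB a (Ideal.pow_mem_pow hD 2)))]
  congr 1
  refine actL_eq_of_sub_mem _ _ (mul_pow_sub_pow_mem ?_ k)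
  rw [mul_assoc]
  refine ang_mul_mem_right hB a ?_
  rw [pow_two]
  refine Ideal.mul_mem_mul hD ?_
  have h3 : cubicExponent w w' 1 0 - cubicReduced w.1 w'.1 1 = sqb (ySp _) (dSp 1) +
      sqb (dSp 0) (dSp 1) + (w.2 : ℂ) • ang (dSp 1) (dSp 2) + (w'.2 : ℂ) • ang (ySp _) (dSp 1) := by
    simp only [cubicExponent, cubicReduced, Fin.sum_univ_two, Finset.univ_unique,
      Finset.sum_singleton, Matrix.cons_val_zero, Matrix.cons_val_one]
    module
  rw [h3, sqb_comm (ySp _) (dSp 1), sqb_comm (dSp 0) (dSp 1), ang_comm (ySp _) (dSp 1)]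
  exact add_mem (add_mem (add_mem (neg_mem (sqb_mem (dSp_mem 1) _))
    (neg_mem (sqb_mem (dSp_mem 1) _))) (smul_mem_ideal _ (ang_mem (dSp_mem 1) _)))
    (smul_mem_ideal _ (neg_mem (ang_mem (dSp_mem 1) _)))

/-- The mirror image of `actL_cubic_right`: here the first one-form is used up. Renaming the
one-forms brings the result to the same shape, with `v` in place of `u` and the opposite dotted
sign. -/
theorem actL_cubic_left (hA : IsQuadratic A) (a : Osc →₀ ℕ) (w w' : ℝ × ℝ) (k : ℕ) :
    actL (args₂ 0 1 A B C) a (ang (dSp 0) (dSp 1) * cubicExponent w w' (-1) (-1) ^ (k + 1)) -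
      actL (args₂ 0 1 A B C) a (ang (dSp 0) (dSp 1) * cubicExponent w w' 1 (-1) ^ (k + 1)) =
    2 * (k + 1) * actL (args₂ 0 1 B A C) a (ang (dSp 0) (dSp 1) * sqb (dSp 1) (dSp 2) *
      cubicReduced w.2 w'.2 (-1) ^ k) := by
  have h1 : cubicExponent w w' 1 (-1) = cubicExponent w w' 0 (-1) + sqb (dSp 0) (dSp 2) := by
    simp only [cubicExponent]; module
  have h2 : cubicExponent w w' (-1) (-1) = cubicExponent w w' 0 (-1) - sqb (dSp 0) (dSp 2) := by
    simp only [cubicExponent]; module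
  have hD : sqb (dSp 0) (dSp 2) ∈ legIdeal (n := 1 + 2) 0 := sqb_mem (dSp_mem 0) _
  have h01 : (0 : Fin (1 + 2)) ≠ 1 := by decide
  have hsw : Equiv.swap (0 : Fin (1 + 2)) 1 2 = 2 := by decide
  have hred : permLegs (Equiv.swap 0 1) (cubicReduced w.2 w'.2 (-1)) =
      sqb (ySp _) (dSp 2) + sqb (ySp _) (dSp 1) - sqb (dSp 1) (dSp 2) +
        ((w.2 : ℂ) • ang (dSp 1) (dSp 2) + (w'.2 : ℂ) • ang (ySp _) (dSp 1)) := by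
    simp only [cubicReduced, Finset.univ_unique, Finset.sum_singleton, map_add, map_smul,
      permLegs_sqb_ySp, permLegs_sqb_dSp, permLegs_ang_dSp, permLegs_ang_ySp,
      Equiv.swap_apply_left, hsw]
    module
  rw [← neg_sub, h1, h2, actL_odd_part _ _ _ _ _ (by
    rw [pow_succ, ← mul_assoc]
    exact Ideal.mul_mem_right _ _ (ang_mul_mem_left hA a (Ideal.pow_mem_pow hD 2))), ← mul_neg]
  congr 1
  have hsw' : args₂ 0 1 B A C = args₂ 0 1 A B C ∘ Equiv.swap (0 : Fin (1 + 2)) 1 :=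
    (args₂_comp_swap h01).symm
  rw [hsw', ← actL_permLegs, map_mul (permLegs _), map_mul (permLegs _),
    map_pow (permLegs _), permLegs_ang_dSp, permLegs_sqb_dSp, Equiv.swap_apply_left,
    Equiv.swap_apply_right, hsw, hred, ← map_neg, ang_comm (dSp 1) (dSp 0), neg_mul, neg_mul,
    map_neg, map_neg, neg_inj]
  refine actL_eq_of_sub_mem _ _ (mul_pow_sub_pow_mem ?_ k)
  rw [mul_assoc]
  refine ang_mul_mem_left hA a ?_
  rw [pow_two]
  refine Ideal.mul_mem_mul hD ?_
  have h3 : cubicExponent w w' 0 (-1) - (sqb (ySp _) (dSp 2) + sqb (ySp _) (dSp 1) -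
      sqb (dSp 1) (dSp 2) + ((w.2 : ℂ) • ang (dSp 1) (dSp 2) + (w'.2 : ℂ) • ang (ySp _) (dSp 1))) =
      sqb (ySp _) (dSp 0) + sqb (dSp 0) (dSp 1) + (w.1 : ℂ) • ang (dSp 0) (dSp 2) +
        (w'.1 : ℂ) • ang (ySp _) (dSp 0) := by
    simp only [cubicExponent, Fin.sum_univ_two, Matrix.cons_val_zero, Matrix.cons_val_one]
    module
  rw [h3, sqb_comm (ySp _) (dSp 0), ang_comm (ySp _) (dSp 0)]
  exact add_mem (add_mem (add_mem (neg_mem (sqb_mem (dSp_mem 0) _))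
    (sqb_mem (dSp_mem 0) _)) (smul_mem_ideal _ (ang_mem (dSp_mem 0) _)))
    (smul_mem_ideal _ (neg_mem (ang_mem (dSp_mem 0) _)))

theorem sum_subV_one_succ (hA : IsQuadratic A) (hB : IsQuadratic B) (a : Osc →₀ ℕ) (k : ℕ) :
    subV (m := 1) 0 1 (args₂ 0 1 A B C) (k + 1) a + subV (m := 1) 0 2 (args₂ 0 2 A B C) (k + 1) a +
      subV (m := 1) 1 2 (args₂ 1 2 A B C) (k + 1) a = 2 * (k.factorial : ℂ)⁻¹ *
        (cubicRedInt A B C a 1 k + cubicRedInt B A C a (-1) k) := by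
  have hI : ∀ x x' s t, Integrable (fun q => actL (args₂ 0 1 A B C) a (ang (dSp 0) (dSp 1) *
      cubicExponent (fullVec q x) (fullVec q x') s t ^ (k + 1)))
        (volume.restrict (simplexDom 1)) := fun x x' s t =>
    integrable_simplexDom (continuous_cubicExponent _ _ _ _ _ _ _)
  have e1 : cubicInt A B C a 0 1 1 1 (k + 1) - cubicInt A B C a 0 1 1 (-1) (k + 1) =
      2 * (k + 1) * cubicRedInt A B C a 1 k := by
    rw [cubicInt, cubicInt, ← integral_sub (hI _ _ _ _) (hI _ _ _ _)]
    simp only [actL_cubic_right hB]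
    rw [integral_const_mul, cubicRedInt]
  have e2 : cubicInt A B C a 1 0 (-1) (-1) (k + 1) - cubicInt A B C a 1 0 1 (-1) (k + 1) =
      2 * (k + 1) * cubicRedInt B A C a (-1) k := by
    rw [cubicInt, cubicInt, ← integral_sub (hI _ _ _ _) (hI _ _ _ _)]
    simp only [actL_cubic_left hA]
    rw [integral_const_mul, cubicRedInt]
    -- The reflection trades the `v`-components with the vectors in reversed order for the
    -- `u`-components in the original order.
    conv_rhs => rw [← setIntegral_comp_reflect]
    simp only [fullVec_reflect, Prod.fst_swap]
    rfl
  rw [sum_subV_one, e1, e2, ← mul_add, Nat.factorial_succ]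
  have h4 : ((k : ℂ) + 1) ≠ 0 := by exact_mod_cast k.succ_ne_zero
  push_cast
  field_simp

/-- The fully contracted part of the cubic vertex. -/
def cubicContr (A B C : GenFun) (a : Osc →₀ ℕ) (k : ℕ) : ℂ :=
  actL (args₂ 0 1 A B C) a (ang (dSp 0) (dSp 1) * sqb (dSp 1) (dSp 2) * sqb (dSp 0) (dSp 2) *
    sqb (ySp _) (dSp (2 : Fin (1 + 2))) ^ k)

/-- The odd part in `[∂_0 ∂_2]` exhausts the first one-form as well. The integrand no longer depends
on the integration point, and the area `1/2` cancels the factor two of the odd part. -/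
theorem cubicRedInt_sub (hA : IsQuadratic A) (a : Osc →₀ ℕ) (k : ℕ) :
    cubicRedInt A B C a 1 (k + 1) - cubicRedInt A B C a (-1) (k + 1) =
      (k + 1) * cubicContr A B C a k := by
  have hI : ∀ s, Integrable (fun q => actL (args₂ 0 1 A B C) a (ang (dSp 0) (dSp 1) *
      sqb (dSp 1) (dSp 2) * cubicReduced (fullVec q 0).1 (fullVec q 1).1 s ^ (k + 1)))
        (volume.restrict (simplexDom 1)) := fun s =>
    integrable_simplexDom (continuous_cubicReduced _ _ _ _)
  have hD : sqb (dSp 0) (dSp 2) ∈ legIdeal (n := 1 + 2) 0 := sqb_mem (dSp_mem 0) _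
  have key : ∀ u u' : ℝ, actL (args₂ 0 1 A B C) a (ang (dSp 0) (dSp 1) *
      sqb (dSp 1) (dSp 2) * cubicReduced u u' 1 ^ (k + 1)) - actL (args₂ 0 1 A B C) a
      (ang (dSp 0) (dSp 1) * sqb (dSp 1) (dSp 2) * cubicReduced u u' (-1) ^ (k + 1)) =
      2 * (k + 1) * cubicContr A B C a k := by
    intro u u'
    have h1 : cubicReduced u u' 1 = cubicReduced u u' 0 + sqb (dSp 0) (dSp 2) := by
      simp only [cubicReduced]; module
    have h2 : cubicReduced u u' (-1) = cubicReduced u u' 0 - sqb (dSp 0) (dSp 2) := by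
      simp only [cubicReduced]; module
    rw [h1, h2, actL_odd_part _ _ _ _ _ (by
      rw [mul_assoc, mul_left_comm, pow_succ _ 2, ← mul_assoc (ang _ _)]
      exact Ideal.mul_mem_left _ _ (Ideal.mul_mem_right _ _
        (ang_mul_mem_left hA a (Ideal.pow_mem_pow hD 2)))), cubicContr]
    congr 1
    refine actL_eq_of_sub_mem _ _ (mul_pow_sub_pow_mem ?_ k)
    have hassoc : ∀ x y z w : Symb (1 + 2), x * y * z * w = y * (x * (z * w)) := by
      intros; ring
    rw [hassoc]
    refine Ideal.mul_mem_left _ _ (ang_mul_mem_left hA a ?_)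
    rw [pow_two]
    refine Ideal.mul_mem_mul hD ?_
    have h3 : cubicReduced u u' 0 - sqb (ySp _) (dSp 2) = sqb (ySp _) (dSp 0) +
        (u : ℂ) • ang (dSp 0) (dSp 2) + (u' : ℂ) • ang (ySp _) (dSp 0) := by
      simp only [cubicReduced, Finset.univ_unique, Finset.sum_singleton]
      module
    rw [h3, sqb_comm (ySp _) (dSp 0), ang_comm (ySp _) (dSp 0)]
    exact add_mem (add_mem (neg_mem (sqb_mem (dSp_mem 0) _))
      (smul_mem_ideal _ (ang_mem (dSp_mem 0) _)))
      (smul_mem_ideal _ (neg_mem (ang_mem (dSp_mem 0) _)))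
  rw [cubicRedInt, cubicRedInt, ← integral_sub (hI _) (hI _)]
  simp only [key]
  rw [integral_simplexDom_one]
  ring

/-- The two dotted brackets are exchanged with each other, while the undotted one changes sign. -/
theorem cubicContr_swap (a : Osc →₀ ℕ) (k : ℕ) : cubicContr B A C a k = -cubicContr A B C a k := by
  have h01 : (0 : Fin (1 + 2)) ≠ 1 := by decide
  have hsw : Equiv.swap (0 : Fin (1 + 2)) 1 2 = 2 := by decide
  rw [cubicContr, cubicContr, ← args₂_comp_swap h01, ← actL_permLegs]
  simp only [map_mul (permLegs _), map_pow (permLegs _), permLegs_ang_dSp, permLegs_sqb_dSp,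
    permLegs_sqb_ySp, Equiv.swap_apply_left, Equiv.swap_apply_right, hsw]
  rw [← map_neg, ang_comm (dSp 1) (dSp 0)]
  congr 1
  ring

theorem taylorSymb_cubic : taylorSymb (n := 1 + 2) ![0, 0, dotWeight] =
    sqb (ySp _) (dSp 2) := by
  rw [taylorSymb, sqb_ySp_dSp, Fintype.sum_sum_type]
  simp [sum_univ_one_add_two, dotWeight]

theorem tsum_factorial_shift_two {f : ℕ → ℂ} {N : ℕ} {v : ℂ} (h0 : f 0 = 0) (h1 : f 1 = 0)
    (hf : ∀ k, f (k + 2) = (k.factorial : ℂ)⁻¹ * if N = k then k.factorial * v else 0) :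
    ∑' k, f k = v := by
  rw [tsum_eq_single (N + 2), hf, if_pos rfl, inv_mul_cancel_left₀]
  · exact_mod_cast N.factorial_ne_zero
  · rintro (_ | _ | k) hk
    · exact h0
    · exact h1
    · rw [hf, if_neg (by omega), mul_zero]

/-- The cubic vertex on quadratic one-forms, in terms of the components `e`, `e'` of the mixed
terms. -/
theorem coeff_vertexV_three (F : Spacetime →ₗ[ℂ] GenFun) (hF : ∀ ξ, IsQuadratic (F ξ))
    (hC : DottedForm c C) (ξ η : Spacetime) (a : Osc →₀ ℕ) {e e' : Fin 2 → Fin 2 → ℂ}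
    (he : ∀ α γ, MvPowerSeries.pderiv ℂ (.inl α) (MvPowerSeries.pderiv ℂ (.inr γ) (F ξ)) =
      MvPowerSeries.C (e α γ))
    (he' : ∀ α γ, MvPowerSeries.pderiv ℂ (.inl α) (MvPowerSeries.pderiv ℂ (.inr γ) (F η)) =
      MvPowerSeries.C (e' α γ)) :
    MvPowerSeries.coeff a (vertexV 3 F C ξ η) = 4 * MvPowerSeries.coeff a
      (MvPowerSeries.C (e 1 1 * e' 0 1 - e 0 1 * e' 1 1) *
          MvPowerSeries.rescale dotWeight (MvPowerSeries.pderiv ℂ (.inr 0)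
            (MvPowerSeries.pderiv ℂ (.inr 0) C)) -
        MvPowerSeries.C ((e 1 1 * e' 0 0 - e 0 1 * e' 1 0) + (e 1 0 * e' 0 1 - e 0 0 * e' 1 1)) *
          MvPowerSeries.rescale dotWeight (MvPowerSeries.pderiv ℂ (.inr 0)
            (MvPowerSeries.pderiv ℂ (.inr 1) C)) +
        MvPowerSeries.C (e 1 0 * e' 0 0 - e 0 0 * e' 1 0) *
          MvPowerSeries.rescale dotWeight (MvPowerSeries.pderiv ℂ (.inr 1)
            (MvPowerSeries.pderiv ℂ (.inr 1) C))) := by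
  have hd : ∀ k, (subV (m := 1) 0 1 (args₂ 0 1 (F ξ) (F η) C) k a -
      subV (m := 1) 0 1 (args₂ 0 1 (F η) (F ξ) C) k a) +
      (subV (m := 1) 0 2 (args₂ 0 2 (F ξ) (F η) C) k a -
      subV (m := 1) 0 2 (args₂ 0 2 (F η) (F ξ) C) k a) +
      (subV (m := 1) 1 2 (args₂ 1 2 (F ξ) (F η) C) k a -
      subV (m := 1) 1 2 (args₂ 1 2 (F η) (F ξ) C) k a) =
      (subV (m := 1) 0 1 (args₂ 0 1 (F ξ) (F η) C) k a +
      subV (m := 1) 0 2 (args₂ 0 2 (F ξ) (F η) C) k a +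
      subV (m := 1) 1 2 (args₂ 1 2 (F ξ) (F η) C) k a) -
      (subV (m := 1) 0 1 (args₂ 0 1 (F η) (F ξ) C) k a +
      subV (m := 1) 0 2 (args₂ 0 2 (F η) (F ξ) C) k a +
      subV (m := 1) 1 2 (args₂ 1 2 (F η) (F ξ) C) k a) := fun k => by ring
  rw [map_add (MvPowerSeries.coeff a), map_sub (MvPowerSeries.coeff a), MvPowerSeries.coeff_C_mul,
    MvPowerSeries.coeff_C_mul, MvPowerSeries.coeff_C_mul]
  show ∑ i : Fin (1 + 2), ∑ j ∈ Finset.Ioi i, ((∑' k, subV i j (args₂ i j (F ξ) (F η) C) k a) -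
        ∑' k, subV i j (args₂ i j (F η) (F ξ) C) k a) = _
  have h0 : Finset.Ioi (0 : Fin (1 + 2)) = {1, 2} := by decide
  have h1 : Finset.Ioi (1 : Fin (1 + 2)) = {2} := by decide
  have h2 : Finset.Ioi (2 : Fin (1 + 2)) = ∅ := by decide
  have hs : ∀ {i j : Fin (1 + 2)}, i ≠ j → ∀ ξ η,
      Summable fun k => subV i j (args₂ i j (F ξ) (F η) C) k a :=
    fun hij ξ η => summable_subV hij (hF ξ) (hF η) hC a
  have n01 : (0 : Fin (1 + 2)) ≠ 1 := by decide
  have n02 : (0 : Fin (1 + 2)) ≠ 2 := by decide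
  have n12 : (1 : Fin (1 + 2)) ≠ 2 := by decide
  rw [sum_univ_one_add_two, h0, h1, h2, Finset.sum_pair (by decide), Finset.sum_singleton,
    Finset.sum_empty, add_zero, ← (hs n01 ξ η).tsum_sub (hs n01 η ξ),
    ← (hs n02 ξ η).tsum_sub (hs n02 η ξ), ← (hs n12 ξ η).tsum_sub (hs n12 η ξ),
    ← ((hs n01 ξ η).sub (hs n01 η ξ)).tsum_add ((hs n02 ξ η).sub (hs n02 η ξ)),
    ← (((hs n01 ξ η).sub (hs n01 η ξ)).add ((hs n02 ξ η).sub (hs n02 η ξ))).tsum_add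
      ((hs n12 ξ η).sub (hs n12 η ξ)), tsum_congr hd]
  refine tsum_factorial_shift_two (N := a.degree) ?_ ?_ fun k => ?_
  · rw [sum_subV_one, sum_subV_one]
    simp [cubicInt]
  · have y1 := sum_subV_one_succ (C := C) (hF ξ) (hF η) a 0
    have y2 := sum_subV_one_succ (C := C) (hF η) (hF ξ) a 0
    -- At this order no exponent is left, so the sign `s` is invisible and the sum is symmetric in
    -- the one-forms.
    have y3 : ∀ A B s, cubicRedInt A B C a s 0 = cubicRedInt A B C a 0 0 := by
      intro A B s
      simp only [cubicRedInt, pow_zero]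
    rw [y3, y3 (F η)] at y1
    rw [y3, y3 (F ξ)] at y2
    refine (congrArg₂ (· - ·) y1 y2).trans ?_
    ring
  · have x1 := cubicRedInt_sub (B := F η) (C := C) (hF ξ) a k
    have x2 := cubicRedInt_sub (B := F ξ) (C := C) (hF η) a k
    rw [cubicContr_swap] at x2
    have hk : ((k : ℂ) + 1) ≠ 0 := by exact_mod_cast k.succ_ne_zero
    have hk' : (k.factorial : ℂ) ≠ 0 := by exact_mod_cast k.factorial_ne_zero
    -- Regrouping by the order of the one-forms exposes two differences over the sign `s`, equal and
    -- opposite up to exchange. They add up to the coefficient four.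
    have hlhs : 2 * ((k + 1).factorial : ℂ)⁻¹ * (cubicRedInt (F ξ) (F η) C a 1 (k + 1) +
        cubicRedInt (F η) (F ξ) C a (-1) (k + 1)) - 2 * ((k + 1).factorial : ℂ)⁻¹ *
        (cubicRedInt (F η) (F ξ) C a 1 (k + 1) + cubicRedInt (F ξ) (F η) C a (-1) (k + 1)) =
        4 * (k.factorial : ℂ)⁻¹ * cubicContr (F ξ) (F η) C a k := by
      rw [Nat.factorial_succ]
      push_cast
      field_simp
      linear_combination 2 * x1 - 2 * x2
    rw [sum_subV_one_succ (hF ξ) (hF η), sum_subV_one_succ (hF η) (hF ξ), hlhs, cubicContr,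
      ← taylorSymb_cubic]
    -- Each bracket pairs complementary index values with alternating sign, hence the indices `1 -
    -- α`, `1 - γ`, `1 - δ`. The variables are ordered so that each one-form meets one undotted and
    -- one dotted derivative, leaving the constants `e` and `e'`.
    have hexp : ang (dSp 0) (dSp 1) * sqb (dSp 1) (dSp 2) * sqb (dSp 0) (dSp 2) *
        taylorSymb (n := 1 + 2) ![0, 0, dotWeight] ^ k =
        ∑ α : Fin 2, ∑ γ : Fin 2, ∑ δ : Fin 2, ((-1 : ℂ) ^ ((α : ℕ) + γ + δ + 1)) •
          (MvPolynomial.X (some 0, .inr γ) * (MvPolynomial.X (some 0, .inl α) *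
          (MvPolynomial.X (some 1, .inr δ) * (MvPolynomial.X (some 1, .inl (1 - α)) *
          (MvPolynomial.X (some 2, .inr (1 - δ)) * (MvPolynomial.X (some 2, .inr (1 - γ)) *
            taylorSymb (n := 1 + 2) ![0, 0, dotWeight] ^ k)))))) := by
      rw [sqb_dSp, sqb_dSp, ang_dSp]
      simp only [Fin.sum_univ_two, Fin.val_zero, Fin.val_one, sub_zero, sub_self]
      norm_num
      ring
    have hr0 : ∀ z : ℂ, MvPowerSeries.rescale (0 : Osc → ℂ) (MvPowerSeries.C z) =
        MvPowerSeries.C z := fun z => by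
      rw [MvPowerSeries.rescale_zero_apply, MvPowerSeries.constantCoeff_C]
    rw [hexp]
    simp only [map_sum, map_smul, actL_X_some_mul, actL_taylorSymb_pow, prod_univ_one_add_two,
      Function.update_self, Function.update_of_ne n01, Function.update_of_ne n01.symm,
      Function.update_of_ne n02, Function.update_of_ne n02.symm, Function.update_of_ne n12,
      Function.update_of_ne n12.symm, args₂_left, args₂_right n01, args₂_of_ne n02.symm n12.symm,
      he, he', Matrix.cons_val_zero, Matrix.cons_val_one, Matrix.cons_val, hr0]
    have hcomm : MvPowerSeries.pderiv ℂ (.inr 1) (MvPowerSeries.pderiv ℂ (.inr 0) C) =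
        MvPowerSeries.pderiv ℂ (.inr 0) (MvPowerSeries.pderiv ℂ (.inr 1) C) := by
      ext m
      simp only [MvPowerSeries.coeff_pderiv]
      rw [add_right_comm]
      simp [mul_right_comm]
    have hcc : ∀ (z w : ℂ) (G : GenFun), MvPowerSeries.coeff a (MvPowerSeries.C z *
        MvPowerSeries.C w * G) = z * w * MvPowerSeries.coeff a G := fun z w G => by
      rw [← map_mul, MvPowerSeries.coeff_C_mul]
    simp only [Fin.sum_univ_two, Fin.val_zero, Fin.val_one, sub_zero, sub_self, hcomm, hcc,
      smul_eq_mul]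
    generalize MvPowerSeries.coeff a (MvPowerSeries.rescale dotWeight (MvPowerSeries.pderiv ℂ
      (.inr 0) (MvPowerSeries.pderiv ℂ (.inr 0) C))) = G₀
    generalize MvPowerSeries.coeff a (MvPowerSeries.rescale dotWeight (MvPowerSeries.pderiv ℂ
      (.inr 0) (MvPowerSeries.pderiv ℂ (.inr 1) C))) = G₁
    generalize MvPowerSeries.coeff a (MvPowerSeries.rescale dotWeight (MvPowerSeries.pderiv ℂ
      (.inr 1) (MvPowerSeries.pderiv ℂ (.inr 1) C))) = G₂
    split_ifs
    · norm_num
      ring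
    · simp

end Cubic

/-! ### The deformed geometry -/

section Forms

theorem extd_add {α β : OneForm} {x : Spacetime} (hα : DifferentiableAt ℂ α x)
    (hβ : DifferentiableAt ℂ β x) (ξ η : Spacetime) :
    extd (fun z => α z + β z) x ξ η = extd α x ξ η + extd β x ξ η := by
  rw [extd, extd, extd, fderiv_fun_add hα hβ]
  simp only [add_apply]
  ring

theorem extd_sub {α β : OneForm} {x : Spacetime} (hα : DifferentiableAt ℂ α x)
    (hβ : DifferentiableAt ℂ β x) (ξ η : Spacetime) :
    extd (fun z => α z - β z) x ξ η = extd α x ξ η - extd β x ξ η := by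
  rw [extd, extd, extd, fderiv_fun_sub hα hβ]
  simp only [sub_apply]
  ring

theorem extd_smul {f : Spacetime → ℂ} {α : OneForm} {x : Spacetime} (hf : DifferentiableAt ℂ f x)
    (hα : DifferentiableAt ℂ α x) (ξ η : Spacetime) :
    extd (fun z => f z • α z) x ξ η =
      fderiv ℂ f x ξ * α x η - fderiv ℂ f x η * α x ξ + f x * extd α x ξ η := by
  rw [extd, extd, fderiv_fun_smul hf hα]
  simp only [add_apply, smul_apply, ContinuousLinearMap.smulRight_apply, smul_eq_mul]
  ring

theorem fderiv_eval {α : OneForm} {x : Spacetime} (hα : DifferentiableAt ℂ α x)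
    (ξ η : Spacetime) : fderiv ℂ (fun z => α z η) x ξ = fderiv ℂ α x ξ η := by
  rw [fderiv_clm_apply hα (differentiableAt_const η)]
  simp

theorem extd_congr {α β : OneForm} {x : Spacetime} (h : α =ᶠ[nhds x] β) (ξ η : Spacetime) :
    extd α x ξ η = extd β x ξ η := by
  rw [extd, extd, h.fderiv_eq]

/-- The differential of a function is closed. -/
theorem extd_fderiv {f : Spacetime → ℂ} {x : Spacetime} (hf : ContDiffAt ℂ ∞ f x)
    (ξ η : Spacetime) : extd (fderiv ℂ f) x ξ η = 0 := by
  rw [extd, sub_eq_zero]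
  have h2 : (2 : WithTop ℕ∞) ≤ ∞ := WithTop.coe_le_coe.2 le_top
  exact (hf.isSymmSndFDerivAt (by simpa using h2)) ξ η

end Forms

/-! ### Closed null forms, functions of the null directions, and the deformed structure equations.
-/

section Geometry

variable {U : Set Spacetime} {b : FlatBackground U}

theorem FlatBackground.smooth_viel (b : FlatBackground U) (α α' : Fin 2) :
    ContDiffOn ℂ ∞ (b.viel α α') U :=
  contDiffOn_const.clm_comp b.smooth_h

theorem FlatBackground.viel_apply (b : FlatBackground U) (α α' : Fin 2) (x ξ : Spacetime) :
    b.viel α α' x ξ = b.h x ξ α α' := rfl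

/-- Inversion is smooth near an invertible continuous linear map. -/
theorem FlatBackground.smooth_symm (hU : IsOpen U) (b : FlatBackground U) :
    ContDiffOn ℂ ∞ (fun x => ((b.h x).symm : (Fin 2 → Fin 2 → ℂ) →L[ℂ] Spacetime)) U := by
  intro x hx
  have h1 := (contDiffAt_map_inverse (𝕜 := ℂ) (n := ∞) (b.h x)).comp x
    (b.smooth_h.contDiffAt (hU.mem_nhds hx))
  refine ContDiffAt.contDiffWithinAt ?_
  convert h1 using 1
  funext z
  simp

/-- The components of `λ̃` with lower index. -/
def Dyad.lt (d : Dyad b) (α' : Fin 2) : Spacetime → ℂ := fun z => low (d.lamT z) α'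

theorem smooth_low {v : Spacetime → Fin 2 → ℂ} (h : ContDiffOn ℂ ∞ v U) (α : Fin 2) :
    ContDiffOn ℂ ∞ (fun z => low (v z) α) U := by
  have h' := contDiffOn_pi.1 h
  fin_cases α
  · exact (h' 1).neg
  · exact h' 0

theorem Dyad.smooth_lt (d : Dyad b) (α' : Fin 2) : ContDiffOn ℂ ∞ (d.lt α') U :=
  smooth_low d.smooth_lamT α'

theorem Dyad.lamT_zero (d : Dyad b) (x : Spacetime) : d.lamT x 0 = d.lt 1 x := rfl

theorem Dyad.lamT_one (d : Dyad b) (x : Spacetime) : d.lamT x 1 = -d.lt 0 x := by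
  simp [Dyad.lt, low]

theorem Dyad.fderiv_lt (d : Dyad b) {x : Spacetime} (hx : x ∈ U) (ξ : Spacetime) (α' : Fin 2) :
    fderiv ℂ (d.lt α') x ξ = b.wt α' 1 x ξ * d.lt 0 x - b.wt α' 0 x ξ * d.lt 1 x := by
  have h := d.const_lamT x hx ξ α'
  rw [Fin.sum_univ_two, d.lamT_zero, d.lamT_one] at h
  change fderiv ℂ (d.lt α') x ξ + _ = 0 at h
  linear_combination h

theorem low_single_zero : low (Pi.single 0 1) = ![0, 1] := by
  simp [low]

theorem low_single_one : low (Pi.single 1 1) = ![-1, 0] := by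
  simp [low]

/-- The closed one-forms `-λ̃^{α'} h_{αα'}`. -/
def Dyad.null (d : Dyad b) (α : Fin 2) : OneForm := fun x =>
  d.lt 0 x • b.viel α 1 x - d.lt 1 x • b.viel α 0 x

theorem Dyad.null_apply (d : Dyad b) (α : Fin 2) (x ξ : Spacetime) :
    d.null α x ξ = d.lt 0 x * b.viel α 1 x ξ - d.lt 1 x * b.viel α 0 x ξ := rfl

theorem Dyad.smooth_null (d : Dyad b) (α : Fin 2) : ContDiffOn ℂ ∞ (d.null α) U :=
  ((d.smooth_lt 0).smul (b.smooth_viel α 1)).sub ((d.smooth_lt 1).smul (b.smooth_viel α 0))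

theorem Dyad.ell_eq (d : Dyad b) :
    d.ell = fun x => (-d.lam 0) • d.null 0 x + (-d.lam 1) • d.null 1 x := by
  funext x
  simp only [Dyad.ell, Fin.sum_univ_two, d.lamT_zero, d.lamT_one, Dyad.null]
  module

theorem Dyad.smooth_ell (d : Dyad b) : ContDiffOn ℂ ∞ d.ell U := by
  rw [d.ell_eq]
  exact ((d.smooth_null 0).const_smul _).add ((d.smooth_null 1).const_smul _)

theorem differentiableAt_of_contDiffOn {E F : Type*} [NormedAddCommGroup E] [NormedSpace ℂ E]
    [NormedAddCommGroup F] [NormedSpace ℂ F] {s : Set E} (hs : IsOpen s) {f : E → F}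
    (hf : ContDiffOn ℂ ∞ f s) {x : E} (hx : x ∈ s) : DifferentiableAt ℂ f x :=
  (hf.contDiffAt (hs.mem_nhds hx)).differentiableAt (by simp)

theorem FlatBackground.extd_viel (b : FlatBackground U) {x : Spacetime} (hx : x ∈ U)
    (ξ η : Spacetime) (α α' : Fin 2) : extd (b.viel α α') x ξ η =
      -contrWedge (b.wt α') (b.viel α) x ξ η :=
  eq_neg_of_add_eq_zero_left (b.torsion x hx ξ η α α')

theorem FlatBackground.extd_w (b : FlatBackground U) {x : Spacetime} (hx : x ∈ U)
    (ξ η : Spacetime) (α β : Fin 2) : extd (b.w α β) x ξ η =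
      -contrWedge (b.viel α) (b.viel β) x ξ η :=
  eq_neg_of_add_eq_zero_left (b.curv_w x hx ξ η α β)

theorem FlatBackground.extd_wt (b : FlatBackground U) {x : Spacetime} (hx : x ∈ U)
    (ξ η : Spacetime) (α β : Fin 2) : extd (b.wt α β) x ξ η =
      -contrWedge (b.wt α) (b.wt β) x ξ η :=
  eq_neg_of_add_eq_zero_left (b.curv_wt x hx ξ η α β)

/-- The torsion constraint and the covariant constancy of `λ̃` produce the same connection terms,
which cancel by the symmetry of `ϖ̃`. Therefore `ell`, a constant combination of these forms, is
closed too. -/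
theorem Dyad.extd_null (hU : IsOpen U) (d : Dyad b) {x : Spacetime} (hx : x ∈ U)
    (ξ η : Spacetime) (α : Fin 2) : extd (d.null α) x ξ η = 0 := by
  have hl := fun α' => differentiableAt_of_contDiffOn hU (d.smooth_lt α') hx
  have hv := fun α' => differentiableAt_of_contDiffOn hU (b.smooth_viel α α') hx
  show extd (fun z => d.lt 0 z • b.viel α 1 z - d.lt 1 z • b.viel α 0 z) x ξ η = 0
  rw [extd_sub ((hl 0).fun_smul (hv 1)) ((hl 1).fun_smul (hv 0)), extd_smul (hl 0) (hv 1),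
    extd_smul (hl 1) (hv 0)]
  simp only [b.extd_viel hx, d.fderiv_lt hx, contrWedge, wedge, b.symm_wt 1 0]
  ring

theorem Dyad.extd_ell (hU : IsOpen U) (d : Dyad b) {x : Spacetime} (hx : x ∈ U)
    (ξ η : Spacetime) : extd d.ell x ξ η = 0 := by
  have hn := fun α => differentiableAt_of_contDiffOn hU (d.smooth_null α) hx
  rw [d.ell_eq, extd_add ((hn 0).fun_const_smul _) ((hn 1).fun_const_smul _),
    extd_smul (differentiableAt_const _) (hn 0), extd_smul (differentiableAt_const _) (hn 1),
    d.extd_null hU hx, d.extd_null hU hx]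
  simp

/-- The derivatives `D_α = μ̃^{α'} ∇_{αα'}`. -/
def Dyad.der (d : Dyad b) (α : Fin 2) (f : Spacetime → ℂ) : Spacetime → ℂ :=
  b.nabla (Pi.single α 1) d.muT f

theorem Dyad.normt_lt (d : Dyad b) {x : Spacetime} (hx : x ∈ U) :
    d.lt 0 x * low (d.muT x) 1 - d.lt 1 x * low (d.muT x) 0 = 1 := by
  have h := d.normt x hx
  rw [Fin.sum_univ_two] at h
  simp only [low, Matrix.cons_val_zero, Matrix.cons_val_one, Dyad.lt] at h ⊢
  linear_combination h

/-- Smooth functions with vanishing derivatives along `λ̃`. -/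
structure Dyad.Admissible (d : Dyad b) (f : Spacetime → ℂ) : Prop where
  smooth : ContDiffOn ℂ ∞ f U
  lamT_indep : ∀ x ∈ U, ∀ v : Fin 2 → ℂ,
    fderiv ℂ f x ((b.h x).symm fun α α' => v α * low (d.lamT x) α') = 0

theorem Dyad.null_symm (d : Dyad b) (x : Spacetime) (v : Fin 2 → ℂ) (τ : Fin 2 → ℂ) (α : Fin 2) :
    d.null α x ((b.h x).symm fun α α' => v α * low τ α') =
      v α * (d.lt 0 x * low τ 1 - d.lt 1 x * low τ 0) := by
  rw [d.null_apply, b.viel_apply, b.viel_apply, ContinuousLinearEquiv.apply_symm_apply]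
  ring

/-- Completeness of the dyad `λ̃, μ̃`: a vector splits into a part along `λ̃`, invisible to
admissible functions, and a part along `μ̃` measured by the null forms. -/
theorem Dyad.decompose (d : Dyad b) {x : Spacetime} (hx : x ∈ U) (ξ : Spacetime) :
    ξ = (b.h x).symm (fun α α' => (d.muT x 0 * b.viel α 0 x ξ + d.muT x 1 * b.viel α 1 x ξ) *
        low (d.lamT x) α') +
      (d.null 1 x ξ • (b.h x).symm (fun α α' => low (Pi.single 0 1) α * low (d.muT x) α') -
        d.null 0 x ξ • (b.h x).symm (fun α α' => low (Pi.single 1 1) α * low (d.muT x) α')) := by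
  apply (b.h x).injective
  rw [map_add, map_sub, map_smul, map_smul, ContinuousLinearEquiv.apply_symm_apply,
    ContinuousLinearEquiv.apply_symm_apply, ContinuousLinearEquiv.apply_symm_apply]
  have h := d.normt_lt hx
  funext α α'
  simp only [Pi.add_apply, Pi.sub_apply, Pi.smul_apply, smul_eq_mul, d.null_apply, b.viel_apply]
  simp only [low, Dyad.lt] at h ⊢
  fin_cases α <;> fin_cases α' <;> simp at h ⊢
  · linear_combination (-b.h x ξ 0 0) * h
  · linear_combination (-b.h x ξ 0 1) * h
  · linear_combination (-b.h x ξ 1 0) * h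
  · linear_combination (-b.h x ξ 1 1) * h

variable {d : Dyad b} {f : Spacetime → ℂ}

theorem Dyad.Admissible.fderiv_apply (hf : d.Admissible f) {x : Spacetime} (hx : x ∈ U)
    (ξ : Spacetime) : fderiv ℂ f x ξ = d.der 0 f x * d.null 1 x ξ - d.der 1 f x * d.null 0 x ξ := by
  conv_lhs => rw [d.decompose hx ξ]
  rw [map_add, map_sub, map_smul, map_smul, hf.lamT_indep x hx]
  simp only [Dyad.der, FlatBackground.nabla, smul_eq_mul]
  ring

theorem smooth_nabla (hU : IsOpen U) (hf : ContDiffOn ℂ ∞ f U) (κ : Fin 2 → ℂ)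
    {τ : Spacetime → Fin 2 → ℂ} (hτ : ContDiffOn ℂ ∞ τ U) :
    ContDiffOn ℂ ∞ (b.nabla κ τ f) U := by
  have h1 : ContDiffOn ℂ ∞ (fun x => fderiv ℂ f x) U := hf.fderiv_of_isOpen hU (by simp)
  refine h1.clm_apply ((b.smooth_symm hU).clm_apply ?_)
  refine contDiffOn_pi.2 fun α => contDiffOn_pi.2 fun α' => ?_
  exact contDiffOn_const.mul (smooth_low hτ α')

theorem smooth_der (hU : IsOpen U) (hf : ContDiffOn ℂ ∞ f U) (α : Fin 2) :
    ContDiffOn ℂ ∞ (d.der α f) U :=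
  smooth_nabla hU hf _ d.smooth_muT

/-- The integrability condition of the derivatives of an admissible function. -/
theorem Dyad.Admissible.integrability (hU : IsOpen U) (hf : d.Admissible f) {x : Spacetime}
    (hx : x ∈ U) (ξ η : Spacetime) :
    fderiv ℂ (d.der 0 f) x ξ * d.null 1 x η - fderiv ℂ (d.der 0 f) x η * d.null 1 x ξ -
      (fderiv ℂ (d.der 1 f) x ξ * d.null 0 x η - fderiv ℂ (d.der 1 f) x η * d.null 0 x ξ) = 0 := by
  have hn := fun α => differentiableAt_of_contDiffOn hU (d.smooth_null α) hx
  have hD := fun α => differentiableAt_of_contDiffOn hU (smooth_der (d := d) hU hf.smooth α) hx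
  have h1 : fderiv ℂ f =ᶠ[nhds x]
      fun z => d.der 0 f z • d.null 1 z - d.der 1 f z • d.null 0 z := by
    filter_upwards [hU.mem_nhds hx] with z hz
    ext1 ξ
    rw [hf.fderiv_apply hz]
    rfl
  have h2 := extd_fderiv (hf.smooth.contDiffAt (hU.mem_nhds hx)) ξ η
  rw [extd_congr h1, extd_sub ((hD 0).fun_smul (hn 1)) ((hD 1).fun_smul (hn 0)), extd_smul (hD 0) (hn 1),
    extd_smul (hD 1) (hn 0), d.extd_null hU hx, d.extd_null hU hx] at h2
  linear_combination h2

theorem Dyad.null_lamT (d : Dyad b) (x : Spacetime) (v : Fin 2 → ℂ) (α : Fin 2) :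
    d.null α x ((b.h x).symm fun α α' => v α * low (d.lamT x) α') = 0 := by
  rw [d.null_symm]
  simp only [Dyad.lt]
  ring

theorem Dyad.null_muT (d : Dyad b) {x : Spacetime} (hx : x ∈ U) (v : Fin 2 → ℂ) (α : Fin 2) :
    d.null α x ((b.h x).symm fun α α' => v α * low (d.muT x) α') = v α := by
  rw [d.null_symm, d.normt_lt hx, mul_one]

/-- In the integrability condition one vector is taken along `λ̃`, where the null forms vanish, and
the other along `μ̃`, chosen to pick out a single null form. -/
theorem Dyad.Admissible.der (hU : IsOpen U) (hf : d.Admissible f) (α : Fin 2) :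
    d.Admissible (d.der α f) := by
  refine ⟨smooth_der hU hf.smooth α, fun x hx v => ?_⟩
  have h := hf.integrability hU hx ((b.h x).symm fun α α' => v α * low (d.lamT x) α')
  fin_cases α
  · have h' := h ((b.h x).symm fun α α' => low (Pi.single 0 1) α * low (d.muT x) α')
    simp only [d.null_lamT, d.null_muT hx] at h'
    simpa [low_single_zero, low_single_one] using h'
  · have h' := h ((b.h x).symm fun α α' => low (Pi.single 1 1) α * low (d.muT x) α')
    simp only [d.null_lamT, d.null_muT hx] at h'
    simpa [low_single_zero, low_single_one] using h'

/-- The integrability condition evaluated on the two `μ̃`-directions. -/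
theorem Dyad.Admissible.der_comm (hU : IsOpen U) (hf : d.Admissible f) {x : Spacetime}
    (hx : x ∈ U) : d.der 0 (d.der 1 f) x = d.der 1 (d.der 0 f) x := by
  have h := hf.integrability hU hx
    ((b.h x).symm fun α α' => low (Pi.single 0 1) α * low (d.muT x) α')
    ((b.h x).symm fun α α' => low (Pi.single 1 1) α * low (d.muT x) α')
  rw [d.null_muT hx, d.null_muT hx, d.null_muT hx, d.null_muT hx] at h
  change d.der 0 (d.der 0 f) x * _ - d.der 1 (d.der 0 f) x * _ -
    (d.der 0 (d.der 1 f) x * _ - d.der 1 (d.der 1 f) x * _) = 0 at h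
  simp [low] at h
  linear_combination h

theorem nabla_lam (κ : Fin 2 → ℂ) (f : Spacetime → ℂ) (x : Spacetime) :
    b.nabla κ d.muT f x = κ 0 * d.der 0 f x + κ 1 * d.der 1 f x := by
  simp only [Dyad.der, FlatBackground.nabla]
  have h : (fun α α' => low κ α * low (d.muT x) α') =
      κ 0 • (fun α α' => low (Pi.single 0 1) α * low (d.muT x) α') +
      κ 1 • (fun α α' => low (Pi.single 1 1) α * low (d.muT x) α') := by
    funext α α'
    fin_cases α <;> simp [low_single_zero, low_single_one] <;> simp [low]
  rw [h, map_add, map_smul, map_smul, map_add, map_smul, map_smul, smul_eq_mul, smul_eq_mul]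

theorem Dyad.Admissible.nabla (hU : IsOpen U) (hf : d.Admissible f) (κ : Fin 2 → ℂ) :
    d.Admissible (b.nabla κ d.muT f) := by
  have h : b.nabla κ d.muT f = fun x => κ 0 * d.der 0 f x + κ 1 * d.der 1 f x :=
    funext fun x => nabla_lam κ f x
  refine ⟨smooth_nabla hU hf.smooth κ d.smooth_muT, fun x hx v => ?_⟩
  have hD := fun α => differentiableAt_of_contDiffOn hU (smooth_der (d := d) hU hf.smooth α) hx
  rw [h, fderiv_fun_add ((hD 0).const_mul _) ((hD 1).const_mul _), fderiv_const_mul (hD 0),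
    fderiv_const_mul (hD 1)]
  simp [(hf.der hU 0).lamT_indep x hx, (hf.der hU 1).lamT_indep x hx]

theorem Dyad.Admissible.iterate_nabla (hU : IsOpen U) (hf : d.Admissible f) (κ : Fin 2 → ℂ)
    (k : ℕ) : d.Admissible ((b.nabla κ d.muT)^[k] f) := by
  induction k with
  | zero => exact hf
  | succ k ih => rw [Function.iterate_succ_apply']; exact ih.nabla hU κ

/-- Any undotted spinor is a combination of `λ` and `μ`, so the derivatives along `λ̃` reduce to
those along `ℓ` and `p̃`, which the profile conditions set to zero. -/
theorem IsProfile.admissible {H₂ : Spacetime → ℂ} (hH : IsProfile d H₂) : d.Admissible H₂ := by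
  refine ⟨hH.smooth, fun x hx v => ?_⟩
  have h1 := hH.u_indep x hx
  have h2 := hH.selfDual x hx
  have hn := d.norm
  rw [Fin.sum_univ_two] at hn
  have hv : (fun α α' => v α * low (d.lamT x) α') =
      (∑ α, d.mu α * v α) • (fun α α' => low d.lam α * low (d.lamT x) α') -
      (∑ α, d.lam α * v α) • (fun α α' => low d.mu α * low (d.lamT x) α') := by
    funext α α'
    simp only [Fin.sum_univ_two, Pi.sub_apply, Pi.smul_apply, smul_eq_mul, ← mul_assoc, ← sub_mul]
    congr 1
    simp only [low] at hn ⊢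
    fin_cases α <;> simp at hn ⊢
    · linear_combination (-v 0) * hn
    · linear_combination (-v 1) * hn
  rw [hv, map_sub, map_smul, map_smul, map_sub, map_smul, map_smul]
  rw [FlatBackground.nabla] at h1 h2
  rw [h1, h2]
  simp

theorem IsProfile.admissible_lamDeriv (hU : IsOpen U) {H₂ : Spacetime → ℂ} (hH : IsProfile d H₂)
    (k : ℕ) : d.Admissible (d.lamDeriv k H₂) :=
  hH.admissible.iterate_nabla hU _ k

theorem Dyad.lamDeriv_succ (k : ℕ) (H₂ : Spacetime → ℂ) (x : Spacetime) :
    d.lamDeriv (k + 1) H₂ x =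
      d.lam 0 * d.der 0 (d.lamDeriv k H₂) x + d.lam 1 * d.der 1 (d.lamDeriv k H₂) x := by
  rw [Dyad.lamDeriv, Function.iterate_succ_apply', nabla_lam]
  rfl

theorem Dyad.ell_apply (x ξ : Spacetime) :
    d.ell x ξ = -(d.lam 0 * d.null 0 x ξ + d.lam 1 * d.null 1 x ξ) := by
  rw [d.ell_eq]
  simp
  ring

/-- `dH_2^{(k)} ∧ ⟨λ|h|λ]`, where `H_2^{(k)}` is the `k`-th derivative along `λ`. -/
theorem wedge_fderiv_lamDeriv (hU : IsOpen U) {H₂ : Spacetime → ℂ} (hH : IsProfile d H₂) (k : ℕ)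
    {x : Spacetime} (hx : x ∈ U) (ξ η : Spacetime) :
    fderiv ℂ (d.lamDeriv k H₂) x ξ * d.ell x η - fderiv ℂ (d.lamDeriv k H₂) x η * d.ell x ξ =
      -(d.lamDeriv (k + 1) H₂ x * wedge (d.null 1) (d.null 0) x ξ η) := by
  have hk := hH.admissible_lamDeriv hU k
  rw [hk.fderiv_apply hx, hk.fderiv_apply hx, d.lamDeriv_succ, d.ell_apply, d.ell_apply, wedge]
  ring

theorem wedge_ell_null (d : Dyad b) (α : Fin 2) (x ξ η : Spacetime) :
    wedge d.ell (d.null α) x ξ η = low d.lam α * wedge (d.null 1) (d.null 0) x ξ η := by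
  simp only [wedge, d.ell_apply]
  fin_cases α <;> simp [low] <;> ring

variable {H₂ : Spacetime → ℂ}

theorem Dyad.boldE_apply (α α' : Fin 2) (x ξ : Spacetime) : d.boldE H₂ α α' x ξ =
    b.viel α α' x ξ + d.lamDeriv 1 H₂ x * low d.lam α * d.lt α' x * d.ell x ξ := rfl

theorem Dyad.boldWt_apply (α' β' : Fin 2) (x ξ : Spacetime) : d.boldWt H₂ α' β' x ξ =
    b.wt α' β' x ξ + d.lamDeriv 2 H₂ x * d.lt α' x * d.lt β' x * d.ell x ξ := rfl

theorem differentiableAt_boldW (hU : IsOpen U) (hH : IsProfile d H₂) {x : Spacetime} (hx : x ∈ U)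
    (α β : Fin 2) : DifferentiableAt ℂ (d.boldW H₂ α β) x :=
  (differentiableAt_of_contDiffOn hU (b.smooth_w α β) hx).add
    (((((differentiableAt_of_contDiffOn hU hH.smooth hx).const_mul 2).mul_const _).mul_const
      _).smul (differentiableAt_of_contDiffOn hU d.smooth_ell hx))

theorem differentiableAt_boldE (hU : IsOpen U) (hH : IsProfile d H₂) {x : Spacetime} (hx : x ∈ U)
    (α α' : Fin 2) : DifferentiableAt ℂ (d.boldE H₂ α α') x :=
  (differentiableAt_of_contDiffOn hU (b.smooth_viel α α') hx).add
    ((((differentiableAt_of_contDiffOn hU (hH.admissible_lamDeriv hU 1).smooth hx).mul_const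
      _).mul (differentiableAt_of_contDiffOn hU (d.smooth_lt α') hx)).smul
        (differentiableAt_of_contDiffOn hU d.smooth_ell hx))

theorem differentiableAt_boldWt (hU : IsOpen U) (hH : IsProfile d H₂) {x : Spacetime} (hx : x ∈ U)
    (α' β' : Fin 2) : DifferentiableAt ℂ (d.boldWt H₂ α' β') x :=
  (differentiableAt_of_contDiffOn hU (b.smooth_wt α' β') hx).add
    ((((differentiableAt_of_contDiffOn hU (hH.admissible_lamDeriv hU 2).smooth hx).mul
      (differentiableAt_of_contDiffOn hU (d.smooth_lt α') hx)).mul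
        (differentiableAt_of_contDiffOn hU (d.smooth_lt β') hx)).smul
          (differentiableAt_of_contDiffOn hU d.smooth_ell hx))

/-- As `ell` is closed, the deformation contributes only `dH₂ ∧ ell`, a multiple of the product of
the null forms. The deformation of the vierbein contributes matching terms `ell ∧ null`. Terms
quadratic in the deformation vanish. -/
theorem extd_boldW (hU : IsOpen U) (hH : IsProfile d H₂) {x : Spacetime} (hx : x ∈ U)
    (ξ η : Spacetime) (α β : Fin 2) : extd (d.boldW H₂ α β) x ξ η =
      -contrWedge (d.boldE H₂ α) (d.boldE H₂ β) x ξ η := by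
  have hw := differentiableAt_of_contDiffOn hU (b.smooth_w α β) hx
  have hl := differentiableAt_of_contDiffOn hU d.smooth_ell hx
  have hs := differentiableAt_of_contDiffOn hU hH.smooth hx
  have hs' : DifferentiableAt ℂ (fun z => 2 * H₂ z * low d.lam α * low d.lam β) x :=
    ((hs.const_mul _).mul_const _).mul_const _
  have hd : ∀ ξ, fderiv ℂ (fun z => 2 * H₂ z * low d.lam α * low d.lam β) x ξ =
      2 * fderiv ℂ H₂ x ξ * low d.lam α * low d.lam β := by
    intro ξ
    rw [fderiv_mul_const ((hs.const_mul _).mul_const _), fderiv_mul_const (hs.const_mul _),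
      fderiv_const_mul hs]
    simp only [smul_apply, smul_eq_mul]
    ring
  have hk : fderiv ℂ H₂ x ξ * d.ell x η - fderiv ℂ H₂ x η * d.ell x ξ =
      -(d.lamDeriv 1 H₂ x * wedge (d.null 1) (d.null 0) x ξ η) :=
    wedge_fderiv_lamDeriv hU hH 0 hx ξ η
  have h1 := wedge_ell_null d α x ξ η
  have h2 := wedge_ell_null d β x ξ η
  show extd (fun z => b.w α β z + (2 * H₂ z * low d.lam α * low d.lam β) • d.ell z) x ξ η = _
  rw [extd_add hw (hs'.fun_smul hl), extd_smul hs' hl, d.extd_ell hU hx, b.extd_w hx, hd, hd]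
  generalize wedge (d.null 1) (d.null 0) x ξ η = W at *
  simp only [contrWedge, wedge, d.boldE_apply, d.null_apply] at hk h1 h2 ⊢
  linear_combination 2 * low d.lam α * low d.lam β * hk +
    d.lamDeriv 1 H₂ x * low d.lam α * h2 + d.lamDeriv 1 H₂ x * low d.lam β * h1

theorem extd_boldE (hU : IsOpen U) (hH : IsProfile d H₂) {x : Spacetime} (hx : x ∈ U)
    (ξ η : Spacetime) (α α' : Fin 2) : extd (d.boldE H₂ α α') x ξ η =
      -contrWedge (d.boldWt H₂ α') (d.boldE H₂ α) x ξ η := by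
  have hw := differentiableAt_of_contDiffOn hU (b.smooth_viel α α') hx
  have hl := differentiableAt_of_contDiffOn hU d.smooth_ell hx
  have hs := differentiableAt_of_contDiffOn hU (hH.admissible_lamDeriv hU 1).smooth hx
  have ht := differentiableAt_of_contDiffOn hU (d.smooth_lt α') hx
  have hs' : DifferentiableAt ℂ (fun z => d.lamDeriv 1 H₂ z * low d.lam α * d.lt α' z) x :=
    (hs.mul_const _).mul ht
  have hd : ∀ ξ, fderiv ℂ (fun z => d.lamDeriv 1 H₂ z * low d.lam α * d.lt α' z) x ξ =
      fderiv ℂ (d.lamDeriv 1 H₂) x ξ * low d.lam α * d.lt α' x + d.lamDeriv 1 H₂ x * low d.lam α *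
        fderiv ℂ (d.lt α') x ξ := by
    intro ξ
    rw [fderiv_fun_mul (hs.mul_const _) ht, fderiv_mul_const hs]
    simp only [add_apply, smul_apply, smul_eq_mul]
    ring
  have hk := wedge_fderiv_lamDeriv hU hH 1 hx ξ η
  have h1 := wedge_ell_null d α x ξ η
  show extd (fun z => b.viel α α' z + (d.lamDeriv 1 H₂ z * low d.lam α * d.lt α' z) •
    d.ell z) x ξ η = _
  rw [extd_add hw (hs'.fun_smul hl), extd_smul hs' hl, d.extd_ell hU hx, b.extd_viel hx, hd, hd,
    d.fderiv_lt hx, d.fderiv_lt hx]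
  generalize wedge (d.null 1) (d.null 0) x ξ η = W at *
  simp only [contrWedge, wedge, d.boldE_apply, d.boldWt_apply, d.null_apply] at hk h1 ⊢
  linear_combination low d.lam α * d.lt α' x * hk + d.lamDeriv 2 H₂ x * d.lt α' x * h1

/-- The same computation, but contracting the deformation with itself gives nothing to absorb `d
(lamDeriv 2 H₂) ∧ ell`. This leftover is the curvature that the cubic vertex has to source. -/
theorem extd_boldWt (hU : IsOpen U) (hH : IsProfile d H₂) {x : Spacetime} (hx : x ∈ U)
    (ξ η : Spacetime) (α' β' : Fin 2) : extd (d.boldWt H₂ α' β') x ξ η =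
      -contrWedge (d.boldWt H₂ α') (d.boldWt H₂ β') x ξ η -
        d.lamDeriv 3 H₂ x * d.lt α' x * d.lt β' x * wedge (d.null 1) (d.null 0) x ξ η := by
  have hw := differentiableAt_of_contDiffOn hU (b.smooth_wt α' β') hx
  have hl := differentiableAt_of_contDiffOn hU d.smooth_ell hx
  have hs := differentiableAt_of_contDiffOn hU (hH.admissible_lamDeriv hU 2).smooth hx
  have ht := fun α' => differentiableAt_of_contDiffOn hU (d.smooth_lt α') hx
  have hs' : DifferentiableAt ℂ (fun z => d.lamDeriv 2 H₂ z * d.lt α' z * d.lt β' z) x :=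
    (hs.mul (ht _)).mul (ht _)
  have hd : ∀ ξ, fderiv ℂ (fun z => d.lamDeriv 2 H₂ z * d.lt α' z * d.lt β' z) x ξ =
      fderiv ℂ (d.lamDeriv 2 H₂) x ξ * d.lt α' x * d.lt β' x + d.lamDeriv 2 H₂ x *
        (fderiv ℂ (d.lt α') x ξ * d.lt β' x + d.lt α' x * fderiv ℂ (d.lt β') x ξ) := by
    intro ξ
    rw [fderiv_fun_mul (hs.fun_mul (ht _)) (ht _), fderiv_fun_mul hs (ht _)]
    simp only [add_apply, smul_apply, smul_eq_mul]
    ring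
  have hk := wedge_fderiv_lamDeriv hU hH 2 hx ξ η
  show extd (fun z => b.wt α' β' z + (d.lamDeriv 2 H₂ z * d.lt α' z * d.lt β' z) •
    d.ell z) x ξ η = _
  rw [extd_add hw (hs'.fun_smul hl), extd_smul hs' hl, d.extd_ell hU hx, b.extd_wt hx, hd, hd,
    d.fderiv_lt hx, d.fderiv_lt hx, d.fderiv_lt hx, d.fderiv_lt hx]
  generalize wedge (d.null 1) (d.null 0) x ξ η = W at *
  simp only [contrWedge, wedge, d.boldWt_apply] at hk ⊢
  linear_combination d.lt α' x * d.lt β' x * hk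

end Geometry

/-! ### The zero-form of positive helicity -/

section Helicity

/-- The generating function of components `F_{α(k)} p_{α'(n+k)}`, where `F k l` is the component
with `k` indices `0` and `l` indices `1`. -/
def helicitySeries (n : ℕ) (F : ℕ → ℕ → ℂ) (p : Fin 2 → ℂ) : GenFun := fun a =>
  if degD a = n + degU a then
    (∏ s, ((a s).factorial : ℂ))⁻¹ *
      (F (a (.inl 0)) (a (.inl 1)) * p 0 ^ a (.inr 0) * p 1 ^ a (.inr 1))
  else 0

variable (n : ℕ) (F : ℕ → ℕ → ℂ) (p : Fin 2 → ℂ)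

theorem coeff_helicitySeries (a : Osc →₀ ℕ) : MvPowerSeries.coeff a (helicitySeries n F p) =
    if degD a = n + degU a then (∏ s, ((a s).factorial : ℂ))⁻¹ *
      (F (a (.inl 0)) (a (.inl 1)) * p 0 ^ a (.inr 0) * p 1 ^ a (.inr 1)) else 0 := rfl

theorem prod_factorial_add_single (a : Osc →₀ ℕ) (s : Osc) :
    ∏ t, (((a + Finsupp.single s 1 : Osc →₀ ℕ) t).factorial : ℂ) =
      (∏ t, ((a t).factorial : ℂ)) * (a s + 1) := by
  rcases s with s | s <;> fin_cases s <;>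
  · simp [Fintype.prod_sum_type, Fin.prod_univ_two, Nat.factorial_succ]
    ring

theorem prod_factorial_ne_zero (a : Osc →₀ ℕ) : ∏ t, ((a t).factorial : ℂ) ≠ 0 :=
  Finset.prod_ne_zero_iff.2 fun t _ => by exact_mod_cast (a t).factorial_ne_zero

theorem inv_prod_factorial_add_single (a : Osc →₀ ℕ) (s : Osc) :
    (∏ t, (((a + Finsupp.single s 1 : Osc →₀ ℕ) t).factorial : ℂ))⁻¹ * (a s + 1) =
      (∏ t, ((a t).factorial : ℂ))⁻¹ := by
  have h1 := prod_factorial_ne_zero a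
  have h2 : (a s : ℂ) + 1 ≠ 0 := by exact_mod_cast (a s).succ_ne_zero
  rw [prod_factorial_add_single]
  field_simp

/-- All dotted indices sit on powers of `p`, so a dotted derivative strips one factor of `p` and
lowers the helicity offset. The undotted derivatives below instead shift the components and raise
the offset. -/
theorem pderiv_inr_helicitySeries (γ : Fin 2) :
    MvPowerSeries.pderiv ℂ (.inr γ) (helicitySeries (n + 1) F p) =
      p γ • helicitySeries n F p := by
  ext a
  have h := inv_prod_factorial_add_single a (.inr γ)
  rw [map_smul, MvPowerSeries.coeff_pderiv, coeff_helicitySeries, coeff_helicitySeries]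
  have hd : degD (a + Finsupp.single (.inr γ) 1) = degD a + 1 := by
    fin_cases γ <;> simp [degD] <;> omega
  have hu : degU (a + Finsupp.single (.inr γ) 1) = degU a := by
    simp [degU]
  rw [hd, hu]
  by_cases hc : degD a = n + degU a
  · rw [if_pos (by omega), if_pos hc, ← h]
    fin_cases γ <;> simp [pow_succ] <;> ring
  · rw [if_neg (by omega), if_neg hc]
    simp

theorem pderiv_inl_zero_helicitySeries :
    MvPowerSeries.pderiv ℂ (.inl 0) (helicitySeries n F p) =
      helicitySeries (n + 1) (fun k l => F (k + 1) l) p := by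
  ext a
  have h := inv_prod_factorial_add_single a (.inl 0)
  rw [MvPowerSeries.coeff_pderiv, coeff_helicitySeries, coeff_helicitySeries]
  have hd : degD (a + Finsupp.single (.inl 0) 1) = degD a := by simp [degD]
  have hu : degU (a + Finsupp.single (.inl 0) 1) = degU a + 1 := by
    simp [degU]; omega
  rw [hd, hu]
  by_cases hc : degD a = n + 1 + degU a
  · rw [if_pos (by omega), if_pos hc, ← h]
    simp
    ring
  · rw [if_neg (by omega), if_neg hc, zero_mul]

theorem pderiv_inl_one_helicitySeries :
    MvPowerSeries.pderiv ℂ (.inl 1) (helicitySeries n F p) =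
      helicitySeries (n + 1) (fun k l => F k (l + 1)) p := by
  ext a
  have h := inv_prod_factorial_add_single a (.inl 1)
  rw [MvPowerSeries.coeff_pderiv, coeff_helicitySeries, coeff_helicitySeries]
  have hd : degD (a + Finsupp.single (.inl 1) 1) = degD a := by simp [degD]
  have hu : degU (a + Finsupp.single (.inl 1) 1) = degU a + 1 := by
    simp [degU]; omega
  rw [hd, hu]
  by_cases hc : degD a = n + 1 + degU a
  · rw [if_pos (by omega), if_pos hc, ← h]
    simp
    ring
  · rw [if_neg (by omega), if_neg hc, zero_mul]

theorem coeff_X_mul_zero (s : Osc) {a : Osc →₀ ℕ} (ha : a s = 0) (f : GenFun) :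
    MvPowerSeries.coeff a (MvPowerSeries.X s * f) = 0 := by
  rw [MvPowerSeries.X, MvPowerSeries.coeff_monomial_mul, if_neg]
  intro h
  have := h s
  simp [ha] at this

theorem coeff_X_mul_add_single (s : Osc) (a : Osc →₀ ℕ) (f : GenFun) :
    MvPowerSeries.coeff (a + Finsupp.single s 1) (MvPowerSeries.X s * f) =
      MvPowerSeries.coeff a f := by
  rw [MvPowerSeries.X, add_comm, MvPowerSeries.coeff_add_monomial_mul, one_mul]

theorem eq_add_single {s : Osc} {a : Osc →₀ ℕ} (ha : a s ≠ 0) :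
    ∃ m, a = m + Finsupp.single s 1 :=
  ⟨a - Finsupp.single s 1, (tsub_add_cancel_of_le (by
    rw [Finsupp.single_le_iff]; omega)).symm⟩

/-- Written so as to match the derivative of `p γ ^ k`. When the exponent is zero the truncated
power is harmless, because its prefactor vanishes. -/
theorem coeff_X_inr_mul_helicitySeries (γ : Fin 2) (a : Osc →₀ ℕ) :
    MvPowerSeries.coeff a (MvPowerSeries.X (.inr γ) * helicitySeries n F p) =
    if degD a = n + 1 + degU a then (∏ s, ((a s).factorial : ℂ))⁻¹ *
      (F (a (.inl 0)) (a (.inl 1)) * (a (.inr γ) * p γ ^ (a (.inr γ) - 1)) *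
        p (1 - γ) ^ a (.inr (1 - γ))) else 0 := by
  by_cases ha : a (.inr γ) = 0
  · rw [coeff_X_mul_zero _ ha, ha]
    simp
  · obtain ⟨m, rfl⟩ := eq_add_single ha
    have h := inv_prod_factorial_add_single m (.inr γ)
    rw [coeff_X_mul_add_single, coeff_helicitySeries]
    have hd : degD (m + Finsupp.single (.inr γ) 1) = degD m + 1 := by
      fin_cases γ <;> simp [degD] <;> omega
    have hu : degU (m + Finsupp.single (.inr γ) 1) = degU m := by
      simp [degU]
    rw [hd, hu]
    by_cases hc : degD m = n + degU m
    · rw [if_pos hc, if_pos (by omega), ← h]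
      fin_cases γ <;> simp <;> ring
    · rw [if_neg hc, if_neg (by omega)]

theorem coeff_monomials (k l n : ℕ) (a : Osc →₀ ℕ) :
    MvPowerSeries.coeff a (MvPowerSeries.X (.inl 0) ^ k * MvPowerSeries.X (.inl 1) ^ l *
      (∑ γ, p γ • MvPowerSeries.X (.inr γ)) ^ n : GenFun) =
    if a (.inl 0) = k ∧ a (.inl 1) = l ∧ degD a = n then
      (n.factorial : ℂ) * ((a (.inr 0)).factorial * (a (.inr 1)).factorial : ℂ)⁻¹ *
        (p 0 ^ a (.inr 0) * p 1 ^ a (.inr 1)) else 0 := by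
  have hexp : (MvPowerSeries.X (.inl 0) ^ k * MvPowerSeries.X (.inl 1) ^ l *
      (∑ γ, p γ • MvPowerSeries.X (.inr γ)) ^ n : GenFun) =
      ∑ i ∈ Finset.range (n + 1), (p 0 ^ i * p 1 ^ (n - i) * (n.choose i : ℂ)) •
        MvPowerSeries.monomial (Finsupp.single (.inl 0) k + Finsupp.single (.inl 1) l +
          (Finsupp.single (.inr 0) i + Finsupp.single (.inr 1) (n - i))) (1 : ℂ) := by
    rw [Fin.sum_univ_two, add_pow, Finset.mul_sum]
    refine Finset.sum_congr rfl fun i _ => ?_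
    have hm : MvPowerSeries.monomial (Finsupp.single (.inl 0) k + Finsupp.single (.inl 1) l +
          (Finsupp.single (.inr 0) i + Finsupp.single (.inr 1) (n - i))) (1 : ℂ) =
        (MvPowerSeries.X (.inl 0) ^ k * MvPowerSeries.X (.inl 1) ^ l *
          (MvPowerSeries.X (.inr 0) ^ i * MvPowerSeries.X (.inr 1) ^ (n - i)) : GenFun) := by
      simp only [MvPowerSeries.X_pow_eq, MvPowerSeries.monomial_mul_monomial, mul_one]
    rw [hm, smul_pow, smul_pow, smul_mul_smul_comm, MvPowerSeries.smul_eq_C_mul,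
      MvPowerSeries.smul_eq_C_mul, map_mul _ _ (n.choose i : ℂ), map_natCast]
    ring
  rw [hexp, map_sum]
  simp only [map_smul, MvPowerSeries.coeff_monomial, smul_eq_mul, mul_ite, mul_one, mul_zero]
  by_cases hc : a (.inl 0) = k ∧ a (.inl 1) = l ∧ degD a = n
  · obtain ⟨h0, h1, h2⟩ := hc
    have hle : a (.inr 0) ≤ n := by rw [← h2]; exact Nat.le_add_right _ _
    have hsub : n - a (.inr 0) = a (.inr 1) := by rw [← h2]; exact Nat.add_sub_cancel_left _ _
    rw [Finset.sum_eq_single (a (.inr 0)), if_pos, if_pos ⟨h0, h1, h2⟩, Nat.choose_eq_factorial_div_factorial hle, hsub]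
    · rw [Nat.cast_div, Nat.cast_mul, div_eq_mul_inv]
      · ring
      · rw [← hsub]; exact Nat.factorial_mul_factorial_dvd_factorial hle
      · exact_mod_cast mul_ne_zero (Nat.factorial_ne_zero _) (Nat.factorial_ne_zero _)
    · rw [hsub]
      ext s
      rcases s with s | s <;> fin_cases s <;> simp [h0, h1]
    · intro i _ hi
      rw [if_neg]
      rintro rfl
      simp at hi
    · intro h
      exact absurd (Finset.mem_range.2 (by omega)) h
  · rw [if_neg hc]
    refine Finset.sum_eq_zero fun i hi => ?_
    have hi' := Finset.mem_range.1 hi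
    rw [if_neg]
    rintro rfl
    refine hc ⟨by simp, by simp, ?_⟩
    simp [degD]
    omega

theorem ySqb_eq (τ : Fin 2 → ℂ) :
    ySqb τ = ∑ γ, low τ γ • (MvPowerSeries.X (.inr γ) : GenFun) := rfl

theorem hasSubst_undotted (τ : Fin 2 → ℂ) :
    MvPowerSeries.HasSubst
      ![(MvPowerSeries.X (.inl 0) : GenFun), MvPowerSeries.X (.inl 1), ySqb τ] := by
  refine MvPowerSeries.hasSubst_of_constantCoeff_zero fun s => ?_
  fin_cases s <;> simp [ySqb, MvPowerSeries.smul_eq_C_mul]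

/-- The power series in `y^0, y^1, [y τ]` that represents `helicitySeries`. -/
def undottedSeries : MvPowerSeries (Fin 3) ℂ := fun e =>
  if e 2 = n + (e 0 + e 1) then
    ((e 0).factorial * (e 1).factorial * (e 2).factorial : ℂ)⁻¹ * F (e 0) (e 1) else 0

theorem coeff_undottedSeries (e : Fin 3 →₀ ℕ) : MvPowerSeries.coeff e (undottedSeries n F) =
    if e 2 = n + (e 0 + e 1) then
      ((e 0).factorial * (e 1).factorial * (e 2).factorial : ℂ)⁻¹ * F (e 0) (e 1) else 0 := rfl

/-- For a given output monomial only one exponent contributes, and its factorial `(e 2)!` cancels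
the one from expanding the power of the linear form. -/
theorem helicitySeries_eq_subst (τ : Fin 2 → ℂ) : helicitySeries n F (low τ) =
    MvPowerSeries.subst ![(MvPowerSeries.X (.inl 0) : GenFun), MvPowerSeries.X (.inl 1), ySqb τ]
      (undottedSeries n F) := by
  ext a
  rw [MvPowerSeries.coeff_subst (hasSubst_undotted τ)]
  have hprod : ∀ e : Fin 3 →₀ ℕ, (e.prod fun s k => (![(MvPowerSeries.X (.inl 0) : GenFun),
      MvPowerSeries.X (.inl 1), ySqb τ] s) ^ k) = MvPowerSeries.X (.inl 0) ^ e 0 *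
        MvPowerSeries.X (.inl 1) ^ e 1 * (∑ γ, low τ γ • MvPowerSeries.X (.inr γ)) ^ e 2 := by
    intro e
    rw [Finsupp.prod_fintype _ _ (fun i => pow_zero _), Fin.prod_univ_three]
    rfl
  simp only [hprod, coeff_monomials]
  let e₀ : Fin 3 →₀ ℕ := Finsupp.equivFunOnFinite.symm ![a (.inl 0), a (.inl 1), degD a]
  rw [finsum_eq_single _ e₀]
  · have h0 : e₀ 0 = a (.inl 0) := rfl
    have h1 : e₀ 1 = a (.inl 1) := rfl
    have h2 : e₀ 2 = degD a := rfl
    rw [h0, h1, h2, if_pos ⟨rfl, rfl, rfl⟩, coeff_helicitySeries, coeff_undottedSeries,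
      h0, h1, h2]
    have hf : ∀ k : ℕ, (k.factorial : ℂ) ≠ 0 := fun k => by exact_mod_cast k.factorial_ne_zero
    split_ifs with h h' h'
    · rw [Fintype.prod_sum_type, Fin.prod_univ_two, Fin.prod_univ_two, smul_eq_mul]
      field_simp [hf]
    · exact absurd h h'
    · exact absurd h' h
    · rw [zero_smul]
  · intro e he
    rw [if_neg, smul_zero]
    rintro ⟨h0, h1, h2⟩
    refine he ?_
    ext s
    fin_cases s
    · exact h0.symm
    · exact h1.symm
    · exact h2.symm

theorem rescale_dotWeight_helicitySeries (τ : Fin 2 → ℂ) :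
    MvPowerSeries.rescale dotWeight (helicitySeries n F (low τ)) =
      ((n.factorial : ℂ)⁻¹ * F 0 0) • ySqb τ ^ n := by
  ext a
  have h := coeff_monomials (low τ) 0 0 n a
  rw [pow_zero, pow_zero, one_mul, one_mul, ← ySqb_eq] at h
  rw [map_smul, h, MvPowerSeries.coeff_rescale, coeff_helicitySeries,
    Finsupp.prod_fintype _ _ (fun i => pow_zero _), Fintype.prod_sum_type, Fin.prod_univ_two,
    Fin.prod_univ_two]
  have hf : ∀ k : ℕ, (k.factorial : ℂ) ≠ 0 := fun k => by exact_mod_cast k.factorial_ne_zero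
  by_cases h0 : a (.inl 0) = 0
  · by_cases h1 : a (.inl 1) = 0
    · rw [Fintype.prod_sum_type, Fin.prod_univ_two, Fin.prod_univ_two]
      simp only [dotWeight, Sum.elim_inl, Sum.elim_inr, Pi.one_apply, h0, h1, degU, pow_zero,
        one_pow, one_mul, add_zero, true_and, Nat.factorial_zero, Nat.cast_one]
      split_ifs
      · rw [smul_eq_mul]
        field_simp [hf]
      · simp
    · simp [dotWeight, h1]
  · simp [dotWeight, h0]

end Helicity

/-! ### The exact solution -/

section ExactSolution

variable {U : Set Spacetime} {b : FlatBackground U} {d : Dyad b} {H₂ : Spacetime → ℂ}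

/-- A linear change of variables: the normalisation `⟨μ λ⟩ = 1` gives `y^α = μ^α ⟨y λ⟩ - λ^α ⟨y μ⟩`.
-/
theorem exists_subst_dyad (d : Dyad b) (τ : Fin 2 → ℂ) (n : ℕ) (F : ℕ → ℕ → ℂ) :
    ∃ G : MvPowerSeries (Fin 3) ℂ, helicitySeries n F (low τ) =
      MvPowerSeries.subst ![yAng d.lam, yAng d.mu, ySqb τ] G := by
  let v : Fin 3 → MvPowerSeries (Fin 3) ℂ :=
    ![d.mu 0 • MvPowerSeries.X 0 - d.lam 0 • MvPowerSeries.X 1,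
      d.mu 1 • MvPowerSeries.X 0 - d.lam 1 • MvPowerSeries.X 1, MvPowerSeries.X 2]
  have hv : MvPowerSeries.HasSubst v := by
    refine MvPowerSeries.hasSubst_of_constantCoeff_zero fun s => ?_
    fin_cases s <;> simp [v, MvPowerSeries.smul_eq_C_mul]
  have hw := hasSubst_dyad d.lam d.mu τ
  have hn := d.norm
  rw [Fin.sum_univ_two] at hn
  simp only [low, Matrix.cons_val_zero, Matrix.cons_val_one] at hn
  refine ⟨MvPowerSeries.subst v (undottedSeries n F), ?_⟩
  rw [MvPowerSeries.subst_comp_subst_apply hv hw, helicitySeries_eq_subst]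
  congr 1
  funext s
  fin_cases s
  · show MvPowerSeries.X (.inl 0) = MvPowerSeries.subst ![yAng d.lam, yAng d.mu, ySqb τ]
      (d.mu 0 • MvPowerSeries.X 0 - d.lam 0 • MvPowerSeries.X 1)
    rw [MvPowerSeries.subst_sub hw, MvPowerSeries.subst_smul hw, MvPowerSeries.subst_smul hw,
      MvPowerSeries.subst_X hw, MvPowerSeries.subst_X hw]
    simp only [yAng, Fin.sum_univ_two, low, Matrix.cons_val_zero, Matrix.cons_val_one]
    match_scalars
    · linear_combination -hn
    · ring
  · show MvPowerSeries.X (.inl 1) = MvPowerSeries.subst ![yAng d.lam, yAng d.mu, ySqb τ]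
      (d.mu 1 • MvPowerSeries.X 0 - d.lam 1 • MvPowerSeries.X 1)
    rw [MvPowerSeries.subst_sub hw, MvPowerSeries.subst_smul hw, MvPowerSeries.subst_smul hw,
      MvPowerSeries.subst_X hw, MvPowerSeries.subst_X hw]
    simp only [yAng, Fin.sum_univ_two, low, Matrix.cons_val_zero, Matrix.cons_val_one]
    match_scalars
    · linear_combination -hn
    · ring
  · show ySqb τ = MvPowerSeries.subst ![yAng d.lam, yAng d.mu, ySqb τ] (MvPowerSeries.X 2)
    rw [MvPowerSeries.subst_X hw]
    rfl

/-- The components of the positive-helicity zero-form, up to the factors `λ̃`. -/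
def Dyad.comp (d : Dyad b) (H₂ : Spacetime → ℂ) (k l : ℕ) : Spacetime → ℂ :=
  (d.der 0)^[k] ((d.der 1)^[l] (d.lamDeriv 3 H₂))

theorem Dyad.Cplus_eq (x : Spacetime) : d.Cplus H₂ x =
    helicitySeries 4 (fun k l => -(1 / 2) * d.comp H₂ k l x) (low (d.lamT x)) := rfl

theorem hasSpinTwoForm_Cplus_add {B : Spacetime → GenFun} (hB : d.HasSpinTwoForm B) :
    d.HasSpinTwoForm (fun x => d.Cplus H₂ x + B x) := by
  obtain ⟨G, hG⟩ := hB
  choose G' hG' using fun x => exists_subst_dyad d (d.lamT x) 4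
    (fun k l => -(1 / 2) * d.comp H₂ k l x)
  refine ⟨fun x => G' x + G x, fun x hx => ?_⟩
  rw [MvPowerSeries.subst_add (hasSubst_dyad _ _ _), ← hG x hx, ← hG']
  rfl

theorem admissible_comp (hU : IsOpen U) (hH : IsProfile d H₂) (k l : ℕ) :
    d.Admissible (d.comp H₂ k l) :=
  ((hH.admissible_lamDeriv hU 3).iterate_nabla hU _ l).iterate_nabla hU _ k

theorem der_congr (hU : IsOpen U) {f g : Spacetime → ℂ} (h : Set.EqOn f g U) (α : Fin 2) :
    Set.EqOn (d.der α f) (d.der α g) U := by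
  intro x hx
  have hfg : f =ᶠ[nhds x] g := by
    filter_upwards [hU.mem_nhds hx] with z hz using h hz
  simp only [Dyad.der, FlatBackground.nabla, hfg.fderiv_eq]

theorem der_zero_comp (k l : ℕ) : d.der 0 (d.comp H₂ k l) = d.comp H₂ (k + 1) l :=
  (Function.iterate_succ_apply' _ _ _).symm

/-- A derivative `D_1` moves through the `D_0` already applied because derivatives of admissible
functions commute. This is known on `U` only, hence the restricted equality. -/
theorem der_one_comp (hU : IsOpen U) (hH : IsProfile d H₂) (k l : ℕ) :
    Set.EqOn (d.der 1 (d.comp H₂ k l)) (d.comp H₂ k (l + 1)) U := by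
  induction k with
  | zero =>
    intro x _
    exact (congrFun (Function.iterate_succ_apply' (d.der 1) l (d.lamDeriv 3 H₂)) x).symm
  | succ k ih =>
    intro x hx
    rw [← der_zero_comp, ← der_zero_comp, ← (admissible_comp hU hH k l).der_comm hU hx]
    exact der_congr hU ih 0 hx

theorem hasFDerivAt_coeff_Cplus (hU : IsOpen U) (hH : IsProfile d H₂) {x : Spacetime}
    (hx : x ∈ U) (a : Osc →₀ ℕ) :
    DifferentiableAt ℂ (fun z => MvPowerSeries.coeff a (d.Cplus H₂ z)) x ∧
    ∀ ξ, fderiv ℂ (fun z => MvPowerSeries.coeff a (d.Cplus H₂ z)) x ξ =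
      if degD a = 4 + degU a then (∏ s, ((a s).factorial : ℂ))⁻¹ * (-(1 / 2)) *
        (fderiv ℂ (d.comp H₂ (a (.inl 0)) (a (.inl 1))) x ξ * d.lt 0 x ^ a (.inr 0) *
          d.lt 1 x ^ a (.inr 1) + d.comp H₂ (a (.inl 0)) (a (.inl 1)) x *
          (a (.inr 0) * d.lt 0 x ^ (a (.inr 0) - 1) * fderiv ℂ (d.lt 0) x ξ *
            d.lt 1 x ^ a (.inr 1) + a (.inr 1) * d.lt 1 x ^ (a (.inr 1) - 1) *
              fderiv ℂ (d.lt 1) x ξ * d.lt 0 x ^ a (.inr 0))) else 0 := by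
  by_cases hc : degD a = 4 + degU a
  · have hf := (differentiableAt_of_contDiffOn hU
      (admissible_comp hU hH (a (.inl 0)) (a (.inl 1))).smooth hx).hasFDerivAt
    have hl := fun α' => (differentiableAt_of_contDiffOn hU (d.smooth_lt α') hx).hasFDerivAt
    have h := (((hf.const_mul (-(1 / 2))).fun_mul ((hl 0).pow (a (.inr 0)))).fun_mul
      ((hl 1).pow (a (.inr 1)))).const_mul (∏ s, ((a s).factorial : ℂ))⁻¹
    have hfun : (fun z => MvPowerSeries.coeff a (d.Cplus H₂ z)) = fun z =>
        (∏ s, ((a s).factorial : ℂ))⁻¹ * (-(1 / 2) * d.comp H₂ (a (.inl 0)) (a (.inl 1)) z *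
          d.lt 0 z ^ a (.inr 0) * d.lt 1 z ^ a (.inr 1)) := by
      funext z
      rw [d.Cplus_eq, coeff_helicitySeries, if_pos hc]
      rfl
    rw [hfun]
    refine ⟨h.differentiableAt, fun ξ => ?_⟩
    rw [HasFDerivAt.fderiv h, if_pos hc]
    simp
    ring
  · have hfun : (fun z => MvPowerSeries.coeff a (d.Cplus H₂ z)) = fun _ => 0 := by
      funext z
      rw [d.Cplus_eq, coeff_helicitySeries, if_neg hc]
    rw [hfun]
    refine ⟨differentiableAt_const _, fun ξ => ?_⟩
    rw [if_neg hc]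
    simp

/-- The deformation is proportional to `λ̃_{α'}`, so contracting with `λ̃` removes it. Hence the
positive-helicity equations see only the flat background. -/
theorem boldE_contr (α : Fin 2) (x ξ : Spacetime) :
    d.boldE H₂ α 0 x ξ * d.lt 1 x - d.boldE H₂ α 1 x ξ * d.lt 0 x = -d.null α x ξ := by
  rw [d.boldE_apply, d.boldE_apply, d.null_apply]
  ring

theorem boldWt_contr {x : Spacetime} (hx : x ∈ U) (γ : Fin 2) (ξ : Spacetime) :
    d.boldWt H₂ γ 0 x ξ * d.lt 1 x - d.boldWt H₂ γ 1 x ξ * d.lt 0 x =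
      -fderiv ℂ (d.lt γ) x ξ := by
  rw [d.boldWt_apply, d.boldWt_apply, d.fderiv_lt hx]
  ring

theorem translation_add (x ξ : Spacetime) (f g : GenFun) :
    d.translation H₂ x ξ (f + g) = d.translation H₂ x ξ f + d.translation H₂ x ξ g := by
  simp only [Dyad.translation, map_add, smul_add]
  abel

theorem rotation_add (x ξ : Spacetime) (f g : GenFun) :
    d.rotation H₂ x ξ (f + g) = d.rotation H₂ x ξ f + d.rotation H₂ x ξ g := by
  simp only [Dyad.rotation, map_add, smul_add, Fin.sum_univ_two]
  ring

/-- The linear equations of the positive-helicity zero-form. -/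
theorem linear_Cplus (hU : IsOpen U) (hH : IsProfile d H₂) {x : Spacetime} (hx : x ∈ U)
    (ξ : Spacetime) (a : Osc →₀ ℕ) :
    fderiv ℂ (fun z => MvPowerSeries.coeff a (d.Cplus H₂ z)) x ξ +
      MvPowerSeries.coeff a (d.rotation H₂ x ξ (d.Cplus H₂ x)) =
        MvPowerSeries.coeff a (d.translation H₂ x ξ (d.Cplus H₂ x)) := by
  set F : ℕ → ℕ → ℂ := fun k l => -(1 / 2) * d.comp H₂ k l x with hF
  set S := helicitySeries 3 F (low (d.lamT x)) with hS
  have hp : ∀ γ, MvPowerSeries.pderiv ℂ (.inr γ) (d.Cplus H₂ x) = d.lt γ x • S := fun γ => by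
    rw [d.Cplus_eq, pderiv_inr_helicitySeries]
    rfl
  -- This term cancels the part of the differential in which `λ̃` is differentiated.
  have hrot : d.rotation H₂ x ξ (d.Cplus H₂ x) =
      ∑ γ, (-fderiv ℂ (d.lt γ) x ξ) • (MvPowerSeries.X (.inr γ) * S) := by
    rw [Dyad.rotation]
    refine Finset.sum_congr rfl fun γ _ => ?_
    rw [hp, hp, smul_smul, smul_smul, ← sub_smul, boldWt_contr hx, mul_smul_comm]
  -- The undotted derivatives weighted by the null forms are the expansion of the differential of an
  -- admissible component.
  have htr : d.translation H₂ x ξ (d.Cplus H₂ x) =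
      d.null 1 x ξ • MvPowerSeries.pderiv ℂ (.inl 0) S -
        d.null 0 x ξ • MvPowerSeries.pderiv ℂ (.inl 1) S := by
    have h0 := boldE_contr (d := d) (H₂ := H₂) 0 x ξ
    have h1 := boldE_contr (d := d) (H₂ := H₂) 1 x ξ
    rw [Dyad.translation, hp, hp]
    simp only [Derivation.map_smul]
    match_scalars
    · linear_combination h0
    · linear_combination -h1
  have hf := (admissible_comp hU hH (a (.inl 0)) (a (.inl 1))).fderiv_apply hx ξ
  have h1 := der_one_comp hU hH (a (.inl 0)) (a (.inl 1)) hx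
  rw [der_zero_comp, h1] at hf
  rw [(hasFDerivAt_coeff_Cplus hU hH hx a).2, hrot, htr, Fin.sum_univ_two, map_add, map_sub,
    map_smul, map_smul, map_smul, map_smul, coeff_X_inr_mul_helicitySeries,
    coeff_X_inr_mul_helicitySeries, pderiv_inl_zero_helicitySeries, pderiv_inl_one_helicitySeries,
    coeff_helicitySeries, coeff_helicitySeries, hf]
  by_cases hc : degD a = 4 + degU a
  · rw [if_pos hc, if_pos hc, if_pos hc, if_pos hc, if_pos hc]
    have hlt : ∀ α', low (d.lamT x) α' = d.lt α' x := fun _ => rfl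
    simp only [hF, smul_eq_mul, sub_zero, sub_self, hlt]
    ring
  · rw [if_neg hc, if_neg hc, if_neg hc, if_neg hc, if_neg hc]
    simp

/-- Every monomial has four more undotted than dotted oscillators, so none survives at vanishing
undotted oscillators. Negative helicity therefore does not enter the cubic vertex. -/
theorem rescale_dotWeight_negHelicity {ψ₂ : Spacetime → ℂ} {B : Spacetime → GenFun}
    (hB : IsNegHelicity d H₂ ψ₂ B) {x : Spacetime} (hx : x ∈ U) :
    MvPowerSeries.rescale dotWeight (B x) = 0 := by
  ext a
  rw [MvPowerSeries.coeff_rescale, Finsupp.prod_fintype _ _ (fun i => pow_zero _),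
    Fintype.prod_sum_type, Fin.prod_univ_two, map_zero]
  by_cases h0 : a (.inl 0) = 0
  · by_cases h1 : a (.inl 1) = 0
    · rw [hB.content x hx a (by simp only [degU, h0, h1]; omega), mul_zero]
    · simp [dotWeight, h1]
  · simp [dotWeight, h0]

theorem rescale_pderiv_inr (γ : Fin 2) (f : GenFun) :
    MvPowerSeries.rescale dotWeight (MvPowerSeries.pderiv ℂ (.inr γ) f) =
      MvPowerSeries.pderiv ℂ (.inr γ) (MvPowerSeries.rescale dotWeight f) := by
  rw [pderiv_rescale, dotWeight, Sum.elim_inr, Pi.one_apply, one_smul]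

theorem pderiv_pderiv_ySqb_pow (τ : Fin 2 → ℂ) (γ δ : Fin 2) :
    MvPowerSeries.pderiv ℂ (.inr γ) (MvPowerSeries.pderiv ℂ (.inr δ) (ySqb τ ^ 4)) =
      (12 * low τ γ * low τ δ) • ySqb τ ^ 2 := by
  have h12 : (MvPowerSeries.C 12 : GenFun) = 12 := map_ofNat _ 12
  rw [Derivation.leibniz_pow, pderiv_inr_ySqb]
  simp only [Derivation.leibniz, Derivation.leibniz_pow, pderiv_inr_ySqb,
    smul_eq_mul, MvPowerSeries.smul_eq_C_mul, map_mul, map_nsmul, h12]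
  simp
  ring

/-- Terms with two dotted derivatives of the zero-form, as they enter the cubic vertex. -/
theorem rescale_pderiv_pderiv {ψ₂ : Spacetime → ℂ} {B : Spacetime → GenFun}
    (hB : IsNegHelicity d H₂ ψ₂ B) {x : Spacetime} (hx : x ∈ U) (γ δ : Fin 2) :
    MvPowerSeries.rescale dotWeight (MvPowerSeries.pderiv ℂ (.inr γ)
      (MvPowerSeries.pderiv ℂ (.inr δ) (d.Cplus H₂ x + B x))) =
      (-(1 / 4) * d.lamDeriv 3 H₂ x * d.lt γ x * d.lt δ x) • ySqb (d.lamT x) ^ 2 := by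
  rw [rescale_pderiv_inr, rescale_pderiv_inr, map_add, rescale_dotWeight_negHelicity hB hx,
    add_zero, d.Cplus_eq, rescale_dotWeight_helicitySeries, Derivation.map_smul,
    Derivation.map_smul, pderiv_pderiv_ySqb_pow, smul_smul]
  congr 1
  have h : d.comp H₂ 0 0 x = d.lamDeriv 3 H₂ x := rfl
  have hf : ((4 : ℕ).factorial : ℂ) = 24 := by norm_num [Nat.factorial]
  rw [h, hf]
  simp only [Dyad.lt]
  ring

theorem coeff_quadForm (a : Osc →₀ ℕ) (w e wt : Fin 2 → Fin 2 → ℂ) :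
    MvPowerSeries.coeff a (quadForm w e wt) =
    (1 / 4 : ℂ) * (∑ α, ∑ β, w α β *
      MvPowerSeries.coeff a (MvPowerSeries.X (.inl α) * MvPowerSeries.X (.inl β) : GenFun)) +
    (1 / 2 : ℂ) * (∑ α, ∑ α', e α α' *
      MvPowerSeries.coeff a (MvPowerSeries.X (.inl α) * MvPowerSeries.X (.inr α') : GenFun)) +
    (1 / 4 : ℂ) * (∑ α', ∑ β', wt α' β' *
      MvPowerSeries.coeff a (MvPowerSeries.X (.inr α') * MvPowerSeries.X (.inr β') : GenFun)) := by
  simp only [quadForm, map_add, map_smul, map_sum, smul_eq_mul]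

theorem hasFDerivAt_coeff_quadForm {w e wt : Fin 2 → Fin 2 → Spacetime → ℂ} {x : Spacetime}
    (hw : ∀ α β, DifferentiableAt ℂ (w α β) x) (he : ∀ α β, DifferentiableAt ℂ (e α β) x)
    (hwt : ∀ α β, DifferentiableAt ℂ (wt α β) x) (a : Osc →₀ ℕ) :
    DifferentiableAt ℂ (fun z => MvPowerSeries.coeff a (quadForm (fun α β => w α β z)
      (fun α β => e α β z) (fun α β => wt α β z))) x ∧
    ∀ ξ, fderiv ℂ (fun z => MvPowerSeries.coeff a (quadForm (fun α β => w α β z)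
      (fun α β => e α β z) (fun α β => wt α β z))) x ξ =
        MvPowerSeries.coeff a (quadForm (fun α β => fderiv ℂ (w α β) x ξ)
          (fun α β => fderiv ℂ (e α β) x ξ) (fun α β => fderiv ℂ (wt α β) x ξ)) := by
  have hs : ∀ {f : Fin 2 → Fin 2 → Spacetime → ℂ} (_ : ∀ α β, DifferentiableAt ℂ (f α β) x)
      (c : Fin 2 → Fin 2 → ℂ) (r : ℂ), HasFDerivAt (fun z => r * ∑ α, ∑ β, f α β z * c α β)
        (r • ∑ α, ∑ β, c α β • fderiv ℂ (f α β) x) x := fun hf c r =>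
    (HasFDerivAt.fun_sum fun α _ => HasFDerivAt.fun_sum fun β _ =>
      (hf α β).hasFDerivAt.mul_const (c α β)).const_mul r
  have h := ((hs hw (fun α β => MvPowerSeries.coeff a
      (MvPowerSeries.X (.inl α) * MvPowerSeries.X (.inl β) : GenFun)) (1 / 4)).fun_add
    (hs he (fun α β => MvPowerSeries.coeff a
      (MvPowerSeries.X (.inl α) * MvPowerSeries.X (.inr β) : GenFun)) (1 / 2))).fun_add
    (hs hwt (fun α β => MvPowerSeries.coeff a
      (MvPowerSeries.X (.inr α) * MvPowerSeries.X (.inr β) : GenFun)) (1 / 4))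
  simp only [coeff_quadForm]
  refine ⟨h.differentiableAt, fun ξ => ?_⟩
  rw [h.fderiv]
  simp only [add_apply, smul_apply, smul_eq_mul, mul_comm,
    Fin.sum_univ_two]

/-- The dotted Poisson bracket of quadratic forms encodes the quadratic right-hand sides of the
three structure equations. -/
theorem quadForm_commutator {w e t w' e' t' : Fin 2 → Fin 2 → ℂ} (ht : t 1 0 = t 0 1)
    (ht' : t' 1 0 = t' 0 1) :
    (2 : ℂ) • (MvPowerSeries.pderiv ℂ (.inr 1) (quadForm w e t) *
        MvPowerSeries.pderiv ℂ (.inr 0) (quadForm w' e' t') -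
      MvPowerSeries.pderiv ℂ (.inr 0) (quadForm w e t) *
        MvPowerSeries.pderiv ℂ (.inr 1) (quadForm w' e' t')) =
    quadForm
      (fun α β => -((e α 0 * e' β 1 - e' α 0 * e β 1) - (e α 1 * e' β 0 - e' α 1 * e β 0)))
      (fun α β => -((t β 0 * e' α 1 - t' β 0 * e α 1) - (t β 1 * e' α 0 - t' β 1 * e α 0)))
      (fun α β => -((t α 0 * t' β 1 - t' α 0 * t β 1) - (t α 1 * t' β 0 - t' α 1 * t β 0))) := by
  rw [pderiv_inr_quadForm w e ht, pderiv_inr_quadForm w e ht, pderiv_inr_quadForm w' e' ht',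
    pderiv_inr_quadForm w' e' ht', quadForm]
  simp only [Fin.sum_univ_two, ht, ht']
  generalize (MvPowerSeries.X (.inl 0) : GenFun) = y₀
  generalize (MvPowerSeries.X (.inl 1) : GenFun) = y₁
  generalize (MvPowerSeries.X (.inr 0) : GenFun) = z₀
  generalize (MvPowerSeries.X (.inr 1) : GenFun) = z₁
  algebra

theorem symm_boldWt (x ξ : Spacetime) : d.boldWt H₂ 1 0 x ξ = d.boldWt H₂ 0 1 x ξ := by
  rw [d.boldWt_apply, d.boldWt_apply, b.symm_wt 1 0]
  ring

theorem rescale_C (w : Osc → ℂ) (z : ℂ) :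
    MvPowerSeries.rescale w (MvPowerSeries.C z) = MvPowerSeries.C z := by
  ext m
  rw [MvPowerSeries.coeff_rescale, MvPowerSeries.coeff_C]
  split_ifs with h
  · simp [h]
  · simp

theorem rescale_X (w : Osc → ℂ) (s : Osc) :
    MvPowerSeries.rescale w (MvPowerSeries.X s) = w s • (MvPowerSeries.X s : GenFun) := by
  ext m
  rw [map_smul, MvPowerSeries.coeff_rescale, MvPowerSeries.coeff_X, smul_eq_mul]
  split_ifs with h
  · simp [h]
  · simp

/-- The quadratic vertex with a single one-form, on the spin-2 sector. -/
theorem coeff_vertexU_two_Omega {C : GenFun} {c : Fin 2 → ℂ} (hC : DottedForm c C)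
    (x ξ : Spacetime) (a : Osc →₀ ℕ) :
    MvPowerSeries.coeff a (vertexU 2 (d.Omega H₂ x) C ξ) =
      MvPowerSeries.coeff a (d.translation H₂ x ξ C) -
        MvPowerSeries.coeff a (d.rotation H₂ x ξ C) := by
  have hs := symm_boldWt (d := d) (H₂ := H₂) x ξ
  -- Setting the undotted oscillators to zero removes the vierbein term of the first derivative, so
  -- this contribution is a pure rotation.
  have hr : ∀ γ, MvPowerSeries.rescale dotWeight (MvPowerSeries.pderiv ℂ (.inr γ)
      (d.Omega H₂ x ξ)) = (1 / 2 : ℂ) • ∑ β, d.boldWt H₂ γ β x ξ •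
        (MvPowerSeries.X (.inr β) : GenFun) := by
    intro γ
    rw [Omega_apply, pderiv_inr_quadForm _ _ (wt := fun α β => d.boldWt H₂ α β x ξ) hs]
    simp only [MvPowerSeries.smul_eq_C_mul, map_add, map_mul, map_sum, rescale_C, rescale_X]
    simp [dotWeight]
  rw [coeff_vertexU_two _ (isQuadratic_Omega x) hC, hr, hr]
  simp only [Omega_apply, pderiv_inl_inr_quadForm _ _ (wt := fun α β => d.boldWt H₂ α β x ξ) hs,
    rescale_C, Dyad.translation, Dyad.rotation, Fin.sum_univ_two, hs]
  have h2 : ∀ f : GenFun, 2 * MvPowerSeries.coeff a f = MvPowerSeries.coeff a ((2 : ℂ) • f) :=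
    fun f => by rw [map_smul, smul_eq_mul]
  rw [h2, h2, ← map_sub (MvPowerSeries.coeff a), ← map_add (MvPowerSeries.coeff a)]
  congr 1
  simp only [← MvPowerSeries.smul_eq_C_mul]
  algebra

theorem quadForm_sub (w e t : Fin 2 → Fin 2 → ℂ) (z : ℂ) (τ : Fin 2 → ℂ) :
    quadForm w e (fun α β => t α β - z * low τ α * low τ β) =
      quadForm w e t - (1 / 4 * z) • ySqb τ ^ 2 := by
  simp only [quadForm, ySqb, Fin.sum_univ_two]
  generalize (MvPowerSeries.X (.inl 0) : GenFun) = y₀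
  generalize (MvPowerSeries.X (.inl 1) : GenFun) = y₁
  generalize (MvPowerSeries.X (.inr 0) : GenFun) = z₀
  generalize (MvPowerSeries.X (.inr 1) : GenFun) = z₁
  algebra

/-- The first equation of motion on the spin-2 sector. -/
theorem coeff_vertexV_Omega (hU : IsOpen U) (hH : IsProfile d H₂) {ψ₂ : Spacetime → ℂ}
    {B : Spacetime → GenFun} (hB : IsNegHelicity d H₂ ψ₂ B) {x : Spacetime} (hx : x ∈ U)
    (ξ η : Spacetime) (a : Osc →₀ ℕ) :
    MvPowerSeries.coeff a (vertexV 2 (d.Omega H₂ x) (d.Cplus H₂ x + B x) ξ η) +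
      MvPowerSeries.coeff a (vertexV 3 (d.Omega H₂ x) (d.Cplus H₂ x + B x) ξ η) =
    MvPowerSeries.coeff a (quadForm (fun α β => extd (d.boldW H₂ α β) x ξ η)
      (fun α β => extd (d.boldE H₂ α β) x ξ η) (fun α β => extd (d.boldWt H₂ α β) x ξ η)) := by
  have hC := (hasSpinTwoForm_Cplus_add (H₂ := H₂) hB.form).dottedForm hx
  have hs := fun ξ => symm_boldWt (d := d) (H₂ := H₂) x ξ
  rw [coeff_vertexV_two _ (isQuadratic_Omega x) hC,
    coeff_vertexV_three _ (isQuadratic_Omega x) hC ξ η a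
      (fun α γ => by
        rw [Omega_apply]
        exact pderiv_inl_inr_quadForm _ _ (wt := fun α β => d.boldWt H₂ α β x ξ) (hs ξ) α γ)
      (fun α γ => by
        rw [Omega_apply]
        exact pderiv_inl_inr_quadForm _ _ (wt := fun α β => d.boldWt H₂ α β x η) (hs η) α γ),
    Omega_apply, Omega_apply]
  have h2 := congrArg (MvPowerSeries.coeff a) (quadForm_commutator
    (w := fun α β => d.boldW H₂ α β x ξ) (e := fun α β => d.boldE H₂ α β x ξ)
    (t := fun α β => d.boldWt H₂ α β x ξ) (t' := fun α β => d.boldWt H₂ α β x η)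
    (w' := fun α β => d.boldW H₂ α β x η) (e' := fun α β => d.boldE H₂ α β x η) (hs ξ) (hs η))
  rw [map_smul, smul_eq_mul] at h2
  -- The source is isolated as a multiple of `[y λ̃]^2`. It equals the cubic vertex: two factors
  -- `1/2` from the vierbein terms cancel the coefficient `4`, leaving the `-1/4` from the
  -- derivatives of the zero-form.
  have h3 : (fun α β => extd (d.boldWt H₂ α β) x ξ η) = fun α β =>
      -contrWedge (d.boldWt H₂ α) (d.boldWt H₂ β) x ξ η -
        d.lamDeriv 3 H₂ x * wedge (d.null 1) (d.null 0) x ξ η * low (d.lamT x) α *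
          low (d.lamT x) β := by
    funext α β
    rw [extd_boldWt hU hH hx]
    simp only [Dyad.lt]
    ring
  rw [h2, h3, quadForm_sub, map_add (MvPowerSeries.coeff a),
    map_sub (MvPowerSeries.coeff a) (_ * _), map_sub (MvPowerSeries.coeff a) (quadForm _ _ _),
    MvPowerSeries.coeff_C_mul, MvPowerSeries.coeff_C_mul, MvPowerSeries.coeff_C_mul]
  simp only [rescale_pderiv_pderiv hB hx, extd_boldW hU hH hx, extd_boldE hU hH hx, contrWedge,
    wedge, map_smul, smul_eq_mul]
  have h4 : ∀ α ξ, d.null α x ξ =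
      d.boldE H₂ α 1 x ξ * d.lt 0 x - d.boldE H₂ α 0 x ξ * d.lt 1 x := fun α ξ => by
    linear_combination boldE_contr (d := d) (H₂ := H₂) α x ξ
  simp only [h4]
  ring

end ExactSolution

end ChiralHSGRA

end

/-! ### The proposition. -/

open ChiralHSGRA in
theorem proposition1 (U : Set Spacetime) (hU : IsOpen U) (b : FlatBackground U) (d : Dyad b)
    (H₂ : Spacetime → ℂ) (hH : IsProfile d H₂) :
    (∀ C : Spacetime → GenFun, d.HasSpinTwoForm C → ∀ x ∈ U,
      (∀ n, 4 ≤ n → ConvergesV n (d.Omega H₂ x) (C x) ∧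
        ∀ ξ η, vertexV n (d.Omega H₂ x) (C x) ξ η = 0) ∧
      (∀ n, 3 ≤ n → ConvergesU n (d.Omega H₂ x) (C x) ∧
        ∀ ξ, vertexU n (d.Omega H₂ x) (C x) ξ = 0)) ∧
    (∀ (ψ₂ : Spacetime → ℂ) (B : Spacetime → GenFun), IsNegHelicity d H₂ ψ₂ B →
      d.HasSpinTwoForm (fun x => d.Cplus H₂ x + B x) ∧
      IsExactSolution U (d.Omega H₂) (fun x => d.Cplus H₂ x + B x)) := by
  refine ⟨fun C hC x hx => ⟨fun n hn => ⟨convergesV_of_dottedForm n x (hC.dottedForm hx),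
      fun ξ η => vertexV_eq_zero hn x ξ η (hC.dottedForm hx)⟩,
    fun n hn => ⟨convergesU_of_dottedForm n x (hC.dottedForm hx),
      fun ξ => vertexU_eq_zero hn x ξ (hC.dottedForm hx)⟩⟩, fun ψ₂ B hB => ?_⟩
  have hform := hasSpinTwoForm_Cplus_add (H₂ := H₂) hB.form
  have hOmega : ∀ x ∈ U, ∀ η a, _ := fun x hx η a => hasFDerivAt_coeff_quadForm
    (w := fun α β z => d.boldW H₂ α β z η) (e := fun α β z => d.boldE H₂ α β z η)
    (wt := fun α β z => d.boldWt H₂ α β z η) (x := x)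
    (fun α β => (differentiableAt_boldW hU hH hx α β).clm_apply (differentiableAt_const η))
    (fun α β => (differentiableAt_boldE hU hH hx α β).clm_apply (differentiableAt_const η))
    (fun α β => (differentiableAt_boldWt hU hH hx α β).clm_apply (differentiableAt_const η)) a
  refine ⟨hform, ⟨fun ξ a x hx => ?_, fun a x hx => ?_,
    fun x hx n => convergesV_of_dottedForm n x (hform.dottedForm hx),
    fun x hx n => convergesU_of_dottedForm n x (hform.dottedForm hx),
    fun x hx ξ η a => ?_, fun x hx ξ a => ?_⟩⟩
  · simp only [Omega_apply]
    exact (hOmega x hx ξ a).1.differentiableWithinAt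
  · simp only [map_add]
    exact (hasFDerivAt_coeff_Cplus hU hH hx a).1.differentiableWithinAt.add
      (hB.differentiable a x hx)
  -- The index is shifted by two: only the quadratic and cubic vertices are nonzero.
  · have hsum := hasSum_sum_of_ne_finset_zero (L := .unconditional ℕ)
      (s := Finset.range 2)
      (f := fun n => MvPowerSeries.coeff a (vertexV (n + 2) (d.Omega H₂ x)
        (d.Cplus H₂ x + B x) ξ η)) fun n hn => by
      rw [vertexV_eq_zero (by have := Finset.mem_range.not.1 hn; omega) x ξ η
        (hform.dottedForm hx), map_zero]
    rw [Finset.sum_range_succ, Finset.sum_range_one] at hsum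
    convert hsum using 1
    rw [coeff_vertexV_Omega hU hH hB hx]
    simp only [Omega_apply]
    rw [(hOmega x hx η a).2, (hOmega x hx ξ a).2, coeff_quadForm, coeff_quadForm, coeff_quadForm]
    simp only [fderiv_eval (differentiableAt_boldW hU hH hx _ _),
      fderiv_eval (differentiableAt_boldE hU hH hx _ _),
      fderiv_eval (differentiableAt_boldWt hU hH hx _ _), extd, sub_mul, Finset.sum_sub_distrib]
    ring
  -- With a single one-form only the quadratic vertex remains, so the equation is linear and the two
  -- helicities separate.
  · have hsum := hasSum_sum_of_ne_finset_zero (L := .unconditional ℕ)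
      (s := Finset.range 1)
      (f := fun n => MvPowerSeries.coeff a (vertexU (n + 2) (d.Omega H₂ x)
        (d.Cplus H₂ x + B x) ξ)) fun n hn => by
      rw [vertexU_eq_zero (by have := Finset.mem_range.not.1 hn; omega) x ξ
        (hform.dottedForm hx), map_zero]
    rw [Finset.sum_range_one] at hsum
    convert hsum using 1
    rw [zero_add, coeff_vertexU_two_Omega (hform.dottedForm hx), translation_add, rotation_add,
      map_add, map_add]
    simp only [map_add]
    rw [fderiv_fun_add (hasFDerivAt_coeff_Cplus hU hH hx a).1
      ((hB.differentiable a).differentiableAt (hU.mem_nhds hx)), add_apply]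
    linear_combination linear_Cplus hU hH hx ξ a + hB.linear x hx ξ a
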